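/- Graphs are finite and may have parallel edges. A connected plane graph is regarded up to orientation-preserving homeomorphism of the sphere, i.e. it is given by its vertices, edges and the cyclic order of the edges at each vertex, subject to Euler's formula $|V|-|E|+|F|=2$; subgraphs and contractions inherit these cyclic orders. Let $G$ be a loopless connected plane graph whose vertices are coloured blue and red so that no edge joins two blue vertices. A red component $M$ is a connected component of the subgraph induced by the red vertices; the BR-component of $M$ is the plane subgraph induced by the vertices of $M$ and the blue vertices adjacent to $M$. $G$ is a BRT-graph if every face of every BR-component is a triangle or a digon (i.e. is bounded by a cycle with three or two edges). Vertex-cut. Let $v$ be a cut vertex of $G$, let $V_i$ $(i\in I)$ be the vertex sets of the components of $G\setminus v$, let $I_1\subsetneq I$ and $I_2=I\setminus I_1$. The vertex-cut yields the plane subgraphs $G_1,G_2$ induced by $\{v\}\cup\bigcup_{i\in I_j}V_i$, $j=1,2$. Normal cycle. A cycle $\gamma$ of $G$ is normal if it has at least two vertices and no three consecutive red vertices of $\gamma$ form an empty triangle: no two consecutive edges $uv,vw$ of $\gamma$ with $u,v,w$ red form, together with an edge $wu$ of $G$, the boundary of a face of $G$. Push-off. A push-off of $\gamma$ is a simple closed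 curve $\gamma'$ that meets $G$, crosses edges only transversely and finitely often, passes through the blue vertices of $\gamma$ and through no other vertex of $G$, and satisfies: edges with no red end on $\gamma$ are not crossed; an edge of $\gamma$ with a blue end is not crossed; an edge of $\gamma$ with two red ends is crossed at most once; an edge not on $\gamma$ is crossed at most once if exactly one of its ends is a red vertex of $\gamma$, and at most twice if both are; and no arc of $\gamma'$ between two successive crossings forms, together with a piece of an edge of $G$ between the same two points, an empty digon (one bounding a face of the graph $G^w$ defined next). Edge-cut. Let $G^w$ be the plane graph obtained from $G$ by inserting a white vertex at each crossing point of $\gamma'$ with an edge, and by adding the arcs of $\gamma'$ as edges. For each of the two sides of $\gamma'$, take the part of $G^w$ on $\gamma'$ and on that side, and contract $\gamma'$ to one new blue vertex $b$; then, for each blue vertex $w\ne b$ adjacent to $b$, contract one (arbitrarily chosen) edge between $w$ and $b$, the resulting vertex being blue; finally delete all loops. The two graphs $G_1,G_2$ so obtained are the result of the edge-cut of $G$ along $\gamma'$. Lemma. Let $G$ be a BRT-graph. If $G_1$ and $G_2$ are obtained from $G$ by a vertex-cut, or by an edge-cut along a push-off of a normal cycle (with any choice of the contracted blue–blue edges),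 then $G_1$ and $G_2$ are again BRT-graphs: each is a connected plane graph without loops and without blue–blue edges, and all of its BR-components are triangulated. -/

import Mathlib

open Classical in
/-- The first-return permutation of a permutation `σ` of a finite set to a subset `P`: each
`x ∈ P` goes to the first of `σ x, σ² x, …` that lies in `P`. Applied to a cyclic order, it is the
cyclic order inherited by a subset. -/
noncomputable def firstReturn {α : Type*} [Finite α] (σ : Equiv.Perm α) (P : Set α) :
    Equiv.Perm P :=
  have ex : ∀ x : P, ∃ n : ℕ, (σ ^ (n + 1)) x.1 ∈ P := fun x =>
    ⟨orderOf σ - 1, by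
      rw [Nat.sub_add_cancel (orderOf_pos σ), pow_orderOf_eq_one]; exact x.2⟩
  Equiv.ofBijective
    (fun x => (⟨(σ ^ (Nat.find (ex x) + 1)) x.1, Nat.find_spec (ex x)⟩ : P))
    (Finite.injective_iff_bijective.1 (by
      have key : ∀ x y : P, Nat.find (ex x) ≤ Nat.find (ex y) →
          (σ ^ (Nat.find (ex x) + 1)) x.1 = (σ ^ (Nat.find (ex y) + 1)) y.1 → x = y := by
        intro x y hle h
        obtain ⟨k, hk⟩ := Nat.exists_eq_add_of_le hle
        have h2 : (σ ^ (Nat.find (ex y) + 1)) y.1 =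
            (σ ^ (Nat.find (ex x) + 1)) ((σ ^ k) y.1) := by
          rw [← Equiv.Perm.mul_apply, ← pow_add]
          congr 2
          omega
        have h3 : x.1 = (σ ^ k) y.1 := (σ ^ (Nat.find (ex x) + 1)).injective (h.trans h2)
        rcases k with _ | k
        · exact Subtype.ext (by simpa using h3)
        · exact absurd (h3 ▸ x.2 : (σ ^ (k + 1)) y.1 ∈ P)
            (Nat.find_min (ex y) (by omega))
      intro x y h
      have h' := congrArg Subtype.val h
      rcases le_total (Nat.find (ex x)) (Nat.find (ex y)) with hle | hle
      · exact key x y hle h'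
      · exact (key y x hle h'.symm).symm))

/-- A coloured multigraph (loops and parallel edges allowed) with vertices `V` and darts (directed
edges) `D`, together with, at each vertex, a cyclic order of the darts leaving it: `tail d` is the
vertex that `d` leaves, `rev d` the same edge traversed backwards, and `rot d` the dart that follows
`d` counterclockwise around `tail d`. Vertices in `blue` are blue, all others are red.
That `rot` really is a cyclic order at each vertex is part of `IsPlane` below. -/
structure RotSys (V D : Type*) where
  tail : D → V
  rev : D → D
  rev_rev : ∀ d, rev (rev d) = d
  rev_ne : ∀ d, rev d ≠ d
  rot : Equiv.Perm D
  blue : Set V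

namespace RotSys

section Basic

variable {V D : Type*} (G : RotSys V D)

def head (d : D) : V := G.tail (G.rev d)

def red : Set V := G.blueᶜ

/-- Reversal as a permutation. -/
def revPerm : Equiv.Perm D := Function.Involutive.toPerm G.rev G.rev_rev

/-- The dart that follows `d` on the boundary walk of the face to the left of `d`:
arriving at `head d`, turn left as sharply as possible. The faces are the orbits. -/
def face : Equiv.Perm D := G.rot⁻¹ * G.revPerm

/-- The underlying simple graph (loops dropped, parallel edges identified). -/
def graph : SimpleGraph V where
  Adj u v := u ≠ v ∧ ∃ d, G.tail d = u ∧ G.head d = v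
  symm := ⟨fun u v h => ⟨h.1.symm, by
    obtain ⟨-, d, h1, h2⟩ := h
    exact ⟨G.rev d, h2, by rw [head, G.rev_rev, h1]⟩⟩⟩
  loopless := ⟨fun _ h => h.1 rfl⟩

/-- The number of faces of a connected drawing; a single vertex without edges has one face. -/
noncomputable def numFaces : ℕ :=
  open Classical in
  if IsEmpty D then 1 else Nat.card (Quotient (Equiv.Perm.SameCycle.setoid G.face))

/-- `G` is a connected plane graph, up to homeomorphism: `rot` is a cyclic order of the darts at
each vertex, the graph is connected, and Euler's formula `|V| - |E| + |F| = 2` holds, where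
`2 |E| = |D|` (the rotation system has genus `0`). -/
structure IsPlane : Prop where
  rot_iff : ∀ d e, G.rot.SameCycle d e ↔ G.tail d = G.tail e
  connected : G.graph.Connected
  euler : 2 * Nat.card V + 2 * G.numFaces = Nat.card D + 4

/-- Every face is a triangle or a digon: its boundary is a cycle of three or of two edges
(a single edge seen from both sides is not a digon, a single vertex is not triangulated). -/
def Triangulated : Prop :=
  Nonempty D ∧ ∀ d, (Function.minimalPeriod G.face d = 2 ∨ Function.minimalPeriod G.face d = 3) ∧
    G.face d ≠ G.rev d

/-- The darts of the edges that are given by a set of darts. -/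
def edgeDarts (S : Set D) : Set D := {d | d ∈ S ∨ G.rev d ∈ S}

open Classical in
/-- Reverse the darts of the edges in `S` and fix all the others. -/
noncomputable def flip (S : Set D) : Equiv.Perm D :=
  Function.Involutive.toPerm (fun d => if d ∈ G.edgeDarts S then G.rev d else d) (by
    intro d
    by_cases h : d ∈ G.edgeDarts S
    · have h' : G.rev d ∈ G.edgeDarts S := by
        rcases h with h | h
        · exact Or.inr (by rwa [G.rev_rev])
        · exact Or.inl h
      simp [h, h', G.rev_rev]
    · simp [h])

/-- The darts of the subgraph with vertex set `U` and edges taken from `P`. -/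
def subDarts (U : Set V) (P : Set D) : Set D :=
  {d | d ∈ P ∧ G.rev d ∈ P ∧ G.tail d ∈ U ∧ G.head d ∈ U}

/-- The plane subgraph with vertex set `U` whose edges are those in `P` with both ends in `U`;
the cyclic orders are inherited. -/
noncomputable def sub [Finite D] (U : Set V) (P : Set D) : RotSys U (G.subDarts U P) where
  tail d := ⟨G.tail d.1, d.2.2.2.1⟩
  rev d := ⟨G.rev d.1, d.2.2.1, by rw [G.rev_rev]; exact d.2.1, d.2.2.2.2, by
    rw [head, G.rev_rev]; exact d.2.2.2.1⟩
  rev_rev d := Subtype.ext (G.rev_rev d.1)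
  rev_ne d h := G.rev_ne d.1 (congrArg Subtype.val h)
  rot := firstReturn G.rot (G.subDarts U P)
  blue := {u | u.1 ∈ G.blue}

/-- The plane subgraph induced by a set of vertices. -/
noncomputable def induce [Finite D] (U : Set V) : RotSys U (G.subDarts U Set.univ) :=
  G.sub U Set.univ

/-- Delete all loop edges. -/
noncomputable def deleteLoops [Finite D] :
    RotSys (Set.univ : Set V) (G.subDarts Set.univ {d | G.tail d ≠ G.head d}) :=
  G.sub Set.univ {d | G.tail d ≠ G.head d}

/-- The vertices of the contraction of the edges in `S`. -/
def ContractVertex (S : Set D) : Type _ :=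
  Quot (fun u v : V => ∃ d ∈ G.edgeDarts S, G.tail d = u ∧ G.head d = v)

/-- Contract the edges in `S`. The cyclic order of the remaining darts at a new vertex is the order
in which they are met when one sweeps around the contracted subgraph: a contracted edge that is met
is followed to its other end, where the sweep goes on. A vertex created by the contraction is
blue; all other vertices keep their colour. -/
noncomputable def contract [Finite D] (S : Set D) :
    RotSys (G.ContractVertex S) ((G.edgeDarts S)ᶜ : Set D) where
  tail d := Quot.mk _ (G.tail d.1)
  rev d := ⟨G.rev d.1, fun h => d.2 (by
    rcases h with h | h
    · exact Or.inr h
    · exact Or.inl (by rwa [G.rev_rev] at h))⟩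
  rev_rev d := Subtype.ext (G.rev_rev d.1)
  rev_ne d h := G.rev_ne d.1 (congrArg Subtype.val h)
  rot := firstReturn (G.rot * G.flip S) (G.edgeDarts S)ᶜ
  blue := {q | ∃ v, Quot.mk _ v = q ∧ (v ∈ G.blue ∨ ∃ d ∈ G.edgeDarts S, G.tail d = v)}

/-- A red component: a connected component of the subgraph induced by the red vertices. -/
abbrev RedComponent : Type _ := (G.graph.induce G.red).ConnectedComponent

/-- The red vertices `V^R_M` of a red component. -/
def redPart (M : G.RedComponent) : Set V := Subtype.val '' M.supp

/-- `V^*_M`: the vertices of the red component and the blue vertices adjacent to one of them. -/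
def star (M : G.RedComponent) : Set V :=
  G.redPart M ∪ {v | v ∈ G.blue ∧ ∃ u ∈ G.redPart M, G.graph.Adj u v}

/-- BRT-graphs: connected plane graphs without loops and without blue-blue edges all of whose
BR-components are triangulated. -/
structure IsBRT [Finite D] : Prop where
  plane : G.IsPlane
  no_loop : ∀ d, G.tail d ≠ G.head d
  no_blue_blue : ∀ d, ¬ (G.tail d ∈ G.blue ∧ G.head d ∈ G.blue)
  triangulated : ∀ M : G.RedComponent, (G.induce (G.star M)).Triangulated

/-! ### Vertex-cuts -/

/-- `v` is a cut vertex of the connected graph `G`: deleting it disconnects the graph. -/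
def IsCutVertex (v : V) : Prop := ¬ (G.graph.induce ({v}ᶜ : Set V)).Preconnected

/-- The connected components of `G` with `v` deleted. -/
abbrev Branch (v : V) : Type _ := (G.graph.induce ({v}ᶜ : Set V)).ConnectedComponent

/-- `v` together with the vertices of the components in `I`. -/
def branchSet (v : V) (I : Set (G.Branch v)) : Set V :=
  {x | x = v ∨ ∃ h : x ∈ ({v}ᶜ : Set V),
    (G.graph.induce ({v}ᶜ : Set V)).connectedComponentMk ⟨x, h⟩ ∈ I}

/-! ### Cycles -/

/-- A cycle, as the cyclic sequence of its darts (one loop and two parallel edges are cycles). -/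
structure IsCycle {n : ℕ} [NeZero n] (c : Fin n → D) : Prop where
  next : ∀ i, G.head (c i) = G.tail (c (i + 1))
  vertex_inj : Function.Injective fun i => G.tail (c i)
  edge_ne : ∀ i j, c i ≠ G.rev (c j)

/-- The consecutive darts `d, d'` are two sides of an empty triangle: together with a third dart
they bound a face, which lies to their left or to their right. -/
def EmptyTriangle (d d' : D) : Prop :=
  ∃ e, (G.face d = d' ∧ G.face d' = e ∧ G.face e = d) ∨
    (G.face (G.rev d') = G.rev d ∧ G.face (G.rev d) = G.rev e ∧ G.face (G.rev e) = G.rev d')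

/-- Normal cycles: at least two vertices, and no three consecutive red vertices of the cycle form
an empty triangle. -/
structure IsNormalCycle {n : ℕ} [NeZero n] (c : Fin n → D) : Prop where
  cycle : G.IsCycle c
  two_le : 2 ≤ n
  no_empty_triangle : ∀ i, G.tail (c i) ∈ G.red → G.tail (c (i + 1)) ∈ G.red →
    G.tail (c (i + 1 + 1)) ∈ G.red → ¬ G.EmptyTriangle (c i) (c (i + 1))

/-- The vertices of a cycle. -/
def cycleVertices {n : ℕ} (c : Fin n → D) : Set V := Set.range fun i => G.tail (c i)

/-- The darts of the edges of a cycle, in both directions. -/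
def cycleDarts {n : ℕ} (c : Fin n → D) : Set D := G.edgeDarts (Set.range c)

/-! ### The two sides of a cycle -/

/-- The darts lying in the faces that can be reached from the faces of the darts in `A` without
crossing an edge of `C` (a dart lies in the face to its left). -/
def region (C A : Set D) : Set D :=
  {e | ∃ a ∈ A, Relation.EqvGen
    (fun x y => y = G.face x ∨ (x ∉ C ∧ y = G.rev x)) a e}

/-- Everything on or to the left of the cycle `c` (resp. to its right, for `left = false`). -/
def closedSideDarts {n : ℕ} (c : Fin n → D) (left : Bool) : Set D :=
  G.cycleDarts c ∪ G.region (G.cycleDarts c)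
    (Set.range fun i => if left = true then c i else G.rev (c i))

/-- The vertices on the cycle `c` or on the given side of it. -/
def closedSideVertices {n : ℕ} (c : Fin n → D) (left : Bool) : Set V :=
  G.tail '' G.closedSideDarts c left

/-- The plane graph formed by the cycle `c` and all that lies on the given side of it. -/
noncomputable def closedSide [Finite D] {n : ℕ} (c : Fin n → D) (left : Bool) :
    RotSys (G.closedSideVertices c left)
      (G.subDarts (G.closedSideVertices c left) (G.closedSideDarts c left)) :=
  G.sub (G.closedSideVertices c left) (G.closedSideDarts c left)

end Basic

/-! ### Push-offs and edge-cuts -/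

/-- A simple closed curve `γ'` drawn on the plane graph `G`, avoiding the red vertices and crossing
the edges transversely, at finitely many points. It is given by the plane graph `H` (`G^w` in the
usual notation) that arises from `G` by placing a white vertex (elements of `W`) at each
crossing point and adding the arcs of the curve as edges; the curve is the cycle `curve` of `H`. -/
structure Overlay {V D : Type*} (G : RotSys V D) (W E : Type*) [Finite E] where
  H : RotSys (V ⊕ W) E
  plane : H.IsPlane
  blue_eq : H.blue = Sum.inl '' G.blue
  len : ℕ
  curve : Fin (len + 1) → E
  cycle : H.IsCycle curve
  /-- The curve avoids the red vertices of `G`. -/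
  avoids_red : ∀ v ∈ G.red, Sum.inl v ∉ H.cycleVertices curve
  /-- The white vertices lie on the curve. -/
  white_mem : ∀ w : W, Sum.inr w ∈ H.cycleVertices curve
  /-- At each white vertex four darts meet: the curve and one edge of `G`, crossing transversely. -/
  white_card : ∀ w : W, Nat.card {e // H.tail e = Sum.inr w} = 4
  white_cross : ∀ (w : W) (e : E), H.tail e = Sum.inr w →
    (H.rot e ∈ H.cycleDarts curve ↔ e ∉ H.cycleDarts curve)
  /-- The successive pieces into which the white vertices cut the dart `d` of `G`. -/
  pieces : D → List E
  pieces_ne_nil : ∀ d, pieces d ≠ []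
  pieces_rev : ∀ d, pieces (G.rev d) = ((pieces d).map H.rev).reverse
  pieces_nodup : ∀ d, (pieces d).Nodup
  /-- The edges of `H` are the arcs of the curve and the pieces of the edges of `G`. -/
  mem_pieces : ∀ e, (∃ d, e ∈ pieces d) ↔ e ∉ H.cycleDarts curve
  pieces_unique : ∀ d d' e, e ∈ pieces d → e ∈ pieces d' → d = d'
  /-- The pieces of `d` form a path from `tail d` on whose inner vertices are white. -/
  pieces_tail : ∀ d, H.tail ((pieces d).head (pieces_ne_nil d)) = Sum.inl (G.tail d)
  pieces_chain : ∀ d, (pieces d).IsChain fun e e' =>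
    ∃ w : W, H.head e = Sum.inr w ∧ H.tail e' = Sum.inr w
  /-- The cyclic orders of `G` are inherited from `H`. -/
  pieces_rot : ∀ d, ∀ h : (pieces d).head (pieces_ne_nil d) ∈ (H.cycleDarts curve)ᶜ,
    (firstReturn H.rot (H.cycleDarts curve)ᶜ ⟨(pieces d).head (pieces_ne_nil d), h⟩).1 =
      (pieces (G.rot d)).head (pieces_ne_nil (G.rot d))

section EdgeCut

variable {V D W E : Type*} [Finite E] {G : RotSys V D}

/-- How often the curve crosses the edge of `d`. -/
def Overlay.crossings (O : G.Overlay W E) (d : D) : ℕ := (O.pieces d).length - 1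

/-- The red vertices of the cycle `γ`. -/
def redOn (G : RotSys V D) {n : ℕ} (γ : Fin n → D) : Set V := G.cycleVertices γ ∩ G.red

/-- The curve is a push-off of the cycle `γ`. -/
structure Overlay.IsPushOff (O : G.Overlay W E) {n : ℕ} (γ : Fin n → D) : Prop where
  /-- The vertices of `G` that the curve passes through are the blue vertices of `γ`. -/
  through : ∀ v, Sum.inl v ∈ O.H.cycleVertices O.curve ↔ v ∈ G.cycleVertices γ ∧ v ∈ G.blue
  /-- `γ` is pushed by a small distance only: edges without a red end on `γ` are not crossed. -/
  near : ∀ d, G.tail d ∉ G.redOn γ → G.head d ∉ G.redOn γ → O.crossings d = 0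
  on_blue : ∀ d ∈ G.cycleDarts γ, G.tail d ∈ G.blue ∨ G.head d ∈ G.blue → O.crossings d = 0
  on_red : ∀ d ∈ G.cycleDarts γ, G.tail d ∈ G.red → G.head d ∈ G.red → O.crossings d ≤ 1
  off_one : ∀ d ∉ G.cycleDarts γ, Xor (G.tail d ∈ G.redOn γ) (G.head d ∈ G.redOn γ) →
    O.crossings d ≤ 1
  off_two : ∀ d ∉ G.cycleDarts γ, G.tail d ∈ G.redOn γ → G.head d ∈ G.redOn γ →
    O.crossings d ≤ 2
  /-- No empty digon: no arc of the curve and piece of an edge, both joining the same two white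
  vertices, bound a face. -/
  no_empty_digon : ∀ a ∈ O.H.cycleDarts O.curve, ∀ e ∉ O.H.cycleDarts O.curve,
    (∃ w : W, O.H.tail a = Sum.inr w) → (∃ w : W, O.H.tail e = Sum.inr w) →
    ¬ (O.H.face a = e ∧ O.H.face e = a)

/-- The edges of the curve, within the closed side. -/
def Overlay.sideCurve (O : G.Overlay W E) (left : Bool) :
    Set (O.H.subDarts (O.H.closedSideVertices O.curve left)
      (O.H.closedSideDarts O.curve left)) :=
  {e | e.1 ∈ O.H.cycleDarts O.curve}

/-- The graph `G'_i` on one side of the curve: of all that lies on the curve or on that side of it,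
the curve is contracted to one new blue vertex. -/
noncomputable def Overlay.contracted (O : G.Overlay W E) (left : Bool) :
    RotSys ((O.H.closedSide O.curve left).ContractVertex (O.sideCurve left))
      (((O.H.closedSide O.curve left).edgeDarts (O.sideCurve left))ᶜ : Set _) :=
  (O.H.closedSide O.curve left).contract (O.sideCurve left)

/-- The new blue vertex of `G'_i`. -/
def Overlay.newVertex (O : G.Overlay W E) (left : Bool) :
    (O.H.closedSide O.curve left).ContractVertex (O.sideCurve left) :=
  Quot.mk _ ⟨O.H.tail (O.curve 0), O.curve 0, Or.inl (Or.inl ⟨0, rfl⟩), rfl⟩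

/-- `T` picks, for each blue vertex `w ≠ b` that is adjacent to `b`, one edge from `w` to `b`. -/
structure IsBlueChoice (G : RotSys V D) (b : V) (T : Set D) : Prop where
  mem : ∀ d ∈ T, G.tail d ∈ G.blue ∧ G.tail d ≠ b ∧ G.head d = b
  existsUnique : ∀ w ∈ G.blue, w ≠ b → (∃ d, G.tail d = w ∧ G.head d = b) →
    ∃! d, d ∈ T ∧ G.tail d = w

/-- The graph `G_i` of an edge-cut: in `G'_i`, contract the picked blue-blue edges `T`, one for each
blue neighbour of the new vertex, and then delete all loop edges. -/
noncomputable def Overlay.edgeCut (O : G.Overlay W E) (left : Bool)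
    (T : Set (((O.H.closedSide O.curve left).edgeDarts (O.sideCurve left))ᶜ : Set _)) :=
  ((O.contracted left).contract T).deleteLoops

end EdgeCut

end RotSys

/-! ### First-return permutations. -/

section FirstReturn

variable {α : Type*} [Finite α] (σ : Equiv.Perm α) (P : Set α)

/-! Planarity is handled without counting faces. In the space of antisymmetric functions on darts,
of dimension |E|, the differences of vertex functions and those of face functions form orthogonal
subspaces, of dimensions |V| - 1 and |F| - 1 for a connected graph. Euler's formula says exactly
that they fill the space. Hence it is equivalent to `FlowExact` (every circulation is a difference
of face functions) and to `CoflowExact` (the dual statement). Extension by zero shows that the first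
passes to subgraphs and the second to contractions. So an edge-cut is plane once each contracted
vertex is known to have a single cyclic order. `FlowExact` also yields the Jordan curve theorem
`IsPlane.rev_notMem_region`: the unit flow around a cycle is the jump of a winding number.

Triangulation is made local. A BR-component contains every dart at its red vertices, so it has the
same corners there as the whole graph. `LocallyTriangulated` expresses the BRT condition by these
corners alone. The converse direction must close a face at its blue corner β: whatever lies inside
the face hangs on β only (`IsPlane.pocket`), hence belongs to other red components.

For a vertex-cut, consecutive neighbours of a red vertex are equal or adjacent, so a red vertex
never separates the graph. The cut vertex is therefore blue and every red corner survives unchanged.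

For an edge-cut, red corners survive too, but a crossed edge now ends at the new blue vertex b. The
curve cannot enter a union of faces through one edge and get stuck there
(`Overlay.no_isolated_crossing`). Therefore a red face with one crossed edge has a second one. If
the red edge of a triangle with a blue corner is crossed, then the curve passes through that corner
or crosses an edge there, so the corner is merged into b. In every case the new corner is again one
of a digon or a triangle. -/

theorem firstReturn_spec (x : P) : ∃ k : ℕ, (firstReturn σ P x).1 = (σ ^ (k + 1)) x.1 ∧
    ∀ m < k, (σ ^ (m + 1)) x.1 ∉ P := by
  classical
  have ex : ∃ n : ℕ, (σ ^ (n + 1)) x.1 ∈ P := ⟨orderOf σ - 1, by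
    rw [Nat.sub_add_cancel (orderOf_pos σ), pow_orderOf_eq_one]; exact x.2⟩
  refine ⟨Nat.find ex, ?_, fun m hm => Nat.find_min ex hm⟩
  simp only [firstReturn, Equiv.ofBijective_apply]

variable {σ P}

theorem firstReturn_eq_of_mem {x : P} (h : σ x.1 ∈ P) : (firstReturn σ P x).1 = σ x.1 := by
  obtain ⟨k, hk, hm⟩ := firstReturn_spec σ P x
  rcases k with _ | k
  · simpa using hk
  · exact absurd (by simpa using h) (hm 0 (Nat.succ_pos k))

/-- A property that holds at `σ x` and is passed on by `σ` outside `P` holds at the first return. -/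
theorem firstReturn_induct {Q : α → Prop} {x : P} (h0 : Q (σ x.1))
    (hs : ∀ y ∉ P, Q y → Q (σ y)) : Q (firstReturn σ P x).1 := by
  obtain ⟨k, hk, hm⟩ := firstReturn_spec σ P x
  rw [hk]
  have : ∀ m ≤ k, Q ((σ ^ (m + 1)) x.1) := by
    intro m
    induction m with
    | zero => intro _; simpa using h0
    | succ m ih =>
      intro hle
      rw [pow_succ', Equiv.Perm.mul_apply]
      exact hs _ (hm m (by omega)) (ih (by omega))
  exact this k le_rfl

/-- The way back passes through the same points in reverse order, none of which lies in `P` before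
the end. This turns the face permutation of a subgraph or contraction into a first return of the
inverse rotation. -/
theorem firstReturn_inv_apply (x : P) : (firstReturn σ P)⁻¹ x = firstReturn σ⁻¹ P x := by
  rw [Equiv.Perm.inv_eq_iff_eq]
  set y := firstReturn σ⁻¹ P x with hy
  obtain ⟨k, hk, hm⟩ := firstReturn_spec σ⁻¹ P x
  obtain ⟨j, hj, hn⟩ := firstReturn_spec σ P y
  have hyx : ∀ i, i ≤ k + 1 → (σ ^ i) y.1 = (σ⁻¹ ^ (k + 1 - i)) x.1 := by
    intro i hi
    rw [hk, ← Equiv.Perm.mul_apply]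
    congr 1
    obtain ⟨l, hl⟩ := Nat.exists_eq_add_of_le hi
    rw [hl, Nat.add_sub_cancel_left, pow_add, inv_pow, inv_pow, mul_inv_cancel_left]
  apply Subtype.ext
  have hjk : j ≤ k := by
    by_contra hlt
    refine hn k (by omega) ?_
    rw [hyx _ le_rfl]
    simp
  rw [hj, hyx _ (by omega)]
  rcases hjk.lt_or_eq with hlt | rfl
  · exfalso
    have h := hm (k + 1 - (j + 1) - 1) (by omega)
    rw [Nat.sub_add_cancel (by omega), ← hyx _ (by omega), ← hj] at h
    exact h (firstReturn σ P y).2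
  · simp

theorem Equiv.Perm.SameCycle.induct {Q : α → Prop} {x y : α} (h : σ.SameCycle x y) (hx : Q x)
    (hs : ∀ z, Q z → Q (σ z)) : Q y := by
  obtain ⟨i, -, rfl⟩ := h.exists_pow_eq'
  clear h
  induction i with
  | zero => simpa using hx
  | succ i ih =>
    rw [pow_succ', Equiv.Perm.mul_apply]
    exact hs _ ih

/-- Cycles of the first return are the traces on `P` of cycles of `σ`: a path of `n` steps that ends
in `P` is cut at its first visit to `P`, and the rest is shorter. -/
theorem firstReturn_sameCycle_iff {x y : P} :
    (firstReturn σ P).SameCycle x y ↔ σ.SameCycle x.1 y.1 := by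
  constructor
  · intro h
    refine h.induct (Q := fun y : P => σ.SameCycle x.1 y.1) (Equiv.Perm.SameCycle.refl _ _) ?_
    intro z hz
    refine firstReturn_induct (Q := fun w => σ.SameCycle x.1 w) ?_ ?_
    · exact Equiv.Perm.sameCycle_apply_right.2 hz
    · exact fun w _ hw => Equiv.Perm.sameCycle_apply_right.2 hw
  · intro h
    obtain ⟨n, -, hn⟩ := h.exists_pow_eq'
    clear h
    induction n using Nat.strong_induction_on generalizing x with
    | _ n ih =>
      rcases n with _ | n
      · have : x = y := Subtype.ext (by simpa using hn)
        rw [this]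
      · obtain ⟨k, hk, hm⟩ := firstReturn_spec σ P x
        have hkn : k ≤ n := by
          by_contra hlt
          exact hm n (by omega) (hn ▸ y.2)
        have h2 : (σ ^ (n - k)) (firstReturn σ P x).1 = y.1 := by
          rw [hk, ← Equiv.Perm.mul_apply, ← pow_add, ← hn]
          congr 2
          omega
        exact Equiv.Perm.sameCycle_apply_left.1 (ih (n - k) (by omega) h2)

end FirstReturn

/-! ### Elementary facts on rotation systems, and induction principles for rotation and
connectivity. -/

namespace RotSys

section Basic

variable {V D : Type*} (G : RotSys V D)

theorem revPerm_apply (d : D) : G.revPerm d = G.rev d := rfl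

theorem face_apply (d : D) : G.face d = G.rot⁻¹ (G.rev d) := rfl

theorem rot_face (d : D) : G.rot (G.face d) = G.rev d := by simp [face_apply]

theorem rot_inv_apply (d : D) : G.rot⁻¹ d = G.face (G.rev d) := by
  rw [face_apply, G.rev_rev]

theorem head_rev (d : D) : G.head (G.rev d) = G.tail d := by rw [head, G.rev_rev]

theorem tail_rev (d : D) : G.tail (G.rev d) = G.head d := rfl

theorem rev_injective : Function.Injective G.rev := fun a b h => by
  rw [← G.rev_rev a, h, G.rev_rev]

theorem rev_eq_comm {a b : D} : G.rev a = b ↔ a = G.rev b :=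
  ⟨fun h => by rw [← h, G.rev_rev], fun h => by rw [h, G.rev_rev]⟩

theorem mem_edgeDarts_rev {S : Set D} {d : D} : G.rev d ∈ G.edgeDarts S ↔ d ∈ G.edgeDarts S := by
  change _ ∨ _ ↔ _ ∨ _
  rw [G.rev_rev]
  exact or_comm

theorem flip_of_mem {S : Set D} {d : D} (h : d ∈ G.edgeDarts S) : G.flip S d = G.rev d := by
  classical exact if_pos h

theorem flip_of_notMem {S : Set D} {d : D} (h : d ∉ G.edgeDarts S) : G.flip S d = d := by
  classical exact if_neg h

theorem flip_flip {S : Set D} (d : D) : G.flip S (G.flip S d) = d := by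
  by_cases h : d ∈ G.edgeDarts S
  · rw [G.flip_of_mem h, G.flip_of_mem (G.mem_edgeDarts_rev.2 h), G.rev_rev]
  · rw [G.flip_of_notMem h, G.flip_of_notMem h]

theorem flip_inv {S : Set D} (d : D) : (G.flip S)⁻¹ d = G.flip S d := by
  rw [Equiv.Perm.inv_eq_iff_eq, flip_flip]

/-- Rotation preserves tails. -/
def TailRot : Prop := ∀ d, G.tail (G.rot d) = G.tail d

variable {G}

theorem IsPlane.tailRot (h : G.IsPlane) : G.TailRot := fun d =>
  ((h.rot_iff _ _).1 (Equiv.Perm.sameCycle_apply_right.2 (Equiv.Perm.SameCycle.refl _ d))).symm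

theorem TailRot.inv (h : G.TailRot) (d : D) : G.tail (G.rot⁻¹ d) = G.tail d := by
  have h1 := h (G.rot⁻¹ d)
  rwa [← Equiv.Perm.mul_apply, mul_inv_cancel, Equiv.Perm.one_apply, eq_comm] at h1

theorem TailRot.tail_face (h : G.TailRot) (d : D) : G.tail (G.face d) = G.head d := by
  rw [face_apply, h.inv, tail_rev]

/-- A property of darts that is passed on by rotation holds at all darts of a vertex. -/
theorem IsPlane.rot_induct [Finite D] (h : G.IsPlane) {Q : D → Prop} {d e : D}
    (hde : G.tail d = G.tail e) (hd : Q d) (hs : ∀ z, Q z → G.tail z = G.tail d → Q (G.rot z)) :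
    Q e :=
  (Equiv.Perm.SameCycle.induct ((h.rot_iff d e).2 hde)
    (Q := fun z => Q z ∧ G.tail z = G.tail d) ⟨hd, rfl⟩
    (fun z hz => ⟨hs z hz.1 hz.2, by rw [h.tailRot, hz.2]⟩)).1

theorem IsPlane.rot_inv_induct [Finite D] (h : G.IsPlane) {Q : D → Prop} {d e : D}
    (hde : G.tail d = G.tail e) (hd : Q d)
    (hs : ∀ z, Q z → G.tail z = G.tail d → Q (G.rot⁻¹ z)) : Q e :=
  (Equiv.Perm.SameCycle.induct (Equiv.Perm.sameCycle_inv.2 ((h.rot_iff d e).2 hde))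
    (Q := fun z => Q z ∧ G.tail z = G.tail d) ⟨hd, rfl⟩
    (fun z hz => ⟨hs z hz.1 hz.2, by rw [h.tailRot.inv, hz.2]⟩)).1

/-- Connectivity: a property of one vertex that is passed on by darts holds everywhere. -/
theorem connected_iff : G.graph.Connected ↔ ∃ v₀, ∀ p : V → Prop, p v₀ →
    (∀ d, p (G.tail d) → p (G.head d)) → ∀ v, p v := by
  rw [SimpleGraph.connected_iff_exists_forall_reachable]
  refine exists_congr fun v₀ => ⟨fun h p h0 hp v => ?_, fun h => ?_⟩
  · obtain ⟨w⟩ := h v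
    clear h
    induction w with
    | nil => exact h0
    | cons hadj _ ih =>
      obtain ⟨-, d, rfl, rfl⟩ := hadj
      exact ih (hp d h0)
  · refine h _ (SimpleGraph.Reachable.refl _) fun d hd => ?_
    by_cases heq : G.tail d = G.head d
    · rwa [← heq]
    · exact hd.trans (SimpleGraph.Adj.reachable ⟨heq, d, rfl, rfl⟩)

/-- The base vertex in `connected_iff` is fixed, here the start is arbitrary. Since darts can be
reversed, the negation of `p` is passed on as well, so a failure at the base vertex would spread to
`u`. -/
theorem connected_induct (h : G.graph.Connected) {p : V → Prop} {u : V} (hu : p u)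
    (hp : ∀ d, p (G.tail d) → p (G.head d)) (v : V) : p v := by
  obtain ⟨v₀, h0⟩ := connected_iff.1 h
  by_cases hv : p v₀
  · exact h0 p hv hp v
  · exfalso
    refine h0 (fun v => ¬ p v) hv (fun d hd hd' => hd ?_) u hu
    have := hp (G.rev d) hd'
    rwa [head_rev] at this

end Basic

end RotSys

/-! ### Euler's formula as exactness of flows and coflows. -/

namespace RotSys

section Planarity

variable {V D : Type*} (G : RotSys V D)

/-- Every antisymmetric function on darts whose sum at each vertex vanishes is the difference of a
function on faces: the first homology vanishes. -/
def FlowExact : Prop := ∀ f : D → ℝ, (∀ d, f (G.rev d) = -f d) →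
  (∀ p : V → ℝ, ∑ᶠ d, f d * p (G.tail d) = 0) →
  ∃ g : D → ℝ, (∀ d, g (G.face d) = g d) ∧ ∀ d, f d = g d - g (G.rev d)

/-- Every antisymmetric function on darts whose sum along each face vanishes is the difference of a
function on vertices: the first cohomology vanishes. -/
def CoflowExact : Prop := ∀ f : D → ℝ, (∀ d, f (G.rev d) = -f d) →
  (∀ g : D → ℝ, (∀ d, g (G.face d) = g d) → ∑ᶠ d, f d * g d = 0) →
  ∃ p : V → ℝ, ∀ d, f d = p (G.head d) - p (G.tail d)

/-- Antisymmetric functions on darts. -/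
def antisymm : Submodule ℝ (EuclideanSpace ℝ D) where
  carrier := {f | ∀ d, f (G.rev d) = -f d}
  add_mem' := fun {f g} hf hg d => by
    have h1 : f (G.rev d) = -f d := hf d
    have h2 : g (G.rev d) = -g d := hg d
    simp only [PiLp.add_apply, h1, h2]
    ring
  zero_mem' := fun d => by simp
  smul_mem' := fun c f hf d => by
    have h1 : f (G.rev d) = -f d := hf d
    simp only [PiLp.smul_apply, h1, smul_neg]

theorem mem_antisymm {f : EuclideanSpace ℝ D} : f ∈ G.antisymm ↔ ∀ d, f (G.rev d) = -f d :=
  Iff.rfl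

/-- The difference of a function on vertices. -/
def vertexDiff : (V → ℝ) →ₗ[ℝ] EuclideanSpace ℝ D where
  toFun p := WithLp.toLp 2 fun d => p (G.head d) - p (G.tail d)
  map_add' p q := by
    ext d
    simp only [Pi.add_apply, PiLp.add_apply]
    ring
  map_smul' c p := by
    ext d
    simp only [Pi.smul_apply, PiLp.smul_apply, smul_eq_mul, RingHom.id_apply]
    ring

/-- The faces. -/
abbrev FaceOrbit : Type _ := Quotient (Equiv.Perm.SameCycle.setoid G.face)

/-- The difference of a function on faces. -/
def faceDiff : (G.FaceOrbit → ℝ) →ₗ[ℝ] EuclideanSpace ℝ D where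
  toFun p := WithLp.toLp 2 fun d => p ⟦d⟧ - p ⟦G.rev d⟧
  map_add' p q := by
    ext d
    simp only [Pi.add_apply, PiLp.add_apply]
    ring
  map_smul' c p := by
    ext d
    simp only [Pi.smul_apply, PiLp.smul_apply, smul_eq_mul, RingHom.id_apply]
    ring

theorem vertexDiff_apply (p : V → ℝ) (d : D) :
    G.vertexDiff p d = p (G.head d) - p (G.tail d) := rfl

theorem faceDiff_apply (p : G.FaceOrbit → ℝ) (d : D) :
    G.faceDiff p d = p ⟦d⟧ - p ⟦G.rev d⟧ := rfl

theorem mk_face (d : D) : (⟦G.face d⟧ : G.FaceOrbit) = ⟦d⟧ :=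
  Quotient.sound (Equiv.Perm.sameCycle_apply_left.2 (Equiv.Perm.SameCycle.refl _ _))

theorem exists_lift_of_face_invariant [Finite D] {β : Type*} {g : D → β}
    (hg : ∀ d, g (G.face d) = g d) : ∃ p : G.FaceOrbit → β, ∀ d, p ⟦d⟧ = g d :=
  ⟨Quotient.lift g fun _ b hab => (Equiv.Perm.SameCycle.induct (Q := fun y => g y = g b)
    (Equiv.Perm.SameCycle.symm hab) rfl fun z hz => by rw [hg, hz]), fun _ => rfl⟩

theorem vertexDiff_range_le : LinearMap.range G.vertexDiff ≤ G.antisymm := by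
  rintro _ ⟨p, rfl⟩ d
  simp [vertexDiff_apply, head_rev, tail_rev]

theorem faceDiff_range_le : LinearMap.range G.faceDiff ≤ G.antisymm := by
  rintro _ ⟨p, rfl⟩ d
  simp [faceDiff_apply, G.rev_rev]

variable [Fintype D]

/-- Summation by parts: orthogonality to all vertex differences means conservation at each vertex.
Likewise `inner_faceDiff` translates orthogonality to face differences into vanishing sums along
faces. -/
theorem inner_vertexDiff {f : EuclideanSpace ℝ D} (hf : f ∈ G.antisymm) (p : V → ℝ) :
    inner ℝ (G.vertexDiff p) f = -2 * ∑ d, f d * p (G.tail d) := by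
  have h1 : ∑ d, f d * p (G.head d) = -∑ d, f d * p (G.tail d) := by
    rw [← Equiv.sum_comp G.revPerm, ← Finset.sum_neg_distrib]
    refine Finset.sum_congr rfl fun d _ => ?_
    rw [revPerm_apply, head_rev, (G.mem_antisymm.1 hf), neg_mul]
  rw [PiLp.inner_apply]
  simp only [vertexDiff_apply, RCLike.inner_apply, conj_trivial, mul_sub, Finset.sum_sub_distrib, h1]
  ring

theorem inner_faceDiff {f : EuclideanSpace ℝ D} (hf : f ∈ G.antisymm) (p : G.FaceOrbit → ℝ) :
    inner ℝ (G.faceDiff p) f = 2 * ∑ d, f d * p ⟦d⟧ := by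
  have h1 : ∑ d, f d * p ⟦G.rev d⟧ = -∑ d, f d * p ⟦d⟧ := by
    rw [← Equiv.sum_comp G.revPerm, ← Finset.sum_neg_distrib]
    refine Finset.sum_congr rfl fun d _ => ?_
    rw [revPerm_apply, G.rev_rev, (G.mem_antisymm.1 hf), neg_mul]
  rw [PiLp.inner_apply]
  simp only [faceDiff_apply, RCLike.inner_apply, conj_trivial, mul_sub, Finset.sum_sub_distrib, h1]
  ring

variable {G}

/-- Along a face the head of each dart is the tail of the next one, so the sum of a vertex
difference around a face telescopes. -/
theorem TailRot.inner_eq_zero (h : G.TailRot) (p : V → ℝ) (q : G.FaceOrbit → ℝ) :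
    inner ℝ (G.faceDiff q) (G.vertexDiff p) = 0 := by
  rw [G.inner_faceDiff (G.vertexDiff_range_le ⟨p, rfl⟩)]
  have h1 : ∑ d, p (G.tail d) * q ⟦d⟧ = ∑ d, p (G.head d) * q ⟦d⟧ := by
    rw [← Equiv.sum_comp G.face]
    exact Finset.sum_congr rfl fun d _ => by rw [h.tail_face, mk_face]
  simp [vertexDiff_apply, sub_mul, Finset.sum_sub_distrib, h1]

theorem TailRot.faceDiff_range_le_orthogonal (h : G.TailRot) :
    LinearMap.range G.faceDiff ≤ (LinearMap.range G.vertexDiff)ᗮ ⊓ G.antisymm := by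
  refine le_inf ?_ G.faceDiff_range_le
  rintro _ ⟨q, rfl⟩
  rw [Submodule.mem_orthogonal]
  rintro _ ⟨p, rfl⟩
  rw [real_inner_comm, h.inner_eq_zero]

theorem TailRot.vertexDiff_range_le_orthogonal (h : G.TailRot) :
    LinearMap.range G.vertexDiff ≤ (LinearMap.range G.faceDiff)ᗮ ⊓ G.antisymm := by
  refine le_inf ?_ G.vertexDiff_range_le
  rintro _ ⟨q, rfl⟩
  rw [Submodule.mem_orthogonal]
  rintro _ ⟨p, rfl⟩
  rw [h.inner_eq_zero]

/-- Restates exactness as an equality of subspaces, one inclusion of which always holds, so that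
only dimensions remain to be compared. -/
theorem TailRot.flowExact_iff (h : G.TailRot) : G.FlowExact ↔
    LinearMap.range G.faceDiff = (LinearMap.range G.vertexDiff)ᗮ ⊓ G.antisymm := by
  constructor
  · intro hx
    refine le_antisymm h.faceDiff_range_le_orthogonal ?_
    rintro f ⟨hf1, hf2⟩
    obtain ⟨g, hg, hfg⟩ := hx f hf2 (fun p => by
      have h1 := (Submodule.mem_orthogonal _ _).1 hf1 _ ⟨p, rfl⟩
      rw [G.inner_vertexDiff hf2] at h1
      rw [finsum_eq_sum_of_fintype]
      linarith)
    obtain ⟨q, hq⟩ := G.exists_lift_of_face_invariant hg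
    refine ⟨q, ?_⟩
    ext d
    rw [faceDiff_apply, hq, hq, hfg]
  · intro hx f hf hp
    have hmem : WithLp.toLp 2 f ∈ (LinearMap.range G.vertexDiff)ᗮ ⊓ G.antisymm := by
      have hanti : WithLp.toLp 2 f ∈ G.antisymm := hf
      refine ⟨(Submodule.mem_orthogonal _ _).2 ?_, hanti⟩
      rintro _ ⟨p, rfl⟩
      have h1 := hp p
      rw [finsum_eq_sum_of_fintype] at h1
      rw [G.inner_vertexDiff hanti]
      simp [h1]
    rw [← hx] at hmem
    obtain ⟨q, hq⟩ := hmem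
    refine ⟨fun d => q ⟦d⟧, fun d => congrArg q (G.mk_face d), fun d => ?_⟩
    rw [← faceDiff_apply, hq]

theorem TailRot.coflowExact_iff (h : G.TailRot) : G.CoflowExact ↔
    LinearMap.range G.vertexDiff = (LinearMap.range G.faceDiff)ᗮ ⊓ G.antisymm := by
  constructor
  · intro hx
    refine le_antisymm h.vertexDiff_range_le_orthogonal ?_
    rintro f ⟨hf1, hf2⟩
    obtain ⟨p, hp⟩ := hx f hf2 (fun g hg => by
      obtain ⟨q, hq⟩ := G.exists_lift_of_face_invariant hg
      have h1 := (Submodule.mem_orthogonal _ _).1 hf1 _ ⟨q, rfl⟩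
      rw [G.inner_faceDiff hf2] at h1
      simp only [hq] at h1
      rw [finsum_eq_sum_of_fintype]
      linarith)
    refine ⟨p, ?_⟩
    ext d
    rw [vertexDiff_apply, hp]
  · intro hx f hf hp
    have hmem : WithLp.toLp 2 f ∈ (LinearMap.range G.faceDiff)ᗮ ⊓ G.antisymm := by
      have hanti : WithLp.toLp 2 f ∈ G.antisymm := hf
      refine ⟨(Submodule.mem_orthogonal _ _).2 ?_, hanti⟩
      rintro _ ⟨q, rfl⟩
      have h1 := hp (fun d => q ⟦d⟧) (fun d => by rw [mk_face])
      rw [finsum_eq_sum_of_fintype] at h1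
      rw [G.inner_faceDiff hanti]
      simp [h1]
    rw [← hx] at hmem
    obtain ⟨p, hp⟩ := hmem
    exact ⟨p, fun d => by rw [← vertexDiff_apply, hp]⟩

/-- Antisymmetrization has the antisymmetric functions as range and the symmetric ones as kernel.
Multiplication by a sign that orients each edge exchanges the two. -/
theorem two_mul_finrank_antisymm (G : RotSys V D) :
    2 * Module.finrank ℝ G.antisymm = Fintype.card D := by
  classical
  obtain ⟨s, hs, hs2⟩ : ∃ s : D → ℝ, (∀ d, s (G.rev d) = -s d) ∧ ∀ d, s d * s d = 1 := by
    let e := Fintype.equivFin D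
    refine ⟨fun d => if e d < e (G.rev d) then 1 else -1, fun d => ?_, fun d => ?_⟩
    · have hne : e d ≠ e (G.rev d) := fun h => G.rev_ne d (e.injective h).symm
      rcases lt_or_gt_of_ne hne with h | h
      · simp [G.rev_rev, h, not_lt.2 h.le]
      · simp [G.rev_rev, h, not_lt.2 h.le]
    · dsimp only
      split_ifs <;> norm_num
  let T : EuclideanSpace ℝ D →ₗ[ℝ] EuclideanSpace ℝ D :=
    { toFun := fun f => WithLp.toLp 2 fun d => f d - f (G.rev d)
      map_add' := fun f g => by
        ext d
        simp only [PiLp.add_apply]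
        ring
      map_smul' := fun c f => by
        ext d
        simp only [PiLp.smul_apply, smul_eq_mul, RingHom.id_apply]
        ring }
  have hT : ∀ f d, T f d = f d - f (G.rev d) := fun _ _ => rfl
  let M : EuclideanSpace ℝ D →ₗ[ℝ] EuclideanSpace ℝ D :=
    { toFun := fun f => WithLp.toLp 2 fun d => s d * f d
      map_add' := fun f g => by
        ext d
        simp only [PiLp.add_apply]
        ring
      map_smul' := fun c f => by
        ext d
        simp only [PiLp.smul_apply, smul_eq_mul, RingHom.id_apply]
        ring }
  have hM : ∀ f d, M f d = s d * f d := fun _ _ => rfl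
  have hMM : ∀ f, M (M f) = f := fun f => by
    ext d
    rw [hM, hM, ← mul_assoc, hs2, one_mul]
  have hrange : LinearMap.range T = G.antisymm := by
    apply le_antisymm
    · rintro _ ⟨f, rfl⟩ d
      rw [hT, hT, G.rev_rev]
      ring
    · intro f hf
      refine ⟨(2⁻¹ : ℝ) • f, ?_⟩
      ext d
      rw [hT, PiLp.smul_apply, PiLp.smul_apply, G.mem_antisymm.1 hf, smul_eq_mul, smul_eq_mul]
      ring
  have hker : LinearMap.ker T = G.antisymm.map M := by
    ext f
    rw [LinearMap.mem_ker, Submodule.mem_map]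
    constructor
    · intro h
      refine ⟨M f, fun d => ?_, hMM f⟩
      have h1 : T f d = 0 := by rw [h]; rfl
      rw [hT, sub_eq_zero] at h1
      rw [hM, hM, hs, h1]
      ring
    · rintro ⟨g, hg, rfl⟩
      ext d
      rw [hT, hM, hM, hs, G.mem_antisymm.1 hg]
      simp
  have hinj : Function.Injective M := fun f g h => by rw [← hMM f, h, hMM]
  have h1 := LinearMap.finrank_range_add_finrank_ker T
  rw [hrange, hker, (Submodule.equivMapOfInjective M hinj G.antisymm).symm.finrank_eq,
    finrank_euclideanSpace] at h1
  omega

/-- A linear map whose kernel consists of the constants. -/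
theorem finrank_range_of_ker_const {ι E : Type*} [Fintype ι] [Nonempty ι] [AddCommGroup E]
    [Module ℝ E] (T : (ι → ℝ) →ₗ[ℝ] E) (h : ∀ p, T p = 0 ↔ ∀ i j, p i = p j) :
    Module.finrank ℝ (LinearMap.range T) + 1 = Fintype.card ι := by
  have h1 := LinearMap.finrank_range_add_finrank_ker T
  rw [Module.finrank_fintype_fun_eq_card] at h1
  have h2 : LinearMap.ker T = Submodule.span ℝ {fun _ : ι => (1 : ℝ)} := by
    ext p
    rw [LinearMap.mem_ker, h, Submodule.mem_span_singleton]
    constructor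
    · intro hp
      inhabit ι
      exact ⟨p default, funext fun i => by simp [hp i default]⟩
    · rintro ⟨a, rfl⟩ i j
      rfl
  rw [h2, finrank_span_singleton] at h1
  · exact h1
  · intro h0
    inhabit ι
    exact one_ne_zero (congrFun h0 default)

omit [Fintype D] in
theorem finrank_range_vertexDiff [Finite V] (hc : G.graph.Connected) :
    Module.finrank ℝ (LinearMap.range G.vertexDiff) + 1 = Nat.card V := by
  cases nonempty_fintype V
  have := hc.nonempty
  rw [Nat.card_eq_fintype_card]
  refine finrank_range_of_ker_const _ fun p => ⟨fun h u v => ?_, fun h => ?_⟩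
  · refine connected_induct hc (p := fun v => p u = p v) (u := u) rfl (fun d hd => ?_) v
    have h1 : G.vertexDiff p d = 0 := by rw [h]; rfl
    rw [vertexDiff_apply, sub_eq_zero] at h1
    rw [hd, h1]
  · ext d
    rw [vertexDiff_apply, h _ (G.tail d), sub_self]
    rfl

/-- In a connected rotation system all darts are linked by rotation and reversal. -/
theorem dart_induct (hc : G.graph.Connected)
    (hrot : ∀ d e, G.tail d = G.tail e → G.rot.SameCycle d e)
    {Q : D → Prop} {d : D} (hd : Q d) (h1 : ∀ z, Q z → Q (G.rot z)) (h2 : ∀ z, Q z → Q (G.rev z))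
    (e : D) : Q e := by
  refine connected_induct hc (p := fun v => ∀ z, G.tail z = v → Q z) (u := G.tail d)
    (fun z hz => Equiv.Perm.SameCycle.induct (hrot d z hz.symm) hd h1) (fun x hx z hz => ?_) _ e rfl
  exact Equiv.Perm.SameCycle.induct (hrot (G.rev x) z hz.symm) (h2 _ (hx x rfl)) h1

/-- The kernel consists of constants because the dual graph is connected: rotation and reversal link
all darts, and each of them leads to the same or to an adjacent face. -/
theorem finrank_range_faceDiff [Nonempty D] (hc : G.graph.Connected)
    (hrot : ∀ d e, G.tail d = G.tail e → G.rot.SameCycle d e) :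
    Module.finrank ℝ (LinearMap.range G.faceDiff) + 1 = Nat.card G.FaceOrbit := by
  classical
  have : Fintype G.FaceOrbit := Fintype.ofFinite _
  have : Nonempty G.FaceOrbit := ‹Nonempty D›.map fun d => ⟦d⟧
  rw [Nat.card_eq_fintype_card]
  refine finrank_range_of_ker_const _ fun p => ⟨fun h u v => ?_, fun h => ?_⟩
  · induction u using Quotient.inductionOn with | _ d => ?_
    induction v using Quotient.inductionOn with | _ e => ?_
    have h0 : ∀ z : D, p ⟦z⟧ = p ⟦G.rev z⟧ := fun z => by
      have h1 : G.faceDiff p z = 0 := by rw [h]; rfl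
      rwa [faceDiff_apply, sub_eq_zero] at h1
    refine dart_induct hc hrot (Q := fun z => p ⟦d⟧ = p ⟦z⟧) (d := d) rfl (fun z hz => ?_)
      (fun z hz => hz.trans (h0 z)) e
    rw [h0 (G.rot z)]
    have h1 : G.face (G.rev (G.rot z)) = z := by simp [face_apply, G.rev_rev]
    have h2 := G.mk_face (G.rev (G.rot z))
    rw [h1] at h2
    rw [hz, h2]
  · ext d
    rw [faceDiff_apply, h ⟦G.rev d⟧ ⟦d⟧, sub_self]
    rfl

end Planarity

section Planarity

variable {V D : Type*} {G : RotSys V D} [Finite V] [Finite D]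

theorem euler_iff_finrank (hc : G.graph.Connected) (ht : ∀ d e, G.rot.SameCycle d e ↔
      G.tail d = G.tail e) [Fintype D] :
    (2 * Nat.card V + 2 * G.numFaces = Nat.card D + 4) ↔
      Module.finrank ℝ (LinearMap.range G.vertexDiff) +
        Module.finrank ℝ (LinearMap.range G.faceDiff) = Module.finrank ℝ G.antisymm := by
  have h1 := finrank_range_vertexDiff hc
  have h2 := two_mul_finrank_antisymm G
  rw [← Nat.card_eq_fintype_card] at h2
  -- Without darts there is a single vertex; the convention of one face makes Euler's formula true,
  -- and all three ranks are zero.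
  by_cases hD : IsEmpty D
  · have h3 : Module.finrank ℝ (LinearMap.range G.faceDiff) = 0 := by
      have := Submodule.finrank_le (LinearMap.range G.faceDiff)
      rw [finrank_euclideanSpace] at this
      simpa using this
    have h4 : Nat.card V = 1 := by
      rw [Nat.card_eq_one_iff_unique]
      have := hc.nonempty
      exact ⟨⟨fun u v => connected_induct hc (p := fun v => u = v) rfl
        (fun d => isEmptyElim d) v⟩, inferInstance⟩
    have h5 : Nat.card D = 0 := by simp
    rw [numFaces, if_pos hD]
    omega
  · have : Nonempty D := not_isEmpty_iff.1 hD
    have h3 := finrank_range_faceDiff hc (fun d e => (ht d e).2)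
    rw [numFaces, if_neg hD]
    change _ = Nat.card (Quotient _) at h3
    omega

/-- The face differences lie in the orthogonal complement of the vertex differences; Euler's formula
makes the dimensions agree. The coflow version exchanges the roles of the two subspaces. -/
theorem isPlane_iff_flowExact : G.IsPlane ↔ (∀ d e, G.rot.SameCycle d e ↔ G.tail d = G.tail e) ∧
    G.graph.Connected ∧ G.FlowExact := by
  classical
  cases nonempty_fintype D
  have key : (∀ d e, G.rot.SameCycle d e ↔ G.tail d = G.tail e) → G.graph.Connected →
      ((2 * Nat.card V + 2 * G.numFaces = Nat.card D + 4) ↔ G.FlowExact) := by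
    intro hr hc
    have ht : G.TailRot := fun d => ((hr _ _).1 (Equiv.Perm.sameCycle_apply_right.2
      (Equiv.Perm.SameCycle.refl _ d))).symm
    rw [euler_iff_finrank hc hr, ht.flowExact_iff,
      ← Submodule.finrank_add_inf_finrank_orthogonal G.vertexDiff_range_le, add_right_inj]
    exact ⟨Submodule.eq_of_le_of_finrank_eq ht.faceDiff_range_le_orthogonal, fun h => by rw [← h]⟩
  exact ⟨fun h => ⟨h.rot_iff, h.connected, (key h.rot_iff h.connected).1 h.euler⟩,
    fun h => ⟨h.1, h.2.1, (key h.1 h.2.1).2 h.2.2⟩⟩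

theorem isPlane_iff_coflowExact : G.IsPlane ↔
    (∀ d e, G.rot.SameCycle d e ↔ G.tail d = G.tail e) ∧ G.graph.Connected ∧ G.CoflowExact := by
  classical
  cases nonempty_fintype D
  have key : (∀ d e, G.rot.SameCycle d e ↔ G.tail d = G.tail e) → G.graph.Connected →
      ((2 * Nat.card V + 2 * G.numFaces = Nat.card D + 4) ↔ G.CoflowExact) := by
    intro hr hc
    have ht : G.TailRot := fun d => ((hr _ _).1 (Equiv.Perm.sameCycle_apply_right.2
      (Equiv.Perm.SameCycle.refl _ d))).symm
    rw [euler_iff_finrank hc hr, ht.coflowExact_iff, add_comm,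
      ← Submodule.finrank_add_inf_finrank_orthogonal G.faceDiff_range_le, add_right_inj]
    exact ⟨Submodule.eq_of_le_of_finrank_eq ht.vertexDiff_range_le_orthogonal, fun h => by rw [← h]⟩
  exact ⟨fun h => ⟨h.rot_iff, h.connected, (key h.rot_iff h.connected).1 h.euler⟩,
    fun h => ⟨h.1, h.2.1, (key h.1 h.2.1).2 h.2.2⟩⟩

end Planarity

end RotSys

/-! ### Planarity of subgraphs and contractions. -/

namespace RotSys

section ExtendZero

open Classical in
/-- Extension of a function on a subset by zero. -/
noncomputable def extendZero {D : Type*} (S : Set D) (f : S → ℝ) (d : D) : ℝ :=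
  if h : d ∈ S then f ⟨d, h⟩ else 0

theorem extendZero_of_mem {D : Type*} {S : Set D} {f : S → ℝ} {d : D} (h : d ∈ S) :
    extendZero S f d = f ⟨d, h⟩ := dif_pos h

theorem extendZero_of_notMem {D : Type*} {S : Set D} {f : S → ℝ} {d : D} (h : d ∉ S) :
    extendZero S f d = 0 := dif_neg h

end ExtendZero

section SubContract

variable {V D : Type*} {G : RotSys V D} [Finite D]

omit [Finite D] in
theorem finsum_extend_mul (S : Set D) (f : S → ℝ) (q : D → ℝ) :
    ∑ᶠ d, extendZero S f d * q d = ∑ᶠ x : S, f x * q x.1 := by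
  have h1 : ∀ x : S, f x * q x.1 = (fun d => extendZero S f d * q d) x.1 := fun x => by
    simp only [extendZero_of_mem x.2]
  rw [finsum_congr h1, finsum_set_coe_eq_finsum_mem (f := fun d => extendZero S f d * q d),
    finsum_mem_def]
  refine finsum_congr fun d => ?_
  by_cases h : d ∈ S
  · simp [h]
  · simp [h, extendZero_of_notMem h]

omit [Finite D] in
theorem extendZero_rev {S : Set D} {f : S → ℝ} (hmem : ∀ d, G.rev d ∈ S ↔ d ∈ S)
    (hf : ∀ d : S, f ⟨G.rev d.1, (hmem _).2 d.2⟩ = -f d) (d : D) :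
    extendZero S f (G.rev d) = -extendZero S f d := by
  by_cases h : d ∈ S
  · rw [extendZero_of_mem h, extendZero_of_mem ((hmem d).2 h)]
    exact hf ⟨d, h⟩
  · rw [extendZero_of_notMem h, extendZero_of_notMem (fun h' => h ((hmem d).1 h')), neg_zero]

/-! ### Subgraphs -/

theorem sub_face_apply (U : Set V) (P : Set D) (x : G.subDarts U P) :
    (G.sub U P).face x = firstReturn G.rot⁻¹ (G.subDarts U P) ((G.sub U P).rev x) := by
  rw [face_apply, ← firstReturn_inv_apply]
  rfl

/-- The face step in a subgraph starts as in `G` and then turns past the darts that were removed. -/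
theorem sub_face_induct {U : Set V} {P : Set D} {x : G.subDarts U P} {Q : D → Prop}
    (h0 : Q (G.face x.1)) (hs : ∀ y ∉ G.subDarts U P, Q y → Q (G.rot⁻¹ y)) :
    Q ((G.sub U P).face x).1 := by
  rw [sub_face_apply]
  exact firstReturn_induct h0 hs

theorem sub_face_eq {U : Set V} {P : Set D} {x : G.subDarts U P}
    (h : G.face x.1 ∈ G.subDarts U P) : ((G.sub U P).face x).1 = G.face x.1 := by
  rw [sub_face_apply]
  exact firstReturn_eq_of_mem (σ := G.rot⁻¹) (x := (G.sub U P).rev x) h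

theorem IsPlane.sub_rot_iff (hG : G.IsPlane) (U : Set V) (P : Set D) (d e : G.subDarts U P) :
    (G.sub U P).rot.SameCycle d e ↔ (G.sub U P).tail d = (G.sub U P).tail e := by
  change (firstReturn G.rot (G.subDarts U P)).SameCycle d e ↔ _
  rw [firstReturn_sameCycle_iff, hG.rot_iff, ← Subtype.coe_inj]
  rfl

/-- A circulation on a subgraph, extended by zero, is a circulation on `G`. Its face function does
not change across removed edges, hence is constant on the merged faces. -/
theorem FlowExact.sub (hG : G.FlowExact) (U : Set V) (P : Set D) :
    (G.sub U P).FlowExact := by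
  classical
  intro f hf hp
  have hmem : ∀ d, G.rev d ∈ G.subDarts U P ↔ d ∈ G.subDarts U P := by
    have h1 : ∀ d, d ∈ G.subDarts U P → G.rev d ∈ G.subDarts U P := fun d hd =>
      ((G.sub U P).rev ⟨d, hd⟩).2
    exact fun d => ⟨fun h => by simpa [G.rev_rev] using h1 _ h, h1 d⟩
  obtain ⟨g, hg, hfg⟩ := hG (extendZero _ f) (extendZero_rev hmem hf)
    (fun p => by
      rw [finsum_extend_mul]
      exact hp (fun u => p u.1))
  refine ⟨fun x => g x.1, fun x => ?_, fun x => ?_⟩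
  · refine sub_face_induct (Q := fun y => g y = g x.1) (hg _) (fun y hy hgy => ?_)
    have h1 := hfg y
    rw [extendZero_of_notMem hy] at h1
    rw [rot_inv_apply, hg]
    linarith
  · have h1 := hfg x.1
    rw [extendZero_of_mem x.2] at h1
    exact h1

theorem IsPlane.sub [Finite V] (hG : G.IsPlane) (U : Set V) (P : Set D)
    (hc : (G.sub U P).graph.Connected) : (G.sub U P).IsPlane :=
  isPlane_iff_flowExact.2 ⟨hG.sub_rot_iff U P, hc, (isPlane_iff_flowExact.1 hG).2.2.sub U P⟩

/-! ### Contractions -/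

theorem contract_face_apply (S : Set D) (x : ((G.edgeDarts S)ᶜ : Set D)) :
    (G.contract S).face x =
      firstReturn (G.rot * G.flip S)⁻¹ (G.edgeDarts S)ᶜ ((G.contract S).rev x) := by
  rw [face_apply, ← firstReturn_inv_apply]
  rfl

/-- The face step in a contraction follows the face of `G` along the contracted darts until a
remaining dart is met. -/
theorem contract_face_induct {S : Set D} {x : ((G.edgeDarts S)ᶜ : Set D)} {Q : D → Prop}
    (h0 : Q (G.face x.1)) (hs : ∀ y ∈ G.edgeDarts S, Q y → Q (G.face y)) :
    Q ((G.contract S).face x).1 := by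
  rw [contract_face_apply]
  -- The inverse sweep is `flip` after the inverse rotation, so its points are one flip away from
  -- the darts of the face; hence the property is tested after a flip.
  have h1 := firstReturn_induct (σ := (G.rot * G.flip S)⁻¹) (P := (G.edgeDarts S)ᶜ)
    (x := (G.contract S).rev x) (Q := fun y => Q (G.flip S y)) (by
      rw [mul_inv_rev, Equiv.Perm.mul_apply, flip_inv, flip_flip]
      exact h0) (fun y hy h => by
      rw [Set.mem_compl_iff, not_not] at hy
      rw [mul_inv_rev, Equiv.Perm.mul_apply, flip_inv, flip_flip, rot_inv_apply]
      rw [G.flip_of_mem hy] at h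
      exact hs _ (G.mem_edgeDarts_rev.2 hy) h)
  rwa [G.flip_of_notMem (Subtype.property (firstReturn _ (G.edgeDarts S)ᶜ _))] at h1

theorem contract_face_eq {S : Set D} {x : ((G.edgeDarts S)ᶜ : Set D)}
    (h : G.face x.1 ∉ G.edgeDarts S) : ((G.contract S).face x).1 = G.face x.1 := by
  rw [contract_face_apply, firstReturn_eq_of_mem]
  · rw [mul_inv_rev, Equiv.Perm.mul_apply, flip_inv]
    exact G.flip_of_notMem h
  · rw [mul_inv_rev, Equiv.Perm.mul_apply, flip_inv]
    change G.flip S (G.face x.1) ∉ _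
    rwa [G.flip_of_notMem h]

omit [Finite D] in
-- Equality in the quotient is used only through predicates that contracted edges transport;
-- reversed edges make the transport symmetric.
theorem contractVertex_lift {S : Set D} {p : V → Prop}
    (hp : ∀ d ∈ G.edgeDarts S, p (G.tail d) → p (G.head d)) {u v : V}
    (h : (Quot.mk _ u : G.ContractVertex S) = Quot.mk _ v) (hu : p u) : p v := by
  have h1 : ∀ a b, (∃ d ∈ G.edgeDarts S, G.tail d = a ∧ G.head d = b) → p a = p b := by
    rintro _ _ ⟨d, hd, rfl, rfl⟩
    refine propext ⟨hp d hd, fun h => ?_⟩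
    have := hp (G.rev d) (G.mem_edgeDarts_rev.2 hd) h
    rwa [head_rev] at this
  have h2 := congrArg (Quot.lift p h1) h
  exact h2.mp hu

theorem contract_connected (hc : G.graph.Connected) (S : Set D) :
    (G.contract S).graph.Connected := by
  obtain ⟨v₀, h0⟩ := connected_iff.1 hc
  refine connected_iff.2 ⟨Quot.mk _ v₀, fun p hp0 hp v => ?_⟩
  induction v using Quot.ind with | _ v => ?_
  refine h0 (fun v => p (Quot.mk _ v)) hp0 (fun d hd => ?_) v
  by_cases hS : d ∈ G.edgeDarts S
  · have : (Quot.mk _ (G.tail d) : G.ContractVertex S) = Quot.mk _ (G.head d) :=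
      Quot.sound ⟨d, hS, rfl, rfl⟩
    change p (Quot.mk _ (G.tail d)) at hd
    rwa [this] at hd
  · exact hp ⟨d, hS⟩ hd

/-- Dual to `FlowExact.sub`: a face-invariant function on `G` restricts to one on the contraction,
so the extension by zero is a vertex difference. The vertex function is constant along contracted
edges and descends to the quotient. -/
theorem CoflowExact.contract (hG : G.CoflowExact) (S : Set D) : (G.contract S).CoflowExact := by
  classical
  intro f hf hg
  have hmem : ∀ d, G.rev d ∈ (G.edgeDarts S)ᶜ ↔ d ∈ (G.edgeDarts S)ᶜ := fun d =>
    not_congr G.mem_edgeDarts_rev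
  obtain ⟨p, hp⟩ := hG (extendZero _ f) (extendZero_rev hmem hf)
    (fun g hgi => by
      rw [finsum_extend_mul]
      exact hg (fun x => g x.1) fun x => contract_face_induct (Q := fun y => g y = g x.1)
        (hgi _) fun y _ hy => by rw [hgi, hy])
  refine ⟨Quot.lift p ?_, fun x => ?_⟩
  · rintro _ _ ⟨d, hd, rfl, rfl⟩
    have h1 := hp d
    rw [extendZero_of_notMem (not_not.2 hd)] at h1
    linarith
  · have h1 := hp x.1
    rw [extendZero_of_mem x.2] at h1
    exact h1

theorem IsPlane.contract_tail_eq (hG : G.IsPlane) (S : Set D) {d e : ((G.edgeDarts S)ᶜ : Set D)}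
    (h : (G.contract S).rot.SameCycle d e) : (G.contract S).tail d = (G.contract S).tail e := by
  change (firstReturn (G.rot * G.flip S) (G.edgeDarts S)ᶜ).SameCycle d e at h
  rw [firstReturn_sameCycle_iff] at h
  refine h.induct (Q := fun y => (G.contract S).tail d = Quot.mk _ (G.tail y)) rfl fun y hy => ?_
  rw [hy, Equiv.Perm.mul_apply, hG.tailRot]
  by_cases hS : y ∈ G.edgeDarts S
  · rw [G.flip_of_mem hS]
    exact Quot.sound ⟨y, hS, rfl, rfl⟩
  · rw [G.flip_of_notMem hS]

omit [Finite D] in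
instance [Finite V] (S : Set D) : Finite (G.ContractVertex S) :=
  inferInstanceAs (Finite (Quot _))

/-- Contraction preserves planarity, provided that each new vertex has one cyclic order; the
condition is stated in terms of the sets that are invariant under sweeping. -/
theorem IsPlane.contract [Finite V] (hG : G.IsPlane) (S : Set D)
    (hrot : ∀ X : D → Prop, (∀ y, X (G.flip S y) → X (G.rot y)) →
      (∀ y, X (G.rot y) → X (G.flip S y)) →
      ∀ d e, d ∉ G.edgeDarts S → e ∉ G.edgeDarts S →
        (Quot.mk _ (G.tail d) : G.ContractVertex S) = Quot.mk _ (G.tail e) → X d → X e) :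
    (G.contract S).IsPlane := by
  refine isPlane_iff_coflowExact.2 ⟨fun d e => ⟨hG.contract_tail_eq S, fun h => ?_⟩,
    contract_connected hG.connected S, (isPlane_iff_coflowExact.1 hG).2.2.contract S⟩
  change (firstReturn (G.rot * G.flip S) (G.edgeDarts S)ᶜ).SameCycle d e
  rw [firstReturn_sameCycle_iff]
  have key : ∀ y, (G.rot * G.flip S).SameCycle d.1 (G.flip S y) ↔
      (G.rot * G.flip S).SameCycle d.1 (G.rot y) := fun y => by
    have h1 : G.rot y = (G.rot * G.flip S) (G.flip S y) := by
      rw [Equiv.Perm.mul_apply, flip_flip]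
    rw [h1, Equiv.Perm.sameCycle_apply_right]
  exact hrot (fun y => (G.rot * G.flip S).SameCycle d.1 y) (fun y => (key y).1)
    (fun y => (key y).2) d.1 e.1 d.2 e.2 h (Equiv.Perm.SameCycle.refl _ _)

/-- Contraction of a forest preserves planarity. -/
theorem IsPlane.contract_of_forest [Finite V] (hG : G.IsPlane) (S : Set D)
    (hS : ∀ f : D → ℝ, (∀ d, f (G.rev d) = -f d) → (∀ d ∉ G.edgeDarts S, f d = 0) →
      (∀ v, ∑ᶠ d ∈ {d | G.tail d = v}, f d = 0) → ∀ d, f d = 0) : (G.contract S).IsPlane := by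
  classical
  refine hG.contract S fun X h1 h2 d e hd he hde hX => ?_
  -- Change of the indicator of `X` under `flip` is a circulation on the contracted edges:
  -- invariance under sweeping turns `flip` into `rot`, which permutes the darts at a vertex. The
  -- hypothesis says that a forest carries only the zero circulation, so `X` is stable under `flip`,
  -- hence under `rot`.
  let x : D → ℝ := fun d => if X d then 1 else 0
  have hx : ∀ y, x (G.rot y) = x (G.flip S y) := fun y => by
    simp only [x]
    congr 1
    exact propext ⟨h2 y, h1 y⟩
  have hf := hS (fun y => x y - x (G.flip S y)) (fun y => by
      by_cases hy : y ∈ G.edgeDarts S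
      · rw [G.flip_of_mem hy, G.flip_of_mem (G.mem_edgeDarts_rev.2 hy), G.rev_rev]
        ring
      · rw [G.flip_of_notMem hy, G.flip_of_notMem (fun h => hy (G.mem_edgeDarts_rev.1 h))]
        ring) (fun y hy => by rw [G.flip_of_notMem hy, sub_self]) (fun v => by
      simp only [← hx]
      rw [finsum_mem_sub_distrib _ _ (Set.toFinite _), sub_eq_zero]
      refine finsum_mem_eq_of_bijOn (fun y => G.rot⁻¹ y) ?_ fun y _ => by simp
      refine ⟨fun y hy => ?_, (Equiv.injective _).injOn, fun y hy => ⟨G.rot y, ?_, by simp⟩⟩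
      · exact (hG.tailRot.inv y).trans hy
      · exact (hG.tailRot y).trans hy)
  have hXf : ∀ y, X (G.flip S y) ↔ X y := fun y => by
    have h3 : x y = x (G.flip S y) := sub_eq_zero.1 (hf y)
    simp only [x] at h3
    by_cases ha : X y <;> by_cases hb : X (G.flip S y) <;> simp_all
  have hvert : ∀ y z, G.tail y = G.tail z → X y → X z := fun y z hyz hy =>
    hG.rot_induct hyz hy fun w hw _ => h1 w ((hXf w).2 hw)
  refine contractVertex_lift (p := fun v => ∀ y, G.tail y = v → X y) (fun y hy hp z hz => ?_)
    hde (fun y hy => hvert d y hy.symm hX) e rfl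
  have h4 : X (G.rev y) := by
    rw [← G.flip_of_mem hy]
    exact (hXf y).2 (hp y rfl)
  exact hvert (G.rev y) z hz.symm h4

end SubContract

end RotSys

/-! ### Directed cycles, the Jordan curve theorem, and what a face can enclose. -/

namespace RotSys

section Jordan

variable {V D : Type*} {G : RotSys V D}

/-! ### Regions -/

theorem region_face_iff {C A : Set D} {e : D} : G.face e ∈ G.region C A ↔ e ∈ G.region C A :=
  ⟨fun ⟨a, ha, h⟩ => ⟨a, ha, h.trans _ _ _ (.symm _ _ (.rel _ _ (Or.inl rfl)))⟩,
    fun ⟨a, ha, h⟩ => ⟨a, ha, h.trans _ _ _ (.rel _ _ (Or.inl rfl))⟩⟩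

theorem region_rev_iff {C A : Set D} {e : D} (he : e ∉ C) :
    G.rev e ∈ G.region C A ↔ e ∈ G.region C A :=
  ⟨fun ⟨a, ha, h⟩ => ⟨a, ha, h.trans _ _ _ (.symm _ _ (.rel _ _ (Or.inr ⟨he, rfl⟩)))⟩,
    fun ⟨a, ha, h⟩ => ⟨a, ha, h.trans _ _ _ (.rel _ _ (Or.inr ⟨he, rfl⟩))⟩⟩

theorem subset_region {C A : Set D} : A ⊆ G.region C A := fun a ha => ⟨a, ha, .refl _⟩

theorem region_induct {C A : Set D} {Q : D → Prop} (hA : ∀ a ∈ A, Q a)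
    (h1 : ∀ x, Q (G.face x) ↔ Q x) (h2 : ∀ x ∉ C, Q (G.rev x) ↔ Q x) {e : D}
    (he : e ∈ G.region C A) : Q e := by
  obtain ⟨a, ha, h⟩ := he
  have key : ∀ x y, Relation.EqvGen (fun x y => y = G.face x ∨ (x ∉ C ∧ y = G.rev x)) x y →
      (Q x ↔ Q y) := by
    intro x y h
    induction h with
    | rel x y h =>
      rcases h with rfl | ⟨hx, rfl⟩
      · exact (h1 x).symm
      · exact (h2 x hx).symm
    | refl => exact Iff.rfl
    | symm _ _ _ ih => exact ih.symm
    | trans _ _ _ _ _ ih1 ih2 => exact ih1.trans ih2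
  exact (key a e h).1 (hA a ha)

/-! ### Directed cycles -/

variable (G) in
/-- The darts of a cycle, each edge being traversed in one direction. -/
structure IsDirCycle (A : Set D) : Prop where
  nonempty : A.Nonempty
  rev_notMem : ∀ a ∈ A, G.rev a ∉ A
  tail_inj : ∀ a ∈ A, ∀ b ∈ A, G.tail a = G.tail b → a = b
  head_inj : ∀ a ∈ A, ∀ b ∈ A, G.head a = G.head b → a = b
  next : ∀ a ∈ A, ∃ b ∈ A, G.tail b = G.head a
  prev : ∀ a ∈ A, ∃ b ∈ A, G.head b = G.tail a
  induct : ∀ X : D → Prop, (∃ a ∈ A, X a) →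
    (∀ a ∈ A, ∀ b ∈ A, X a → G.tail b = G.head a → X b) → ∀ a ∈ A, X a

theorem IsDirCycle.reverse {A : Set D} (hA : G.IsDirCycle A) : G.IsDirCycle (G.rev ⁻¹' A) where
  nonempty := by
    obtain ⟨a, ha⟩ := hA.nonempty
    exact ⟨G.rev a, by rwa [Set.mem_preimage, G.rev_rev]⟩
  rev_notMem a ha h := by
    rw [Set.mem_preimage, G.rev_rev] at h
    exact hA.rev_notMem a h ha
  tail_inj a ha b hb h := G.rev_injective (hA.head_inj _ ha _ hb (by rwa [head_rev, head_rev]))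
  head_inj a ha b hb h := G.rev_injective (hA.tail_inj _ ha _ hb h)
  next a ha := by
    obtain ⟨b, hb, h⟩ := hA.prev _ ha
    exact ⟨G.rev b, by rwa [Set.mem_preimage, G.rev_rev], h⟩
  prev a ha := by
    obtain ⟨b, hb, h⟩ := hA.next _ ha
    exact ⟨G.rev b, by rwa [Set.mem_preimage, G.rev_rev], by rw [head_rev, h, head_rev]⟩
  induct X hX hs a ha := by
    by_contra hna
    obtain ⟨b, hb, hXb⟩ := hX
    refine hA.induct (fun y => ¬ X (G.rev y)) ⟨_, ha, by rwa [G.rev_rev]⟩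
      (fun x hx y hy hnx hxy hXy => hnx ?_) _ hb (by rwa [G.rev_rev])
    exact hs (G.rev y) (by rwa [Set.mem_preimage, G.rev_rev]) (G.rev x)
      (by rwa [Set.mem_preimage, G.rev_rev]) hXy (by rw [tail_rev, head_rev, hxy])

theorem edgeDarts_preimage_rev (A : Set D) : G.edgeDarts (G.rev ⁻¹' A) = G.edgeDarts A := by
  ext d
  change _ ∨ _ ↔ _ ∨ _
  rw [Set.mem_preimage, Set.mem_preimage, G.rev_rev]
  exact or_comm

theorem IsCycle.isDirCycle {n : ℕ} [NeZero n] {c : Fin n → D} (hc : G.IsCycle c) :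
    G.IsDirCycle (Set.range c) where
  nonempty := ⟨c 0, 0, rfl⟩
  rev_notMem := by
    rintro _ ⟨i, rfl⟩ ⟨j, hj⟩
    exact hc.edge_ne j i hj
  tail_inj := by
    rintro _ ⟨i, rfl⟩ _ ⟨j, rfl⟩ h
    rw [hc.vertex_inj h]
  head_inj := by
    rintro _ ⟨i, rfl⟩ _ ⟨j, rfl⟩ h
    rw [hc.next, hc.next] at h
    rw [add_right_cancel (hc.vertex_inj h)]
  next := by
    rintro _ ⟨i, rfl⟩
    exact ⟨_, ⟨i + 1, rfl⟩, (hc.next i).symm⟩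
  prev := by
    rintro _ ⟨i, rfl⟩
    exact ⟨_, ⟨i - 1, rfl⟩, by rw [hc.next, sub_add_cancel]⟩
  induct := by
    rintro X ⟨_, ⟨i, rfl⟩, hi⟩ hs _ ⟨j, rfl⟩
    have key : ∀ k : ℕ, X (c (i + Fin.ofNat n k)) := by
      intro k
      induction k with
      | zero => simpa using hi
      | succ k ih =>
        refine hs _ ⟨_, rfl⟩ _ ⟨_, rfl⟩ ih ?_
        rw [hc.next]
        congr 2
        rw [add_assoc]
        congr 1
        apply Fin.ext
        simp [Fin.val_add]
    have h1 := key (j - i).val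
    have h2 : Fin.ofNat n (j - i).val = j - i := by
      apply Fin.ext
      simp
    rwa [h2, add_sub_cancel] at h1

variable [Finite D]

/-- The unit flow around a cycle is conserved, because "next dart" is a bijection of the cycle that
matches heads with tails. -/
theorem IsDirCycle.flow {A : Set D} (hA : G.IsDirCycle A) (p : V → ℝ) :
    ∑ᶠ d, (A.indicator 1 d - A.indicator 1 (G.rev d) : ℝ) * p (G.tail d) = 0 := by
  classical
  choose! nx hnx hnx2 using hA.next
  have hbij : Set.BijOn nx A A := by
    refine ⟨hnx, fun a ha b hb h => hA.head_inj a ha b hb ?_, fun a ha => ?_⟩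
    · rw [← hnx2 a ha, ← hnx2 b hb, h]
    · obtain ⟨b, hb, h⟩ := hA.prev a ha
      exact ⟨b, hb, hA.tail_inj _ (hnx b hb) _ ha (by rw [hnx2 b hb, h])⟩
  have h1 : ∑ᶠ a ∈ A, p (G.head a) = ∑ᶠ a ∈ A, p (G.tail a) :=
    finsum_mem_eq_of_bijOn nx hbij fun a ha => by rw [hnx2 a ha]
  have h2 : ∑ᶠ d, (A.indicator 1 d : ℝ) * p (G.tail d) = ∑ᶠ a ∈ A, p (G.tail a) := by
    rw [finsum_mem_def]
    refine finsum_congr fun d => ?_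
    by_cases h : d ∈ A <;> simp [h]
  have h3 : ∑ᶠ d, (A.indicator 1 (G.rev d) : ℝ) * p (G.tail d) = ∑ᶠ a ∈ A, p (G.head a) := by
    rw [finsum_mem_def, ← finsum_comp_equiv G.revPerm]
    refine finsum_congr fun d => ?_
    rw [revPerm_apply, G.rev_rev, tail_rev]
    by_cases h : d ∈ A <;> simp [h]
  simp only [sub_mul]
  rw [finsum_sub_distrib (Set.toFinite _) (Set.toFinite _), h2, h3, h1, sub_self]

omit [Finite D] in
theorem IsDirCycle.mem_of_tail_eq {A : Set D} (hA : G.IsDirCycle A) {a y : D} (ha : a ∈ A)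
    (hy : y ∈ G.edgeDarts A) (h : G.tail y = G.head a) : y ∈ A ∨ y = G.rev a := by
  rcases hy with hy | hy
  · exact Or.inl hy
  · right
    rw [← hA.head_inj _ hy _ ha (by rw [head_rev, h]), G.rev_rev]

/-- The Jordan curve theorem: the two sides of a cycle are disjoint. -/
theorem IsPlane.rev_notMem_region [Finite V] (hG : G.IsPlane) {A : Set D} (hA : G.IsDirCycle A)
    {a : D} (ha : a ∈ A) : G.rev a ∉ G.region (G.edgeDarts A) A := by
  classical
  -- The face function `g` is a winding number: it drops by 1 from the left to the right of a dart
  -- of the cycle and is unchanged across other edges.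
  obtain ⟨g, hg, hfg⟩ := (isPlane_iff_flowExact.1 hG).2.2
    (fun d => A.indicator 1 d - A.indicator 1 (G.rev d)) (fun d => by
      rw [G.rev_rev]
      ring) hA.flow
  have hC : ∀ d ∉ G.edgeDarts A, g (G.rev d) = g d := fun d hd => by
    have h1 := hfg d
    rw [Set.indicator_of_notMem (fun h => hd (Or.inl h)),
      Set.indicator_of_notMem (fun h => hd (Or.inr h))] at h1
    linarith
  have hAg : ∀ a ∈ A, g (G.rev a) = g a - 1 := fun a ha => by
    have h1 := hfg a
    rw [Set.indicator_of_mem ha, Set.indicator_of_notMem (hA.rev_notMem a ha)] at h1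
    simp only [Pi.one_apply] at h1
    linarith
  -- Turning from the reverse of `x` through the left side, the first dart of the cycle met has the
  -- value `g x`. It cannot be the reverse of `x`, where the value is `g x - 1`, so it is the
  -- successor `y`.
  have hnext : ∀ x ∈ A, ∀ y ∈ A, G.tail y = G.head x → g y = g x := by
    intro x hx y hy hxy
    have hmem : G.rev x ∈ G.edgeDarts A := G.mem_edgeDarts_rev.2 (Or.inl hx)
    set z := firstReturn G.rot⁻¹ (G.edgeDarts A) ⟨G.rev x, hmem⟩ with hz
    have h1 : g z.1 = g x := firstReturn_induct (Q := fun z => g z = g x) (hg x)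
      fun w hw h => by
        rw [rot_inv_apply, hg, hC w hw, h]
    have h2 : G.tail z.1 = G.head x := firstReturn_induct (Q := fun z => G.tail z = G.head x)
      (hG.tailRot.tail_face x) fun w _ h => by
        rw [hG.tailRot.inv, h]
    rcases hA.mem_of_tail_eq hx z.2 h2 with h | h
    · rw [← h1, hA.tail_inj _ hy _ h (by rw [hxy, h2])]
    · rw [h, hAg x hx] at h1
      linarith
  have hconst : ∀ b ∈ A, g b = g a := hA.induct (fun b => g b = g a) ⟨a, ha, rfl⟩
    fun x hx y hy h hxy => (hnext x hx y hy hxy).trans h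
  intro hmem
  have h1 := region_induct (Q := fun e => g e = g a) hconst (fun x => by rw [hg])
    (fun x hx => by rw [hC x hx]) hmem
  have h2 := hAg a ha
  linarith

/-- At a vertex off the cycle, one dart lies on a side only if all do. -/
theorem IsPlane.region_of_tail_eq (hG : G.IsPlane) {C A : Set D}
    {d e : D} (hd : d ∈ G.region C A)
    (hde : G.tail d = G.tail e) (h : ∀ z, G.tail z = G.tail d → z ∉ C) : e ∈ G.region C A := by
  refine hG.rot_inv_induct hde hd fun z hz hzd => ?_
  rw [rot_inv_apply, region_face_iff, region_rev_iff (h z hzd)]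
  exact hz

variable (G) in
/-- `v` can be reached from `u` by darts that do not lead to `β`. -/
def ReachAvoiding (β : V) : V → V → Prop :=
  Relation.ReflTransGen fun x y => y ≠ β ∧ ∃ d, G.tail d = x ∧ G.head d = y

/-- If all the corners but one of a cycle are corners of a face, then what lies on the side of these
corners is attached at the remaining vertex `β` only. -/
theorem IsPlane.pocket [Finite V] (hG : G.IsPlane) {A : Set D} (hA : G.IsDirCycle A) {β : V}
    (hβ : ∀ a ∈ A, G.head a ≠ β → G.face a ∈ A) {a : D} (ha : a ∈ A) (haβ : G.head a ≠ β) {v : V}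
    (hv : G.ReachAvoiding β (G.head a) v) {y : D} (hy : y ∈ G.region (G.edgeDarts A) A)
    (hyv : G.tail y = v) : y ∈ A := by
  have hrev : ∀ x ∈ A, G.rev x ∉ G.region (G.edgeDarts A) A := fun x hx =>
    hG.rev_notMem_region hA hx
  have hmemC : ∀ z ∈ G.edgeDarts A, G.rev z ∈ G.region (G.edgeDarts A) A → G.rev z ∈ A := by
    rintro z (hz | hz) h
    · exact absurd h (hrev z hz)
    · exact hz
  have hCsymm : ∀ d, G.rev d ∈ G.edgeDarts A ↔ d ∈ G.edgeDarts A := fun d => G.mem_edgeDarts_rev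
  -- At a corner other than `β` the face goes straight from `b` to the next dart of the cycle, so no
  -- other dart fits into the region there: rotating from such a dart towards the reverse of `b`,
  -- the last dart before it would be `face b`, which is on the cycle.
  have on_cycle : ∀ b ∈ A, G.head b ≠ β → ∀ z ∈ G.region (G.edgeDarts A) A,
      G.tail z = G.head b → z ∈ A := by
    intro b hb hbβ z hz hzb
    by_contra hzA
    have hzC : z ∉ G.edgeDarts A := by
      rintro (h | h)
      · exact hzA h
      · exact hrev _ h (by rwa [G.rev_rev])
    -- sweep from `z` to the first dart of the cycle
    have hend := hG.rot_induct (d := z) (e := G.rev b)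
      (Q := fun w => w ∉ G.edgeDarts A ∧ w ∈ G.region (G.edgeDarts A) A) hzb ⟨hzC, hz⟩ (by
        rintro w ⟨hw1, hw2⟩ hwz
        have h1 : G.rev (G.rot w) ∈ G.region (G.edgeDarts A) A := by
          rw [← region_face_iff, ← rot_inv_apply]
          simpa using hw2
        have h2 : G.rot w ∉ G.edgeDarts A := by
          intro h
          have h3 := hmemC _ h h1
          have h4 : G.rev (G.rot w) = b := hA.head_inj _ h3 _ hb (by
            rw [head_rev, hG.tailRot, hwz, hzb])
          have h5 := hβ b hb hbβ
          rw [← h4, ← rot_inv_apply] at h5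
          exact hw1 (Or.inl (by simpa using h5))
        exact ⟨h2, (region_rev_iff h2).1 h1⟩)
    exact hend.1 (G.mem_edgeDarts_rev.2 (Or.inl hb))
  induction hv generalizing y with
  | refl => exact on_cycle a ha haβ y hy hyv
  | @tail u w hu huw ih =>
    obtain ⟨hwβ, d, rfl, rfl⟩ := huw
    have hyd := hyv
    by_cases hcyc : ∃ b ∈ A, G.head b = G.head d
    · obtain ⟨b, hb, hbd⟩ := hcyc
      exact on_cycle b hb (hbd ▸ hwβ) y hy (hyd.trans hbd.symm)
    · have hoff : ∀ z, G.tail z = G.tail y → z ∉ G.edgeDarts A := by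
        rintro z hz (h | h)
        · obtain ⟨b, hb, hb2⟩ := hA.prev z h
          exact hcyc ⟨b, hb, by rw [hb2, hz, hyd]⟩
        · exact hcyc ⟨_, h, by rw [head_rev, hz, hyd]⟩
      -- Off the cycle, one dart in the region puts all darts at the vertex there. So the last dart
      -- of the path lies in the region too; by induction it would be on the cycle, which does not
      -- meet this vertex.
      have h1 : G.rev d ∈ G.region (G.edgeDarts A) A :=
        hG.region_of_tail_eq hy hyd hoff
      have h2 : G.rev d ∉ G.edgeDarts A := hoff _ hyd.symm
      rw [hCsymm] at h2
      rw [region_rev_iff h2] at h1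
      exact absurd (Or.inl (ih h1 rfl)) h2

omit [Finite D] in
theorem isDirCycle_pair {d e : D} (hde : G.head d = G.tail e) (hed : G.head e = G.tail d)
    (hne : e ≠ G.rev d) (ht : G.tail d ≠ G.tail e) : G.IsDirCycle {d, e} where
  nonempty := ⟨d, Or.inl rfl⟩
  rev_notMem := by
    rintro _ (rfl | rfl) (h | h)
    · exact G.rev_ne _ h
    · exact hne h.symm
    · exact hne (G.rev_eq_comm.1 h)
    · exact G.rev_ne _ h
  tail_inj := by
    rintro _ (rfl | rfl) _ (rfl | rfl) h
    exacts [rfl, absurd h ht, absurd h.symm ht, rfl]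
  head_inj := by
    rintro _ (rfl | rfl) _ (rfl | rfl) h
    exacts [rfl, absurd (hed.symm.trans (h.symm.trans hde)) ht,
      absurd (hed.symm.trans (h.trans hde)) ht, rfl]
  next := by
    rintro _ (rfl | rfl)
    exacts [⟨e, Or.inr rfl, hde.symm⟩, ⟨d, Or.inl rfl, hed.symm⟩]
  prev := by
    rintro _ (rfl | rfl)
    exacts [⟨e, Or.inr rfl, hed⟩, ⟨d, Or.inl rfl, hde⟩]
  induct := by
    rintro X ⟨_, rfl | rfl, h⟩ hs
    · have h2 := hs _ (Or.inl rfl) _ (Or.inr rfl) h hde.symm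
      rintro _ (rfl | rfl) <;> assumption
    · have h2 := hs _ (Or.inr rfl) _ (Or.inl rfl) h hed.symm
      rintro _ (rfl | rfl) <;> assumption

omit [Finite D] in
theorem isDirCycle_triple {d e f : D} (hde : G.head d = G.tail e) (hef : G.head e = G.tail f)
    (hfd : G.head f = G.tail d) (h1 : G.tail d ≠ G.tail e) (h2 : G.tail e ≠ G.tail f)
    (h3 : G.tail f ≠ G.tail d) : G.IsDirCycle {d, e, f} where
  nonempty := ⟨d, Or.inl rfl⟩
  rev_notMem := by
    have key : ∀ a b, G.rev a = b → G.tail a = G.head b ∧ G.head a = G.tail b := by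
      rintro a _ rfl
      exact ⟨(G.head_rev a).symm, rfl⟩
    rintro a ha hb
    obtain ⟨hh, ht⟩ := key a _ rfl
    rcases ha with rfl | rfl | rfl <;> rcases hb with hb | hb | hb <;> rw [hb] at hh ht
    all_goals grind
  tail_inj := by
    rintro _ (rfl | rfl | rfl) _ (rfl | rfl | rfl) h <;> grind
  head_inj := by
    rintro _ (rfl | rfl | rfl) _ (rfl | rfl | rfl) h <;> grind
  next := by
    rintro _ (rfl | rfl | rfl)
    exacts [⟨e, Or.inr (Or.inl rfl), hde.symm⟩, ⟨f, Or.inr (Or.inr rfl), hef.symm⟩,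
      ⟨d, Or.inl rfl, hfd.symm⟩]
  prev := by
    rintro _ (rfl | rfl | rfl)
    exacts [⟨f, Or.inr (Or.inr rfl), hfd⟩, ⟨d, Or.inl rfl, hde⟩, ⟨e, Or.inr (Or.inl rfl), hef⟩]
  induct := by
    have hd : d ∈ ({d, e, f} : Set D) := Or.inl rfl
    have he : e ∈ ({d, e, f} : Set D) := Or.inr (Or.inl rfl)
    have hf : f ∈ ({d, e, f} : Set D) := Or.inr (Or.inr rfl)
    intro X hX hs
    have s1 := fun h => hs d hd e he h hde.symm
    have s2 := fun h => hs e he f hf h hef.symm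
    have s3 := fun h => hs f hf d hd h hfd.symm
    obtain ⟨_, rfl | rfl | rfl, h⟩ := hX
    · rintro _ (rfl | rfl | rfl)
      exacts [h, s1 h, s2 (s1 h)]
    · rintro _ (rfl | rfl | rfl)
      exacts [s3 (s2 h), h, s2 h]
    · rintro _ (rfl | rfl | rfl)
      exacts [s3 h, s1 (s3 h), h]

end Jordan

end RotSys

/-! ### The BRT condition in terms of corners at red vertices. -/

namespace RotSys

section Local

variable {V D : Type*} {G : RotSys V D}

variable (G) in
/-- The condition that all BR-components are triangulated, in terms of the corners at the red
vertices. -/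
structure LocallyTriangulated : Prop where
  exists_dart : ∀ v ∈ G.red, ∃ d, G.tail d = v
  face_ne : ∀ d, G.head d ∈ G.red → G.face d ≠ G.rev d
  digon : ∀ d, G.tail d ∈ G.blue → G.head d ∈ G.red → G.head (G.face d) ∈ G.blue →
    G.head (G.face d) = G.tail d
  triangle : ∀ d, G.tail d ∈ G.blue → G.head d ∈ G.red → G.head (G.face d) ∈ G.red →
    G.head (G.face (G.face d)) = G.tail d
  red_face : ∀ d, G.tail d ∈ G.red → G.head d ∈ G.red → G.head (G.face d) ∈ G.red →
    G.face (G.face d) = d ∨ G.face (G.face (G.face d)) = d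

variable (G) in
def LoopFree : Prop := ∀ d, G.tail d ≠ G.head d

variable (G) in
def NoBlueBlue : Prop := ∀ d, ¬ (G.tail d ∈ G.blue ∧ G.head d ∈ G.blue)

/-! ### BR-components -/

theorem notMem_red {v : V} : v ∉ G.red ↔ v ∈ G.blue := Set.notMem_compl_iff

theorem NoBlueBlue.head_red (h : G.NoBlueBlue) {d : D} (hd : G.tail d ∈ G.blue) :
    G.head d ∈ G.red := fun h' => h d ⟨hd, h'⟩

theorem mem_redPart {M : G.RedComponent} {v : V} : v ∈ G.redPart M ↔
    ∃ h : v ∈ G.red, (G.graph.induce G.red).connectedComponentMk ⟨v, h⟩ = M := by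
  constructor
  · rintro ⟨⟨v, h⟩, hM, rfl⟩
    exact ⟨h, hM⟩
  · rintro ⟨h, hM⟩
    exact ⟨⟨v, h⟩, hM, rfl⟩

theorem red_of_mem_redPart {M : G.RedComponent} {v : V} (h : v ∈ G.redPart M) : v ∈ G.red :=
  (mem_redPart.1 h).1

theorem head_mem_redPart {M : G.RedComponent} {d : D} (h : G.tail d ∈ G.redPart M)
    (hr : G.head d ∈ G.red) : G.head d ∈ G.redPart M := by
  obtain ⟨h1, h2⟩ := mem_redPart.1 h
  refine mem_redPart.2 ⟨hr, ?_⟩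
  rw [← h2]
  by_cases heq : G.tail d = G.head d
  · congr 2
    exact heq.symm
  · refine SimpleGraph.ConnectedComponent.sound (SimpleGraph.Adj.reachable ?_).symm
    exact ⟨heq, d, rfl, rfl⟩

theorem reachAvoiding_of_mem_redPart {M : G.RedComponent} {u v β : V} (hu : u ∈ G.redPart M)
    (hv : v ∈ G.redPart M) (hβ : β ∈ G.blue) : G.ReachAvoiding β u v := by
  obtain ⟨hu1, hu2⟩ := mem_redPart.1 hu
  obtain ⟨hv1, hv2⟩ := mem_redPart.1 hv
  obtain ⟨w⟩ := SimpleGraph.ConnectedComponent.exact (hu2.trans hv2.symm)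
  have key : ∀ (x y : G.red), (G.graph.induce G.red).Walk x y → G.ReachAvoiding β x.1 y.1 := by
    intro x y w
    induction w with
    | nil => exact .refl
    | @cons a b c hadj _ ih =>
      obtain ⟨-, d, h1, h2⟩ := hadj
      refine Relation.ReflTransGen.head ⟨?_, d, h1, h2⟩ ih
      intro hb
      have hb' : b.1 = β := hb
      exact b.2 (hb' ▸ hβ)
  exact key _ _ w

/-- A BR-component keeps all darts at its red vertices; only at blue vertices can darts be missing.
-/
theorem mem_starDarts (hl : G.LoopFree) {M : G.RedComponent} {d : D}
    (h : G.tail d ∈ G.redPart M) : d ∈ G.subDarts (G.star M) Set.univ := by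
  refine ⟨trivial, trivial, Or.inl h, ?_⟩
  by_cases hb : G.head d ∈ G.red
  · exact Or.inl (head_mem_redPart h hb)
  · exact Or.inr ⟨notMem_red.1 hb, _, h, hl d, d, rfl, rfl⟩

theorem rev_mem_subDarts {U : Set V} {P : Set D} {d : D} :
    G.rev d ∈ G.subDarts U P ↔ d ∈ G.subDarts U P := by
  have h1 : ∀ d, d ∈ G.subDarts U P → G.rev d ∈ G.subDarts U P := fun d hd =>
    ⟨hd.2.1, by rw [G.rev_rev]; exact hd.1, hd.2.2.2, by rw [head_rev]; exact hd.2.2.1⟩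
  exact ⟨fun h => by simpa [G.rev_rev] using h1 _ h, h1 d⟩

theorem mem_starDarts' (hl : G.LoopFree) {M : G.RedComponent} {d : D}
    (h : G.head d ∈ G.redPart M) : d ∈ G.subDarts (G.star M) Set.univ :=
  rev_mem_subDarts.1 (mem_starDarts hl h)

theorem head_mem_redPart_of_star (hb : G.NoBlueBlue) {M : G.RedComponent} {d : D}
    (h : d ∈ G.subDarts (G.star M) Set.univ) (hd : G.tail d ∈ G.blue) :
    G.head d ∈ G.redPart M := by
  rcases h.2.2.2 with h | h
  · exact h
  · exact absurd ⟨hd, h.1⟩ (hb d)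

theorem tail_mem_redPart_of_star {M : G.RedComponent} {d : D}
    (h : d ∈ G.subDarts (G.star M) Set.univ) (hd : G.tail d ∈ G.red) :
    G.tail d ∈ G.redPart M := by
  rcases h.2.2.1 with h | h
  · exact h
  · exact absurd h.1 hd

theorem exists_mem_redPart {v : V} (h : v ∈ G.red) : ∃ M : G.RedComponent, v ∈ G.redPart M :=
  ⟨_, mem_redPart.2 ⟨h, rfl⟩⟩

variable [Finite D]

/-- At a red vertex nothing is skipped, so faces of the BR-component turn there as faces of `G` do.
-/
theorem star_face_eq (ht : G.TailRot) (hl : G.LoopFree) {M : G.RedComponent}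
    {x : G.subDarts (G.star M) Set.univ} (h : G.head x.1 ∈ G.red) :
    ((G.induce (G.star M)).face x).1 = G.face x.1 := by
  refine sub_face_eq (mem_starDarts hl ?_)
  rw [ht.tail_face]
  exact tail_mem_redPart_of_star (rev_mem_subDarts.2 x.2) h

theorem star_tail_face (ht : G.TailRot) {M : G.RedComponent}
    (x : G.subDarts (G.star M) Set.univ) :
    G.tail ((G.induce (G.star M)).face x).1 = G.head x.1 :=
  sub_face_induct (Q := fun y => G.tail y = G.head x.1) (ht.tail_face _)
    fun y _ h => (ht.inv y).trans h

/-- A face of length two or three is followed through its red corners, where it agrees with `G`. At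
a blue corner only the vertex is the same, which is why the digon and triangle conditions compare
vertices and not darts. -/
theorem IsBRT.locallyTriangulated (h : G.IsBRT) : G.LocallyTriangulated := by
  have ht := h.plane.tailRot
  have hl : G.LoopFree := h.no_loop
  have hb : G.NoBlueBlue := h.no_blue_blue
  have per : ∀ d, G.head d ∈ G.red → ∃ (M : G.RedComponent) (x : G.subDarts (G.star M) Set.univ),
      x.1 = d ∧ ((G.induce (G.star M)).face ((G.induce (G.star M)).face x) = x ∨
        (G.induce (G.star M)).face ((G.induce (G.star M)).face
          ((G.induce (G.star M)).face x)) = x) ∧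
      (G.induce (G.star M)).face x ≠ (G.induce (G.star M)).rev x := by
    intro d hd
    obtain ⟨M, hM⟩ := exists_mem_redPart hd
    refine ⟨M, ⟨d, mem_starDarts' hl hM⟩, rfl, ?_⟩
    obtain ⟨hp, hne⟩ := (h.triangulated M).2 ⟨d, mem_starDarts' hl hM⟩
    refine ⟨?_, hne⟩
    have hpt := Function.isPeriodicPt_minimalPeriod (G.induce (G.star M)).face
      ⟨d, mem_starDarts' hl hM⟩
    rcases hp with hp | hp
    · rw [hp] at hpt
      exact Or.inl hpt
    · rw [hp] at hpt
      exact Or.inr hpt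
  refine ⟨fun v hv => ?_, fun d hd => ?_, fun d h1 h2 h3 => ?_, fun d h1 h2 h3 => ?_,
    fun d h1 h2 h3 => ?_⟩
  · by_contra! hno
    have hall : ∀ u, u = v := fun u =>
      connected_induct h.plane.connected (p := fun u => u = v) rfl
        (fun d hd => absurd hd (hno d)) u
    obtain ⟨M, -⟩ := exists_mem_redPart hv
    obtain ⟨x⟩ := (h.triangulated M).1
    exact hno _ (hall (G.tail x.1))
  · obtain ⟨M, x, rfl, -, hne⟩ := per d hd
    intro heq
    refine hne (Subtype.ext ?_)
    rw [star_face_eq ht hl hd, heq]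
    rfl
  · obtain ⟨M, x, rfl, hp, -⟩ := per d h2
    have e1 := star_face_eq ht hl h2
    rcases hp with hp | hp
    · have := star_tail_face ht ((G.induce (G.star M)).face x)
      rw [hp, e1] at this
      exact this.symm
    · exfalso
      have h4 := star_tail_face ht ((G.induce (G.star M)).face x)
      have h5 := star_tail_face ht ((G.induce (G.star M)).face ((G.induce (G.star M)).face x))
      rw [hp] at h5
      rw [e1] at h4
      exact hb _ ⟨h4 ▸ h3, h5 ▸ h1⟩
  · obtain ⟨M, x, rfl, hp, -⟩ := per d h2
    have e1 := star_face_eq ht hl h2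
    have e2 := star_face_eq ht hl (x := (G.induce (G.star M)).face x) (by rwa [e1])
    rw [e1] at e2
    have h4 := star_tail_face ht ((G.induce (G.star M)).face x)
    have h5 := star_tail_face ht ((G.induce (G.star M)).face ((G.induce (G.star M)).face x))
    rcases hp with hp | hp
    · rw [hp, e1] at h4
      rw [h4] at h1
      exact absurd h1 h3
    · rw [hp, e2] at h5
      exact h5.symm
  · obtain ⟨M, x, rfl, hp, -⟩ := per d h2
    have e1 := star_face_eq ht hl h2
    have e2 := star_face_eq ht hl (x := (G.induce (G.star M)).face x) (by rwa [e1])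
    rw [e1] at e2
    rcases hp with hp | hp
    · left
      rw [← e2, hp]
    · right
      have h5 := star_tail_face ht ((G.induce (G.star M)).face ((G.induce (G.star M)).face x))
      rw [hp] at h5
      have e3 := star_face_eq ht hl
        (x := (G.induce (G.star M)).face ((G.induce (G.star M)).face x)) (by rwa [← h5])
      rw [e2, hp] at e3
      exact e3.symm

variable [Finite V]

/-- A face of a BR-component closes up at its blue corner. -/
theorem IsPlane.star_face_closes (hG : G.IsPlane) (hb : G.NoBlueBlue)
    {M : G.RedComponent} {A : Set D} (hA : G.IsDirCycle A)
    (hAM : A ⊆ G.subDarts (G.star M) Set.univ) {β : V} (hβ : β ∈ G.blue)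
    (hface : ∀ a ∈ A, G.head a ≠ β → G.face a ∈ A) {d : D} (hd : d ∈ A) (hdβ : G.tail d = β)
    {l : G.subDarts (G.star M) Set.univ} (hl1 : l.1 ∈ A) (hl2 : G.head l.1 = β) :
    ((G.induce (G.star M)).face l).1 = d := by
  have ht := hG.tailRot
  set y := (G.induce (G.star M)).face l with hy
  have hyL : y.1 ∈ G.region (G.edgeDarts A) A :=
    sub_face_induct (Q := fun y => y ∈ G.region (G.edgeDarts A) A)
      (region_face_iff.2 (subset_region hl1)) fun z hz hzL => by
        rw [rot_inv_apply, region_face_iff, region_rev_iff]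
        · exact hzL
        · rintro (h | h)
          · exact hz (hAM h)
          · exact hz (rev_mem_subDarts.1 (hAM h))
  have hyβ : G.tail y.1 = β := (star_tail_face ht l).trans hl2
  have hyC : y.1 ∈ G.edgeDarts A := by
    by_contra hyC
    have h1 := head_mem_redPart_of_star hb y.2 (hyβ ▸ hβ)
    have h2 := head_mem_redPart_of_star hb (hAM hd) (hdβ ▸ hβ)
    -- If the face turned into a dart `y` off the cycle, the head of `y` would lie in the same red
    -- component as the head of `d`, hence be reachable without passing through `β`. A pocket
    -- contains nothing of this kind.
    have h3 := hG.pocket hA hface hd (fun h => red_of_mem_redPart h2 (h ▸ hβ))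
      (reachAvoiding_of_mem_redPart h2 h1 hβ) ((region_rev_iff hyC).2 hyL) rfl
    exact hyC (Or.inr h3)
  rcases hyC with h | h
  · exact hA.tail_inj _ h _ hd (hyβ.trans hdβ.symm)
  · have := hG.rev_notMem_region hA h
    rw [G.rev_rev] at this
    exact absurd hyL this

/-- A face with a blue corner is read from there: the corner conditions give its two or three darts,
and `IsPlane.star_face_closes` brings it back to the start. Other faces have red corners only and
agree with faces of `G`. -/
theorem LocallyTriangulated.isBRT (h : G.LocallyTriangulated) (hG : G.IsPlane) (hl : G.LoopFree)
    (hb : G.NoBlueBlue) : G.IsBRT := by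
  have ht := hG.tailRot
  refine ⟨hG, hl, hb, fun M => ⟨?_, ?_⟩⟩
  · obtain ⟨⟨v, hv⟩, hM⟩ := M.exists_rep
    obtain ⟨d, rfl⟩ := h.exists_dart v hv
    exact ⟨⟨d, mem_starDarts hl (mem_redPart.2 ⟨hv, hM⟩)⟩⟩
  let φ := (G.induce (G.star M)).face
  have hφ : ∀ x : G.subDarts (G.star M) Set.univ, G.head x.1 ∈ G.red → (φ x).1 = G.face x.1 :=
    fun x hx => star_face_eq ht hl hx
  have hφt : ∀ x, G.tail (φ x).1 = G.head x.1 := star_tail_face ht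
  have hnf : ∀ x, φ x ≠ x := fun x hx => by
    have h1 := hφt x
    rw [hx] at h1
    exact hl _ h1
  have p2 : ∀ x, φ (φ x) = x → Function.minimalPeriod φ x = 2 := fun x hx => by
    have : Fact (Nat.Prime 2) := ⟨Nat.prime_two⟩
    exact Function.minimalPeriod_eq_prime hx (hnf x)
  have p3 : ∀ x, φ (φ (φ x)) = x → Function.minimalPeriod φ x = 3 := fun x hx => by
    have : Fact (Nat.Prime 3) := ⟨Nat.prime_three⟩
    exact Function.minimalPeriod_eq_prime hx (hnf x)
  -- The inequality in the second case serves to exclude, at the end, a single edge seen from both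
  -- sides at its blue end.
  have blue_tail : ∀ x : G.subDarts (G.star M) Set.univ, G.tail x.1 ∈ G.blue →
      φ (φ x) = x ∨ (φ (φ (φ x)) = x ∧ G.tail (φ (φ x)).1 ≠ G.head x.1) := by
    intro x hx
    have h1 := hb.head_red hx
    have e1 := hφ x h1
    have t1 := hφt x
    have t2 := hφt (φ x)
    have hβr : G.tail x.1 ≠ G.head x.1 := hl _
    by_cases hc : G.head (G.face x.1) ∈ G.red
    · right
      have e2 := hφ (φ x) (by rwa [e1])
      have h2 := h.triangle _ hx h1 hc
      rw [← e1, ← e2] at h2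
      rw [← e1] at hc
      have h3 : G.head (φ x).1 ≠ G.tail x.1 := fun h' => hc (h' ▸ hx)
      have t3 := hl (φ x).1
      rw [t1] at t3
      refine ⟨Subtype.ext ?_, by rw [t2]; exact t3.symm⟩
      refine hG.star_face_closes hb (A := {x.1, (φ x).1, (φ (φ x)).1})
        (isDirCycle_triple t1.symm t2.symm h2 ?_ ?_ ?_) ?_ hx ?_ (Or.inl rfl) rfl
        (Or.inr (Or.inr rfl)) h2
      · rwa [t1]
      · rwa [t1, t2]
      · rwa [t2]
      · rintro _ (rfl | rfl | rfl)
        exacts [x.2, (φ x).2, (φ (φ x)).2]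
      · rintro _ (rfl | rfl | rfl) hne
        · exact Or.inr (Or.inl e1.symm)
        · exact Or.inr (Or.inr e2.symm)
        · exact absurd h2 hne
    · left
      have h2 := h.digon _ hx h1 (notMem_red.1 hc)
      have h0 := h.face_ne _ h1
      rw [← e1] at h2 h0
      refine Subtype.ext ?_
      refine hG.star_face_closes hb (A := {x.1, (φ x).1})
        (isDirCycle_pair t1.symm h2 h0 (by rwa [t1])) ?_ hx ?_ (Or.inl rfl) rfl (Or.inr rfl) h2
      · rintro _ (rfl | rfl)
        exacts [x.2, (φ x).2]
      · rintro _ (rfl | rfl) hne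
        · exact Or.inr e1.symm
        · exact absurd h2 hne
  have per_blue : ∀ x : G.subDarts (G.star M) Set.univ, G.tail x.1 ∈ G.blue →
      Function.minimalPeriod φ x = 2 ∨ Function.minimalPeriod φ x = 3 := fun x hx =>
    (blue_tail x hx).imp (p2 x) fun h => p3 x h.1
  have per_apply : ∀ x, Function.minimalPeriod φ (φ x) = Function.minimalPeriod φ x := fun x =>
    Function.minimalPeriod_apply (Function.Injective.mem_periodicPts φ.injective x)
  intro x
  constructor
  -- The period is constant along a face, so the starting dart may be moved to a blue tail whenever
  -- the face has a blue vertex.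
  · change Function.minimalPeriod φ x = 2 ∨ Function.minimalPeriod φ x = 3
    by_cases h1 : G.tail x.1 ∈ G.red
    · by_cases h2 : G.head x.1 ∈ G.red
      · have e1 := hφ x h2
        by_cases h3 : G.head (φ x).1 ∈ G.red
        · have e2 := hφ _ h3
          have h4 := h.red_face _ h1 h2 (by rwa [← e1])
          rw [← e1, ← e2] at h4
          rcases h4 with h4 | h4
          · exact Or.inl (p2 x (Subtype.ext h4))
          · refine Or.inr (p3 x (Subtype.ext ?_))
            rw [← h4]
            refine hφ _ ?_
            rw [← ht.tail_face, h4]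
            exact h1
        · rw [← per_apply, ← per_apply]
          refine per_blue _ ?_
          rw [hφt]
          exact notMem_red.1 h3
      · rw [← per_apply]
        refine per_blue _ ?_
        rw [hφt]
        exact notMem_red.1 h2
    · exact per_blue x (notMem_red.1 h1)
  · by_cases h2 : G.head x.1 ∈ G.red
    · intro heq
      refine h.face_ne _ h2 ?_
      rw [← hφ x h2]
      exact congrArg Subtype.val heq
    · rw [notMem_red] at h2
      intro heq
      change φ x = _ at heq
      set y := φ x with hy
      have hyr : G.head y.1 = G.tail x.1 := by rw [heq]; exact G.head_rev x.1
      have hyb : G.tail y.1 ∈ G.blue := by rw [hφt]; exact h2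
      rcases blue_tail y hyb with hc | ⟨hc, hc2⟩
      · have : φ y = x := φ.injective hc
        refine h.face_ne y.1 (hb.head_red hyb) ?_
        rw [← hφ y (hb.head_red hyb), this, heq]
        exact (G.rev_rev x.1).symm
      · have : φ (φ y) = x := φ.injective hc
        rw [this, hyr] at hc2
        exact hc2 rfl

end Local

end RotSys

/-! ### Vertex-cuts. -/

namespace RotSys

section VertexCut

variable {V D : Type*} {G : RotSys V D}

/-- The two neighbours on the sides of a corner at a red vertex are joined around it by the face.
This links consecutive neighbours of a red vertex without using the vertex itself. -/
theorem TailRot.head_face_eq_or (ht : G.TailRot) (h : G.LocallyTriangulated) {x : D}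
    (hx : G.head x ∈ G.red) : G.head (G.face x) = G.tail x ∨
      ∃ y, G.tail y = G.head (G.face x) ∧ G.head y = G.tail x := by
  by_cases hu : G.tail x ∈ G.red
  · by_cases hw : G.head (G.face x) ∈ G.red
    · rcases h.red_face x hu hx hw with h1 | h1
      · left
        rw [← ht.tail_face, h1]
      · right
        refine ⟨G.face (G.face x), ht.tail_face _, ?_⟩
        rw [← ht.tail_face, h1]
    · right
      rw [notMem_red] at hw
      -- The corner conditions start at a blue tail, so the red-red-blue corner is read one dart
      -- earlier. That dart starts at the blue vertex, since a red start would make the whole face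
      -- red.
      obtain ⟨y, rfl⟩ := G.face.surjective x
      rw [ht.tail_face] at hu ⊢
      by_cases hy : G.tail y ∈ G.red
      · exfalso
        rcases h.red_face y hy hu hx with h1 | h1
        · rw [h1] at hw
          exact hu hw
        · rw [← ht.tail_face, h1] at hw
          exact hy hw
      · exact ⟨y, (h.triangle y (notMem_red.1 hy) hu hx).symm, rfl⟩
  · rw [notMem_red] at hu
    by_cases hw : G.head (G.face x) ∈ G.red
    · exact Or.inr ⟨G.face (G.face x), ht.tail_face _, h.triangle x hu hx hw⟩
    · exact Or.inl (h.digon x hu hx (notMem_red.1 hw))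

theorem ReachAvoiding.reachable {β u w : V} (h : G.ReachAvoiding β u w)
    (hu : u ∈ ({β}ᶜ : Set V)) : ∃ hw : w ∈ ({β}ᶜ : Set V),
      (G.graph.induce ({β}ᶜ : Set V)).Reachable ⟨u, hu⟩ ⟨w, hw⟩ := by
  induction h with
  | refl => exact ⟨hu, SimpleGraph.Reachable.refl _⟩
  | @tail a b _ hab ih =>
    obtain ⟨ha, hr⟩ := ih
    obtain ⟨hb, d, rfl, rfl⟩ := hab
    refine ⟨hb, ?_⟩
    by_cases heq : G.tail d = G.head d
    · simpa only [heq] using hr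
    · exact hr.trans (SimpleGraph.Adj.reachable ⟨heq, d, rfl, rfl⟩)

variable [Finite D]

/-- In a BRT-graph all cut vertices are blue. -/
theorem IsBRT.blue_of_isCutVertex (hG : G.IsBRT) {v : V} (hv : G.IsCutVertex v) :
    v ∈ G.blue := by
  by_contra hvr
  have ht := hG.plane.tailRot
  have hL := hG.locallyTriangulated
  obtain ⟨d₀, rfl⟩ := hL.exists_dart v hvr
  have hne : G.head d₀ ≠ G.tail d₀ := (hG.no_loop d₀).symm
  -- Turning once around the red vertex links all its neighbours while avoiding it.
  have h1 : ∀ d, G.tail d = G.tail d₀ → G.ReachAvoiding (G.tail d₀) (G.head d₀) (G.head d) := by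
    intro d hd
    refine hG.plane.rot_inv_induct (d := d₀) (e := d)
      (Q := fun d => G.ReachAvoiding (G.tail d₀) (G.head d₀) (G.head d)) hd.symm .refl ?_
    intro z hz hzd
    have hzr : G.head (G.rev z) ∈ G.red := by rwa [head_rev, hzd]
    rw [rot_inv_apply]
    have hne' : G.head (G.face (G.rev z)) ≠ G.tail d₀ := by
      have h3 : G.tail (G.face (G.rev z)) = G.tail d₀ := by rw [ht.tail_face, head_rev, hzd]
      rw [← h3]
      exact (hG.no_loop _).symm
    rcases ht.head_face_eq_or hL hzr with h | ⟨y, hy1, hy2⟩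
    · rw [h]
      exact hz
    · exact hz.tail ⟨hne', G.rev y, hy2, by rw [head_rev, hy1]⟩
  have h2 : ∀ u, u ≠ G.tail d₀ → G.ReachAvoiding (G.tail d₀) (G.head d₀) u := by
    intro u
    refine connected_induct hG.plane.connected (u := G.tail d₀)
      (p := fun u => u ≠ G.tail d₀ → G.ReachAvoiding (G.tail d₀) (G.head d₀) u)
      (fun h => absurd rfl h) (fun d hd hdv => ?_) u
    by_cases hdt : G.tail d = G.tail d₀
    · exact h1 d hdt
    · exact (hd hdt).tail ⟨hdv, d, rfl, rfl⟩
  refine hv fun ⟨a, ha⟩ ⟨b, hb⟩ => ?_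
  obtain ⟨_, ha'⟩ := (h2 a ha).reachable hne
  obtain ⟨_, hb'⟩ := (h2 b hb).reachable hne
  exact ha'.symm.trans hb'

variable [Finite V]

/-- A connected induced subgraph of a BRT-graph that contains all neighbours of its red vertices. -/
theorem IsBRT.induce (hG : G.IsBRT) (U : Set V)
    (hU : ∀ d, G.tail d ∈ U → G.tail d ∈ G.red → G.head d ∈ U)
    (hc : (G.induce U).graph.Connected) : (G.induce U).IsBRT := by
  have ht := hG.plane.tailRot
  have hL := hG.locallyTriangulated
  -- Red vertices of `U` keep all their darts, so their corners are those of `G`.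
  have hface : ∀ x : G.subDarts U Set.univ, G.head x.1 ∈ G.red →
      ((G.induce U).face x).1 = G.face x.1 := fun x hx => by
    refine sub_face_eq ⟨trivial, trivial, ?_, hU _ ?_ ?_⟩
    · rw [ht.tail_face]
      exact x.2.2.2.2
    · rw [ht.tail_face]
      exact x.2.2.2.2
    · rwa [ht.tail_face]
  refine LocallyTriangulated.isBRT ⟨?_, ?_, ?_, ?_, ?_⟩ (hG.plane.sub U Set.univ hc)
    (fun x h => hG.no_loop x.1 (congrArg Subtype.val h)) (fun x h => hG.no_blue_blue x.1 h)
  · rintro ⟨v, hv⟩ hr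
    obtain ⟨d, rfl⟩ := hL.exists_dart v hr
    exact ⟨⟨d, trivial, trivial, hv, hU d hv hr⟩, rfl⟩
  · intro x hx h
    refine hL.face_ne x.1 hx ?_
    rw [← hface x hx, h]
    rfl
  · intro x h1 h2 h3
    refine Subtype.ext ?_
    have h4 := hL.digon x.1 h1 h2
    rw [← hface x h2] at h4
    exact h4 h3
  · intro x h1 h2 h3
    refine Subtype.ext ?_
    have h4 := hL.triangle x.1 h1 h2
    rw [← hface x h2] at h4
    rw [← hface _ h3] at h4
    exact h4 h3
  · intro x h1 h2 h3
    have h4 := hL.red_face x.1 h1 h2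
    rw [← hface x h2] at h4
    rw [← hface _ h3] at h4
    rcases h4 h3 with h5 | h5
    · exact Or.inl (Subtype.ext h5)
    · right
      refine Subtype.ext ?_
      rw [hface, h5]
      rw [← ht.tail_face, h5]
      exact h1

/-- Only `v` can lose neighbours, and it is blue. Paths of `G` that leave the branches return
through `v`, so the part stays connected. -/
theorem IsBRT.vertexCut (hG : G.IsBRT) {v : V} (hv : G.IsCutVertex v) (I : Set (G.Branch v)) :
    (G.induce (G.branchSet v I)).IsBRT := by
  have hvb := hG.blue_of_isCutVertex hv
  have hU : ∀ d, G.tail d ∈ G.branchSet v I → G.tail d ≠ v → G.head d ∈ G.branchSet v I := by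
    rintro d (h | ⟨h, hI⟩) hne
    · exact absurd h hne
    · by_cases hd : G.head d = v
      · exact Or.inl hd
      · refine Or.inr ⟨hd, ?_⟩
        have hadj : (G.graph.induce ({v}ᶜ : Set V)).Adj ⟨G.tail d, h⟩ ⟨G.head d, hd⟩ :=
          ⟨hG.no_loop d, d, rfl, rfl⟩
        have h1 : (G.graph.induce ({v}ᶜ : Set V)).connectedComponentMk ⟨G.head d, hd⟩ =
            (G.graph.induce ({v}ᶜ : Set V)).connectedComponentMk ⟨G.tail d, h⟩ :=
          (SimpleGraph.ConnectedComponent.sound (SimpleGraph.Adj.reachable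
            hadj)).symm
        rwa [h1]
  refine hG.induce _ (fun d h1 h2 => hU d h1 fun h => h2 (h ▸ hvb)) ?_
  refine connected_iff.2 ⟨⟨v, Or.inl rfl⟩, fun p hp hd x => ?_⟩
  have := connected_induct hG.plane.connected (u := v)
    (p := fun y => ∀ hy : y ∈ G.branchSet v I, p ⟨y, hy⟩) (fun _ => hp) (fun d ih hy => ?_) x.1
  · exact this x.2
  · by_cases hv : G.head d = v
    · convert hp using 2
      exact Subtype.ext hv
    · have h1 : G.tail d ∈ G.branchSet v I := by
        have := hU (G.rev d) hy hv
        rwa [head_rev] at this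
      exact hd ⟨d, trivial, trivial, h1, hy⟩ (ih h1)

end VertexCut

end RotSys

/-! ### The overlay of a graph and a curve: white vertices, extension of face functions, isolated
crossings. -/

namespace RotSys

section Overlay

variable {V D W E : Type*} {G : RotSys V D} [Finite E]

namespace Overlay

variable (O : G.Overlay W E)

/-- The first piece of a dart. -/
def first (d : D) : E := (O.pieces d).head (O.pieces_ne_nil d)

theorem length_pieces_pos (d : D) : 0 < (O.pieces d).length :=
  List.length_pos_iff.2 (O.pieces_ne_nil d)

theorem first_eq_getElem (d : D) : O.first d = (O.pieces d)[0]'(O.length_pieces_pos d) :=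
  List.head_eq_getElem _

theorem first_mem (d : D) : O.first d ∈ O.pieces d := List.head_mem _

theorem tail_first (d : D) : O.H.tail (O.first d) = Sum.inl (G.tail d) := O.pieces_tail d

theorem length_pieces_rev (d : D) : (O.pieces (G.rev d)).length = (O.pieces d).length := by
  rw [O.pieces_rev, List.length_reverse, List.length_map]

theorem rev_mem_pieces {d : D} {e : E} (h : e ∈ O.pieces d) :
    O.H.rev e ∈ O.pieces (G.rev d) := by
  rw [O.pieces_rev, List.mem_reverse]
  exact List.mem_map_of_mem h

theorem getLast_pieces (d : D) :
    (O.pieces d).getLast (O.pieces_ne_nil d) = O.H.rev (O.first (G.rev d)) := by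
  have h : O.pieces d = ((O.pieces (G.rev d)).map O.H.rev).reverse := by
    rw [← O.pieces_rev, G.rev_rev]
  simp only [h, List.getLast_reverse, List.head_map]
  rfl

theorem notMem_curve_of_mem {d : D} {e : E} (h : e ∈ O.pieces d) :
    e ∉ O.H.cycleDarts O.curve := (O.mem_pieces e).1 ⟨d, h⟩

theorem rev_mem_curve {e : E} : O.H.rev e ∈ O.H.cycleDarts O.curve ↔
    e ∈ O.H.cycleDarts O.curve := O.H.mem_edgeDarts_rev

theorem chain_getElem (d : D) (i : ℕ) (hi : i + 1 < (O.pieces d).length) :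
    ∃ w : W, O.H.head (O.pieces d)[i] = Sum.inr w ∧ O.H.tail (O.pieces d)[i + 1] = Sum.inr w :=
  List.isChain_iff_getElem.1 (O.pieces_chain d) i hi

/-- A piece is the first one or has a white tail. -/
theorem eq_first_or_white {d : D} {e : E} (h : e ∈ O.pieces d) :
    e = O.first d ∨ O.crossings d ≠ 0 ∧ ∃ w : W, O.H.tail e = Sum.inr w := by
  obtain ⟨i, hi, rfl⟩ := List.mem_iff_getElem.1 h
  rcases i with _ | i
  · exact Or.inl (O.first_eq_getElem d).symm
  · refine Or.inr ⟨?_, ?_⟩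
    · rw [crossings]
      omega
    · obtain ⟨w, -, hw⟩ := O.chain_getElem d i hi
      exact ⟨w, hw⟩

theorem pieces_eq_of_crossings_eq_zero {d : D} (h : O.crossings d = 0) :
    O.pieces d = [O.first d] := by
  rw [crossings] at h
  have h1 := O.length_pieces_pos d
  obtain ⟨e, he⟩ := List.length_eq_one_iff.1 (show (O.pieces d).length = 1 by omega)
  simp only [first, he, List.head_cons]

theorem crossings_rev (d : D) : O.crossings (G.rev d) = O.crossings d := by
  rw [crossings, crossings, length_pieces_rev]

theorem rev_first_of_uncrossed {d : D} (h : O.crossings d = 0) :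
    O.H.rev (O.first d) = O.first (G.rev d) := by
  have h1 := O.rev_mem_pieces (O.first_mem d)
  rw [O.pieces_eq_of_crossings_eq_zero (h := (O.crossings_rev d).trans h)] at h1
  exact List.mem_singleton.1 h1

theorem head_first_of_uncrossed {d : D} (h : O.crossings d = 0) :
    O.H.head (O.first d) = Sum.inl (G.head d) := by
  rw [head, O.rev_first_of_uncrossed h, O.tail_first, tail_rev]

theorem head_first_of_crossed {d : D} (h : O.crossings d ≠ 0) :
    ∃ w : W, O.H.head (O.first d) = Sum.inr w := by
  rw [crossings] at h
  obtain ⟨w, hw, -⟩ := O.chain_getElem d 0 (by omega)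
  exact ⟨w, by rw [first_eq_getElem, hw]⟩

/-- A dart off the curve that leaves a vertex of `G` is the first piece of a dart. -/
theorem exists_first {e : E} (he : e ∉ O.H.cycleDarts O.curve) {v : V}
    (hv : O.H.tail e = Sum.inl v) : ∃ d, G.tail d = v ∧ e = O.first d := by
  obtain ⟨d, hd⟩ := (O.mem_pieces e).2 he
  rcases O.eq_first_or_white hd with h | ⟨-, w, hw⟩
  · refine ⟨d, ?_, h⟩
    rw [h, O.tail_first] at hv
    exact Sum.inl_injective hv
  · rw [hw] at hv
    simp at hv

/-! ### White vertices -/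

/-- Curve darts and edge darts alternate among the four darts at a white vertex, so the other edge
dart is the opposite one. -/
theorem white_order {w : W} {y : E} (hy : O.H.tail y = Sum.inr w)
    (hyC : y ∉ O.H.cycleDarts O.curve) :
    O.H.rot (O.H.rot (O.H.rot (O.H.rot y))) = y ∧ ∀ z, O.H.tail z = Sum.inr w →
      z ∉ O.H.cycleDarts O.curve → z ≠ y → z = O.H.rot (O.H.rot y) := by
  classical
  cases nonempty_fintype E
  have ht := O.plane.tailRot
  have t1 : O.H.tail (O.H.rot y) = Sum.inr w := (ht y).trans hy
  have t2 : O.H.tail (O.H.rot (O.H.rot y)) = Sum.inr w := (ht _).trans t1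
  have t3 : O.H.tail (O.H.rot (O.H.rot (O.H.rot y))) = Sum.inr w := (ht _).trans t2
  have c1 := (O.white_cross w y hy).2 hyC
  have c2 := mt (O.white_cross w _ t1).1 (not_not.2 c1)
  have c3 := (O.white_cross w _ t2).2 c2
  have hcard : (Finset.univ.filter fun e => O.H.tail e = Sum.inr w).card = 4 := by
    rw [← O.white_card w, Nat.card_eq_fintype_card, Fintype.card_subtype]
  have hmemF : ∀ z, z ∈ (Finset.univ.filter fun e => O.H.tail e = Sum.inr w) ↔
      O.H.tail z = Sum.inr w := fun z => by simp
  -- If the rotation closed up after two steps, the vertex would have at most two darts.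
  have n02 : y ≠ O.H.rot (O.H.rot y) := by
    intro h
    have hsub : (Finset.univ.filter fun e => O.H.tail e = Sum.inr w) ⊆ {y, O.H.rot y} := by
      intro z hz
      rw [hmemF] at hz
      refine O.plane.rot_induct (d := y) (e := z) (Q := fun z => z ∈ ({y, O.H.rot y} : Finset E))
        (hy.trans hz.symm) (by simp) ?_
      intro u hu _
      simp only [Finset.mem_insert, Finset.mem_singleton] at hu ⊢
      rcases hu with rfl | rfl
      · exact Or.inr rfl
      · exact Or.inl h.symm
    have := (Finset.card_le_card hsub).trans Finset.card_le_two
    omega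
  have n13 : O.H.rot y ≠ O.H.rot (O.H.rot (O.H.rot y)) := fun h => n02 (O.H.rot.injective h)
  have n01 : y ≠ O.H.rot y := fun h => hyC (h ▸ c1)
  have n03 : y ≠ O.H.rot (O.H.rot (O.H.rot y)) := fun h => hyC (h ▸ c3)
  have n12 : O.H.rot y ≠ O.H.rot (O.H.rot y) := fun h => n01 (O.H.rot.injective h)
  have n23 : O.H.rot (O.H.rot y) ≠ O.H.rot (O.H.rot (O.H.rot y)) := fun h =>
    n12 (O.H.rot.injective h)
  have hS : ({y, O.H.rot y, O.H.rot (O.H.rot y), O.H.rot (O.H.rot (O.H.rot y))} : Finset E) =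
      Finset.univ.filter fun e => O.H.tail e = Sum.inr w := by
    refine Finset.eq_of_subset_of_card_le ?_ ?_
    · intro z hz
      rw [hmemF]
      simp only [Finset.mem_insert, Finset.mem_singleton] at hz
      rcases hz with rfl | rfl | rfl | rfl <;> assumption
    · rw [hcard]
      simp [n01, n02, n03, n12, n13, n23]
  have hmem : ∀ z, O.H.tail z = Sum.inr w → z = y ∨ z = O.H.rot y ∨ z = O.H.rot (O.H.rot y) ∨
      z = O.H.rot (O.H.rot (O.H.rot y)) := fun z hz => by
    have h1 := (hmemF z).2 hz
    rw [← hS] at h1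
    simpa only [Finset.mem_insert, Finset.mem_singleton] using h1
  constructor
  · rcases hmem _ ((ht _).trans t3) with h | h | h | h
    · exact h
    · exact absurd (O.H.rot.injective h).symm n03
    · exact absurd (O.H.rot.injective h).symm n13
    · exact absurd (O.H.rot.injective h).symm n23
  · intro z hz hzC hzy
    rcases hmem z hz with rfl | rfl | h | rfl
    · exact absurd rfl hzy
    · exact absurd c1 hzC
    · exact h
    · exact absurd c3 hzC

/-- Consecutive pieces are opposite at the white vertex between them. -/
theorem next_piece {d : D} {i : ℕ} (hi : i + 1 < (O.pieces d).length) :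
    (O.pieces d)[i + 1] = O.H.rot⁻¹ (O.H.rot⁻¹ (O.H.rev (O.pieces d)[i])) := by
  obtain ⟨w, h1, h2⟩ := O.chain_getElem d i hi
  have m1 : (O.pieces d)[i] ∈ O.pieces d := List.getElem_mem _
  have m2 : (O.pieces d)[i + 1] ∈ O.pieces d := List.getElem_mem _
  obtain ⟨h3, h4⟩ := O.white_order (y := (O.pieces d)[i + 1]) h2 (O.notMem_curve_of_mem m2)
  have h5 := h4 (O.H.rev (O.pieces d)[i]) h1
    (O.notMem_curve_of_mem (O.rev_mem_pieces m1)) (by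
      intro heq
      refine G.rev_ne d (O.pieces_unique _ _ _ (O.rev_mem_pieces m1) ?_)
      rwa [heq])
  rw [h5]
  simp

/-! ### Faces of `G` as unions of faces of the overlay -/

omit [Finite E] in
theorem sum_sub_telescope {V' : Type*} (H : RotSys V' E) (p : V' → ℝ) {l : List E} (hl : l ≠ [])
    (hc : l.IsChain fun e e' => H.head e = H.tail e') :
    (l.map fun e => p (H.tail e)).sum - (l.map fun e => p (H.head e)).sum =
      p (H.tail (l.head hl)) - p (H.head (l.getLast hl)) := by
  induction l with
  | nil => exact absurd rfl hl
  | cons a l ih =>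
    rcases l with _ | ⟨b, l⟩
    · simp
    · rw [List.isChain_cons_cons] at hc
      have h1 := ih (List.cons_ne_nil b l) hc.2
      simp only [List.map_cons, List.sum_cons, List.head_cons] at h1 ⊢
      rw [List.getLast_cons_cons, hc.1]
      linarith

variable [Finite D] [Finite V] [Finite W]

/-- Each face of `G` is a union of faces of the overlay separated by arcs of the curve. Only the
flow argument is needed: the difference of `g₀` is spread over the pieces, with zero on the curve,
and integrated in the overlay. -/
theorem exists_extension (hG : G.IsPlane) {g₀ : D → ℝ} (hg₀ : ∀ d, g₀ (G.face d) = g₀ d) :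
    ∃ g : E → ℝ, (∀ e, g (O.H.face e) = g e) ∧
      (∀ e ∈ O.H.cycleDarts O.curve, g (O.H.rev e) = g e) ∧
      ∀ d, ∀ e ∈ O.pieces d, g e = g₀ d := by
  classical
  cases nonempty_fintype D
  cases nonempty_fintype E
  let f₀ : D → ℝ := fun d => g₀ d - g₀ (G.rev d)
  have hf₀ : ∀ d, f₀ (G.rev d) = -f₀ d := fun d => by
    simp only [f₀, G.rev_rev]
    ring
  let f : E → ℝ := fun e => ∑ d, if e ∈ O.pieces d then f₀ d else 0
  have f_piece : ∀ d, ∀ e ∈ O.pieces d, f e = f₀ d := by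
    intro d e he
    simp only [f]
    rw [Finset.sum_eq_single d (fun d' _ hne => if_neg fun h =>
      hne (O.pieces_unique _ _ _ h he)) (fun h => absurd (Finset.mem_univ d) h), if_pos he]
  have f_curve : ∀ e ∈ O.H.cycleDarts O.curve, f e = 0 := by
    intro e he
    exact Finset.sum_eq_zero fun d _ => if_neg fun h => O.notMem_curve_of_mem h he
  have f_rev : ∀ e, f (O.H.rev e) = -f e := by
    intro e
    by_cases he : e ∈ O.H.cycleDarts O.curve
    · rw [f_curve e he, f_curve _ (O.rev_mem_curve.2 he), neg_zero]
    · obtain ⟨d, hd⟩ := (O.mem_pieces e).2 he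
      rw [f_piece d e hd, f_piece _ _ (O.rev_mem_pieces hd), hf₀]
  have f_flow : ∀ p : V ⊕ W → ℝ, ∑ᶠ e, f e * p (O.H.tail e) = 0 := by
    intro p
    rw [finsum_eq_sum_of_fintype]
    let P : D → ℝ := fun d => ((O.pieces d).map fun e => p (O.H.tail e)).sum
    have h1 : ∑ e, f e * p (O.H.tail e) = ∑ d, f₀ d * P d := by
      simp only [f, Finset.sum_mul]
      rw [Finset.sum_comm]
      refine Finset.sum_congr rfl fun d _ => ?_
      simp only [P]
      rw [← List.sum_toFinset _ (O.pieces_nodup d), Finset.mul_sum,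
        ← Finset.sum_filter_add_sum_filter_not Finset.univ (fun e => e ∈ O.pieces d)]
      rw [Finset.sum_eq_zero (s := Finset.univ.filter fun e => ¬ e ∈ O.pieces d), add_zero]
      · refine Finset.sum_congr ?_ fun e he => ?_
        · ext e
          simp
        · rw [if_pos (List.mem_toFinset.1 he)]
      · intro e he
        rw [if_neg (Finset.mem_filter.1 he).2, zero_mul]
    -- Along the pieces of an edge the inner white vertices cancel, so conservation in the overlay
    -- reduces to conservation in `G`.
    have h2 : ∀ d, P d - P (G.rev d) = p (Sum.inl (G.tail d)) - p (Sum.inl (G.head d)) := by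
      intro d
      have h3 : P (G.rev d) = ((O.pieces d).map fun e => p (O.H.head e)).sum := by
        simp only [P]
        rw [O.pieces_rev, List.map_reverse, List.sum_reverse, List.map_map]
        rfl
      rw [h3, sum_sub_telescope O.H p (O.pieces_ne_nil d), O.pieces_tail, O.getLast_pieces,
        head_rev, O.tail_first]
      · rfl
      · refine (O.pieces_chain d).imp ?_
        rintro e e' ⟨w, h4, h5⟩
        rw [h4, h5]
    have h3 : ∑ d, f₀ d * P d = -∑ d, f₀ d * P (G.rev d) := by
      rw [← Equiv.sum_comp G.revPerm, ← Finset.sum_neg_distrib]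
      exact Finset.sum_congr rfl fun d _ => by rw [revPerm_apply, hf₀, neg_mul]
    let q : D → ℝ := fun d => p (Sum.inl (G.tail d))
    have h4 : ∑ d, f₀ d * (P d - P (G.rev d)) = ∑ d, f₀ d * (q d - q (G.rev d)) :=
      Finset.sum_congr rfl fun d _ => by rw [h2]; rfl
    have h5 : ∑ d, f₀ d * q (G.rev d) = -∑ d, f₀ d * q d := by
      rw [← Equiv.sum_comp G.revPerm, ← Finset.sum_neg_distrib]
      exact Finset.sum_congr rfl fun d _ => by rw [revPerm_apply, hf₀, G.rev_rev, neg_mul]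
    have h6 : ∑ d, g₀ d * q d = ∑ d, g₀ d * q (G.rev d) := by
      rw [← Equiv.sum_comp G.face]
      refine Finset.sum_congr rfl fun d _ => ?_
      rw [hg₀]
      simp only [q]
      rw [hG.tailRot.tail_face, tail_rev]
    have h7 : ∑ d, g₀ (G.rev d) * q d = ∑ d, g₀ d * q (G.rev d) := by
      rw [← Equiv.sum_comp G.revPerm]
      exact Finset.sum_congr rfl fun d _ => by rw [revPerm_apply, G.rev_rev]
    have h8 : ∑ d, f₀ d * q d = 0 := by
      simp only [f₀, sub_mul, Finset.sum_sub_distrib, h6, h7, sub_self]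
    simp only [mul_sub, Finset.sum_sub_distrib] at h4
    linarith
  obtain ⟨g, hg, hfg⟩ := (isPlane_iff_flowExact.1 O.plane).2.2 f f_rev f_flow
  have g_curve : ∀ e ∈ O.H.cycleDarts O.curve, g (O.H.rev e) = g e := fun e he => by
    have := hfg e
    rw [f_curve e he] at this
    linarith
  have rot_inv_curve : ∀ e ∈ O.H.cycleDarts O.curve, g (O.H.rot⁻¹ e) = g e := fun e he => by
    rw [rot_inv_apply, hg, g_curve e he]
  have g_piece : ∀ d, ∀ e ∈ O.pieces d, g e = g (O.first d) := by
    intro d e he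
    obtain ⟨i, hi, rfl⟩ := List.mem_iff_getElem.1 he
    clear he
    induction i with
    | zero => rw [first_eq_getElem]
    | succ i ih =>
      rw [← ih (by omega), O.next_piece hi]
      obtain ⟨w, h1, -⟩ := O.chain_getElem d i hi
      have m1 : (O.pieces d)[i] ∈ O.pieces d := List.getElem_mem _
      have h2 : O.H.rot⁻¹ (O.H.rev (O.pieces d)[i]) ∈ O.H.cycleDarts O.curve := by
        by_contra h
        have h3 := (O.white_cross w (O.H.rot⁻¹ (O.H.rev (O.pieces d)[i]))
          ((O.plane.tailRot.inv _).trans h1)).2 h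
        rw [Equiv.Perm.inv_def, Equiv.apply_symm_apply] at h3
        exact O.notMem_curve_of_mem m1 (O.rev_mem_curve.1 h3)
      rw [rot_inv_curve _ h2]
      exact hg _
  have g_face : ∀ d, g (O.first (G.face d)) = g (O.first d) := by
    intro d
    have hmem : ∀ d, O.first d ∈ (O.H.cycleDarts O.curve)ᶜ := fun d =>
      O.notMem_curve_of_mem (O.first_mem d)
    have h1 : (firstReturn O.H.rot (O.H.cycleDarts O.curve)ᶜ
        ⟨O.first (G.face d), hmem _⟩).1 = O.first (G.rot (G.face d)) :=
      O.pieces_rot (G.face d) (hmem _)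
    rw [rot_face] at h1
    have h2 : (firstReturn O.H.rot⁻¹ (O.H.cycleDarts O.curve)ᶜ
        ⟨O.first (G.rev d), hmem _⟩) = ⟨O.first (G.face d), hmem _⟩ := by
      rw [← firstReturn_inv_apply, Equiv.Perm.inv_eq_iff_eq]
      exact Subtype.ext h1.symm
    have h3 := firstReturn_induct (σ := O.H.rot⁻¹) (P := (O.H.cycleDarts O.curve)ᶜ)
      (x := ⟨O.first (G.rev d), hmem _⟩) (Q := fun y => g y = g (O.H.rot⁻¹ (O.first (G.rev d))))
      rfl (fun y hy h => by rw [rot_inv_curve y (not_not.1 hy), h])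
    rw [h2] at h3
    refine h3.trans ?_
    rw [rot_inv_apply, hg, ← O.getLast_pieces]
    exact g_piece d _ (List.getLast_mem _)
  have hdiff : ∀ d, g (O.first d) - g₀ d = g (O.first (G.rev d)) - g₀ (G.rev d) := by
    intro d
    have h1 := hfg (O.first d)
    rw [f_piece d _ (O.first_mem d), g_piece _ _ (O.rev_mem_pieces (O.first_mem d))] at h1
    simp only [f₀] at h1
    linarith
  rcases isEmpty_or_nonempty D with hD | ⟨⟨d₀⟩⟩
  · exact ⟨g, hg, g_curve, fun d => isEmptyElim d⟩
  -- Both face functions on `G` have the same differences across edges, so by connectivity they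
  -- differ by a constant, which is then subtracted.
  · have hconst : ∀ d, g (O.first d) - g₀ d = g (O.first d₀) - g₀ d₀ := by
      refine dart_induct hG.connected (fun d e => (hG.rot_iff d e).2) (d := d₀)
        (Q := fun d => g (O.first d) - g₀ d = g (O.first d₀) - g₀ d₀) rfl (fun z hz => ?_)
        (fun z hz => (hdiff z).symm.trans hz)
      have h1 : G.face (G.rev (G.rot z)) = z := by simp [face_apply, G.rev_rev]
      have h2 := g_face (G.rev (G.rot z))
      have h3 := hg₀ (G.rev (G.rot z))
      rw [h1] at h2 h3
      rw [hdiff, ← h2, ← h3, hz]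
    refine ⟨fun e => g e - (g (O.first d₀) - g₀ d₀), fun e => by simp only [hg],
      fun e he => by simp only [g_curve e he], fun d e he => ?_⟩
    dsimp only
    rw [g_piece d e he]
    linarith [hconst d]

/-- The curve cannot enter a union of faces through one edge only. -/
theorem no_isolated_crossing (hG : G.IsPlane) (hlen : ∀ d, O.crossings d ≤ 2)
    (hdigon : ∀ a ∈ O.H.cycleDarts O.curve, ∀ e ∉ O.H.cycleDarts O.curve,
      (∃ w : W, O.H.tail a = Sum.inr w) → (∃ w : W, O.H.tail e = Sum.inr w) →
      ¬ (O.H.face a = e ∧ O.H.face e = a))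
    (hdart : ∀ v, Sum.inl v ∈ O.H.cycleVertices O.curve → ∃ d, G.tail d = v)
    {Φ : Set D} (hΦ : ∀ d, G.face d ∈ Φ ↔ d ∈ Φ) {δ : D} (hδ : δ ∈ Φ)
    (hcross : O.crossings δ ≠ 0) (honly : ∀ ε ∈ Φ, O.crossings ε ≠ 0 → ε = δ)
    (hoff : ∀ ε ∈ Φ, Sum.inl (G.tail ε) ∉ O.H.cycleVertices O.curve) : False := by
  classical
  -- The function `g` marks the overlay faces inside `Φ`; it is blind to the curve.
  obtain ⟨g, hg, hgC, hgΦ⟩ := O.exists_extension hG (g₀ := Φ.indicator 1) fun d => by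
    by_cases h : d ∈ Φ
    · rw [Set.indicator_of_mem h, Set.indicator_of_mem ((hΦ d).2 h)]
      rfl
    · rw [Set.indicator_of_notMem h, Set.indicator_of_notMem (mt (hΦ d).1 h)]
  have hlen2 : 1 < (O.pieces δ).length := by
    rw [crossings] at hcross
    omega
  have ht := O.plane.tailRot
  set p₁ := (O.pieces δ)[0] with hp₁
  set p₂ := (O.pieces δ)[1] with hp₂
  have m1 : p₁ ∈ O.pieces δ := List.getElem_mem _
  have m2 : p₂ ∈ O.pieces δ := List.getElem_mem _
  obtain ⟨w, h1, h2⟩ : ∃ w : W, O.H.head p₁ = Sum.inr w ∧ O.H.tail p₂ = Sum.inr w :=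
    O.chain_getElem δ 0 hlen2
  -- The arc by which the curve enters the left side of `δ` at its first crossing.
  set a := O.H.face p₁ with ha
  have ha1 : O.H.tail a = Sum.inr w := (ht.tail_face _).trans h1
  have haC : a ∈ O.H.cycleDarts O.curve := by
    by_contra h
    have h3 := (O.white_cross w a ha1).2 h
    rw [ha, rot_face] at h3
    exact O.notMem_curve_of_mem m1 (O.rev_mem_curve.1 h3)
  have hp2a : p₂ = O.H.rot⁻¹ a := O.next_piece hlen2
  have hga : g a = 1 := by
    rw [ha, hg, hgΦ δ _ m1, Set.indicator_of_mem hδ]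
    rfl
  set x := O.H.face a with hx
  have hgx : g x = 1 := (hg a).trans hga
  have hxt : O.H.tail x = O.H.head a := ht.tail_face a
  have hrevC := O.rev_mem_curve.2 haC
  -- If the arc ends at a vertex of `G`, turning there through marked darts meets only the curve,
  -- since no dart of `Φ` starts at this vertex; but some dart of `G` does start there. If it ends
  -- at a white vertex, the curve leaves through a crossed dart of `Φ`, which must be `δ`.
  rcases hav : O.H.head a with v | w'
  · have hvC : Sum.inl v ∈ O.H.cycleVertices O.curve := by
      rw [← hav, ← tail_rev]
      rcases hrevC with ⟨i, hi⟩ | ⟨i, hi⟩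
      · exact ⟨i, by rw [← hi]⟩
      · rw [O.H.rev_rev] at hi
        refine ⟨i + 1, ?_⟩
        dsimp only
        rw [← O.cycle.next, hi, tail_rev]
    have hzero : ∀ y, O.H.tail y = Sum.inl v → g y = 1 → y ∈ O.H.cycleDarts O.curve := by
      intro y hy hgy
      by_contra hyC
      obtain ⟨ε, hε, rfl⟩ := O.exists_first hyC hy
      rw [hgΦ ε _ (O.first_mem ε)] at hgy
      by_cases hεΦ : ε ∈ Φ
      · exact hoff ε hεΦ (hε ▸ hvC)
      · rw [Set.indicator_of_notMem hεΦ] at hgy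
        exact zero_ne_one hgy
    obtain ⟨ε, hε⟩ := hdart v hvC
    have hxv : O.H.tail x = Sum.inl v := hxt.trans hav
    have := O.plane.rot_inv_induct (d := x) (e := O.first ε)
      (Q := fun y => y ∈ O.H.cycleDarts O.curve ∧ g y = 1) (by rw [hxv, O.tail_first, hε])
      ⟨hzero x hxv hgx, hgx⟩ (by
        rintro y ⟨hyC, hgy⟩ hyx
        have h3 : g (O.H.rot⁻¹ y) = 1 := by rw [rot_inv_apply, hg, hgC y hyC, hgy]
        exact ⟨hzero _ ((ht.inv y).trans (hyx.trans hxv)) h3, h3⟩)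
    exact O.notMem_curve_of_mem (O.first_mem ε) this.1
  · have hxw : O.H.tail x = Sum.inr w' := hxt.trans hav
    have hxC : x ∉ O.H.cycleDarts O.curve := by
      rw [← O.white_cross w' x hxw, hx, rot_face]
      exact hrevC
    obtain ⟨ε, hε⟩ := (O.mem_pieces x).2 hxC
    have hεΦ : ε ∈ Φ := by
      by_contra h
      rw [hgΦ ε x hε, Set.indicator_of_notMem h] at hgx
      exact zero_ne_one hgx
    rcases O.eq_first_or_white hε with h | ⟨hεc, -⟩
    · rw [h, O.tail_first] at hxw
      simp at hxw
    obtain rfl := honly ε hεΦ hεc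
    obtain ⟨i, hi, hix⟩ := List.mem_iff_getElem.1 hε
    have hle := hlen ε
    rw [crossings] at hle
    -- With at most two crossings there are three pieces: the first has no white tail, the second
    -- would make the arc its own reverse, and the third gives an empty digon between the arc and
    -- the middle piece.
    obtain rfl | rfl | rfl : i = 0 ∨ i = 1 ∨ i = 2 := by omega
    · rw [← hix, ← O.first_eq_getElem, O.tail_first] at hxw
      simp at hxw
    · change p₂ = x at hix
      rw [hp2a, hx, face_apply] at hix
      exact O.H.rev_ne a (O.H.rot⁻¹.injective hix).symm
    · have h3 : (O.pieces ε)[2] = O.H.rot⁻¹ (O.H.rot⁻¹ (O.H.rev p₂)) := O.next_piece hi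
      rw [hix, hx, face_apply] at h3
      have h4 := O.H.rot⁻¹.injective h3
      refine hdigon _ hrevC p₂ (O.notMem_curve_of_mem m2) ⟨w', hav⟩ ⟨w, h2⟩ ⟨?_, ?_⟩
      · rw [face_apply, O.H.rev_rev, hp2a]
      · rw [h4]
        rfl

end Overlay

end Overlay

end RotSys

/-! ### Where a push-off can cross the faces of a BRT-graph. -/

namespace RotSys

section PushOff

variable {V D W E : Type*} {G : RotSys V D} [Finite E]

theorem IsCycle.reachAvoiding {n : ℕ} [NeZero n] {γ : Fin n → D} (hγ : G.IsCycle γ) {β u w : V}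
    (hβ : β ∉ G.cycleVertices γ) (hu : u ∈ G.cycleVertices γ) (hw : w ∈ G.cycleVertices γ) :
    G.ReachAvoiding β u w := by
  obtain ⟨i, rfl⟩ := hu
  obtain ⟨j, rfl⟩ := hw
  refine hγ.isDirCycle.induct (fun a => G.ReachAvoiding β (G.tail (γ i)) (G.tail a))
    ⟨_, ⟨i, rfl⟩, .refl⟩ ?_ _ ⟨j, rfl⟩
  rintro a - _ ⟨k, rfl⟩ h hk
  exact h.tail ⟨fun h => hβ ⟨k, h⟩, a, rfl, hk.symm⟩

namespace Overlay

/-- The curve passes through `β` or crosses an edge at `β`. -/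
def Touches (O : G.Overlay W E) (β : V) : Prop :=
  Sum.inl β ∈ O.H.cycleVertices O.curve ∨ ∃ ε, G.tail ε = β ∧ O.crossings ε ≠ 0

variable {O : G.Overlay W E} {n : ℕ} {γ : Fin n → D}

theorem IsPushOff.crossings_le_two (hO : O.IsPushOff γ) (d : D) : O.crossings d ≤ 2 := by
  by_cases hd : d ∈ G.cycleDarts γ
  · by_cases hb : G.tail d ∈ G.blue ∨ G.head d ∈ G.blue
    · rw [hO.on_blue d hd hb]
      omega
    · rw [not_or] at hb
      have := hO.on_red d hd hb.1 hb.2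
      omega
  · by_cases h1 : G.tail d ∈ redOn G γ <;> by_cases h2 : G.head d ∈ redOn G γ
    · exact hO.off_two d hd h1 h2
    · have := hO.off_one d hd (Or.inl ⟨h1, h2⟩)
      omega
    · have := hO.off_one d hd (Or.inr ⟨h2, h1⟩)
      omega
    · rw [hO.near d h1 h2]
      omega

theorem IsPushOff.redOn_of_crossed (hO : O.IsPushOff γ) {d : D} (h : O.crossings d ≠ 0) :
    G.tail d ∈ redOn G γ ∨ G.head d ∈ redOn G γ := by
  by_contra! hc
  exact h (hO.near d hc.1 hc.2)

variable [Finite D] [Finite V] [Finite W]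

theorem IsPushOff.no_isolated_crossing (hO : O.IsPushOff γ) (hG : G.IsPlane) {Φ : Set D}
    (hΦ : ∀ d, G.face d ∈ Φ ↔ d ∈ Φ) {δ : D} (hδ : δ ∈ Φ) (hcross : O.crossings δ ≠ 0)
    (honly : ∀ ε ∈ Φ, O.crossings ε ≠ 0 → ε = δ)
    (hoff : ∀ ε ∈ Φ, Sum.inl (G.tail ε) ∉ O.H.cycleVertices O.curve) : False := by
  refine Overlay.no_isolated_crossing O hG hO.crossings_le_two hO.no_empty_digon ?_ hΦ hδ hcross
    honly hoff
  intro v hv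
  obtain ⟨⟨i, rfl⟩, -⟩ := (hO.through v).1 hv
  exact ⟨γ i, rfl⟩

/-- If the curve crosses the red edge of a triangle with a blue corner, then it passes through this
corner or crosses an edge there. -/
theorem IsPushOff.touches [NeZero n] (hO : O.IsPushOff γ) (hG : G.IsPlane) (hγ : G.IsCycle γ) {d : D}
    (h1 : G.tail d ∈ G.blue) (h2 : G.head d ∈ G.red) (h3 : G.head (G.face d) ∈ G.red)
    (h4 : G.head (G.face (G.face d)) = G.tail d) (h5 : G.head (G.face d) ≠ G.head d)
    (hcross : O.crossings (G.face d) ≠ 0) : O.Touches (G.tail d) := by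
  have ht := hG.tailRot
  by_contra hnot
  rw [Touches, not_or] at hnot
  obtain ⟨hoff, hun⟩ := hnot
  push Not at hun
  have hβγ : G.tail d ∉ G.cycleVertices γ := fun h => hoff ((hO.through _).2 ⟨h, h1⟩)
  have n1 : G.head d ≠ G.tail d := fun h => h2 (h ▸ h1)
  have n2 : G.head (G.face d) ≠ G.tail d := fun h => h3 (h ▸ h1)
  have t1 := ht.tail_face d
  have t2 := ht.tail_face (G.face d)
  set δ := G.face d with hδ
  set e := G.face δ with he
  have hA : G.IsDirCycle {d, δ, e} := isDirCycle_triple t1.symm t2.symm h4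
    (by rw [t1]; exact n1.symm) (by rw [t1, t2]; exact h5.symm) (by rwa [t2])
  have hface : ∀ a ∈ ({d, δ, e} : Set D), G.head a ≠ G.tail d → G.face a ∈ ({d, δ, e} : Set D) := by
    rintro _ (rfl | rfl | rfl) h
    exacts [Or.inr (Or.inl rfl), Or.inr (Or.inr rfl), absurd h4 h]
  have hreach : ∀ u ∈ G.cycleVertices γ, G.ReachAvoiding (G.tail d) (G.head d) u := by
    intro u hu
    rcases hO.redOn_of_crossed hcross with h | h
    · rw [t1] at h
      exact hγ.reachAvoiding hβγ h.1 hu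
    · exact Relation.ReflTransGen.head ⟨n2, δ, t1, rfl⟩ (hγ.reachAvoiding hβγ h.1 hu)
  -- If the curve does not touch the blue corner, the cycle `γ` misses it. Then all of `γ` is linked
  -- to the triangle without passing through this corner, so inside the triangle no edges are
  -- attached to `γ`.
  have hpocket : ∀ y ∈ G.region (G.edgeDarts {d, δ, e}) {d, δ, e},
      G.tail y ∈ G.cycleVertices γ → y ∈ ({d, δ, e} : Set D) := fun y hy hyγ =>
    hG.pocket hA hface (Or.inl rfl) n1 (hreach _ hyγ) hy rfl
  -- The whole inside of the triangle is taken, not one face, since other parts of the graph may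
  -- hang on the blue corner.
  refine hO.no_isolated_crossing hG (Φ := G.region (G.edgeDarts {d, δ, e}) {d, δ, e})
    (fun _ => region_face_iff) (δ := δ) (subset_region (Or.inr (Or.inl rfl))) hcross ?_ ?_
  · intro ε hε hεc
    have hεA : ε ∈ ({d, δ, e} : Set D) := by
      rcases hO.redOn_of_crossed hεc with h | h
      · exact hpocket ε hε h.1
      · by_cases hC : ε ∈ G.edgeDarts {d, δ, e}
        · rcases hC with hC | hC
          · exact hC
          · have := hG.rev_notMem_region hA hC
            rw [G.rev_rev] at this
            exact absurd hε this
        · exact absurd (Or.inr (hpocket _ ((region_rev_iff hC).2 hε) h.1)) hC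
    rcases hεA with h | h | h
    · exact absurd (hun _ (congrArg G.tail h)) hεc
    · exact h
    · have := hun (G.rev e) h4
      rw [O.crossings_rev, ← h] at this
      exact absurd this hεc
  · intro ε hε hεC
    have h6 := (hO.through _).1 hεC
    rcases hpocket ε hε h6.1 with rfl | rfl | rfl
    · exact hoff hεC
    · rw [t1] at h6
      exact h2 h6.2
    · rw [t2] at h6
      exact h3 h6.2

/-- If the curve crosses an edge of a red face, then it crosses a second one. -/
theorem IsPushOff.red_face_not_isolated (hO : O.IsPushOff γ) (hG : G.IsPlane) {d δ : D}
    (h1 : G.tail d ∈ G.red) (h2 : G.head d ∈ G.red) (h3 : G.head (G.face d) ∈ G.red)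
    (h4 : G.face (G.face d) = d ∨ G.face (G.face (G.face d)) = d)
    (hδ : δ ∈ ({d, G.face d, G.face (G.face d)} : Set D)) (hcross : O.crossings δ ≠ 0)
    (honly : ∀ ε ∈ ({d, G.face d, G.face (G.face d)} : Set D), O.crossings ε ≠ 0 → ε = δ) :
    False := by
  have ht := hG.tailRot
  have hmaps : ∀ x ∈ ({d, G.face d, G.face (G.face d)} : Set D),
      G.face x ∈ ({d, G.face d, G.face (G.face d)} : Set D) := by
    rintro _ (rfl | rfl | rfl)
    · exact Or.inr (Or.inl rfl)
    · exact Or.inr (Or.inr rfl)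
    · rcases h4 with h4 | h4
      · rw [h4]
        exact Or.inr (Or.inl rfl)
      · rw [h4]
        exact Or.inl rfl
  have hbij := ((Set.toFinite ({d, G.face d, G.face (G.face d)} : Set D)).injOn_iff_bijOn_of_mapsTo
    (f := G.face) hmaps).1 G.face.injective.injOn
  refine hO.no_isolated_crossing hG (fun x => ⟨fun hx => ?_, hmaps x⟩) hδ hcross honly ?_
  · obtain ⟨y, hy, hyx⟩ := hbij.surjOn hx
    rwa [← G.face.injective hyx]
  · intro ε hε
    refine O.avoids_red _ ?_
    rcases hε with rfl | rfl | rfl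
    · exact h1
    · rwa [ht.tail_face]
    · rwa [ht.tail_face]

end Overlay

end PushOff

end RotSys

/-! ### The closed side of a cycle and the contraction of the cycle. -/

namespace RotSys

section ClosedSide

variable {V D : Type*} {G : RotSys V D} {n : ℕ} {c : Fin n → D}

variable (G) in
/-- The darts of the cycle `c`, directed such that the given side lies to the left. -/
def sideCycle (c : Fin n → D) (left : Bool) : Set D :=
  Set.range fun i => if left = true then c i else G.rev (c i)

theorem sideCycle_false : G.sideCycle c false = G.rev ⁻¹' Set.range c := by
  ext d
  constructor
  · rintro ⟨i, rfl⟩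
    exact ⟨i, (G.rev_rev (c i)).symm⟩
  · rintro ⟨i, hi⟩
    exact ⟨i, show G.rev (c i) = d by rw [hi, G.rev_rev]⟩

theorem IsCycle.isDirCycle_sideCycle [NeZero n] (hc : G.IsCycle c) (left : Bool) :
    G.IsDirCycle (G.sideCycle c left) := by
  cases left
  · rw [sideCycle_false]
    exact hc.isDirCycle.reverse
  · exact hc.isDirCycle

theorem edgeDarts_sideCycle (left : Bool) : G.edgeDarts (G.sideCycle c left) = G.cycleDarts c := by
  cases left
  · rw [sideCycle_false, edgeDarts_preimage_rev]
    rfl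
  · rfl

theorem rev_mem_cycleDarts {d : D} : G.rev d ∈ G.cycleDarts c ↔ d ∈ G.cycleDarts c :=
  G.mem_edgeDarts_rev

theorem IsCycle.tail_mem_cycleVertices [NeZero n] (hc : G.IsCycle c) {d : D}
    (hd : d ∈ G.cycleDarts c) : G.tail d ∈ G.cycleVertices c := by
  rcases hd with ⟨i, rfl⟩ | ⟨i, hi⟩
  · exact ⟨i, rfl⟩
  · refine ⟨i + 1, ?_⟩
    dsimp only
    rw [← hc.next, hi, head_rev]

theorem IsCycle.exists_mem_sideCycle [NeZero n] (hc : G.IsCycle c) (left : Bool) {v : V}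
    (hv : v ∈ G.cycleVertices c) : ∃ a ∈ G.sideCycle c left, G.tail a = v := by
  obtain ⟨i, rfl⟩ := hv
  cases left
  · refine ⟨G.rev (c (i - 1)), ⟨i - 1, rfl⟩, ?_⟩
    rw [tail_rev, hc.next, sub_add_cancel]
  · exact ⟨c i, ⟨i, rfl⟩, rfl⟩

theorem mem_closedSideDarts {left : Bool} {d : D} : d ∈ G.closedSideDarts c left ↔
    d ∈ G.cycleDarts c ∨ d ∈ G.region (G.cycleDarts c) (G.sideCycle c left) := Iff.rfl

theorem rev_mem_closedSideDarts {left : Bool} {d : D} :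
    G.rev d ∈ G.closedSideDarts c left ↔ d ∈ G.closedSideDarts c left := by
  rw [mem_closedSideDarts, mem_closedSideDarts, rev_mem_cycleDarts]
  by_cases h : d ∈ G.cycleDarts c
  · simp [h]
  · rw [region_rev_iff h]

theorem mem_closedSide_subDarts {left : Bool} {d : D} :
    d ∈ G.subDarts (G.closedSideVertices c left) (G.closedSideDarts c left) ↔
      d ∈ G.closedSideDarts c left :=
  ⟨fun h => h.1, fun h => ⟨h, rev_mem_closedSideDarts.2 h, ⟨d, h, rfl⟩,
    ⟨G.rev d, rev_mem_closedSideDarts.2 h, rfl⟩⟩⟩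

theorem mem_closedSideVertices_of_cycle (left : Bool) {v : V}
    (hv : v ∈ G.cycleVertices c) : v ∈ G.closedSideVertices c left := by
  obtain ⟨i, rfl⟩ := hv
  exact ⟨c i, Or.inl (Or.inl ⟨i, rfl⟩), rfl⟩

variable [Finite D]

/-- At a vertex of the closed side that is not on the cycle, all darts belong to the side. -/
theorem IsPlane.mem_closedSideDarts_of_tail [NeZero n] (hG : G.IsPlane) (hc : G.IsCycle c)
    {left : Bool} {e : D} (he : G.tail e ∈ G.closedSideVertices c left)
    (hoff : G.tail e ∉ G.cycleVertices c) :
    e ∉ G.cycleDarts c ∧ e ∈ G.closedSideDarts c left := by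
  obtain ⟨d, hd, hde⟩ := he
  have h1 : ∀ z, G.tail z = G.tail e → z ∉ G.cycleDarts c := fun z hz h =>
    hoff (hz ▸ hc.tail_mem_cycleVertices h)
  rcases hd with hd | hd
  · exact absurd hd (h1 d hde)
  · refine ⟨h1 e rfl, Or.inr ?_⟩
    exact hG.region_of_tail_eq hd hde (fun z hz => h1 z (hz.trans hde))

theorem IsPlane.closedSide_connected [NeZero n] (hG : G.IsPlane) (hc : G.IsCycle c)
    (left : Bool) : (G.closedSide c left).graph.Connected := by
  have h0 : G.tail (c 0) ∈ G.closedSideVertices c left :=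
    mem_closedSideVertices_of_cycle left ⟨0, rfl⟩
  have hstep : ∀ p : G.closedSideVertices c left → Prop,
      (∀ d, p ((G.closedSide c left).tail d) → p ((G.closedSide c left).head d)) →
      ∀ d (hd : d ∈ G.closedSideDarts c left) (h1 : G.tail d ∈ G.closedSideVertices c left)
        (h2 : G.head d ∈ G.closedSideVertices c left), p ⟨G.tail d, h1⟩ → p ⟨G.head d, h2⟩ :=
    fun p hp d hd _ _ h => hp ⟨d, mem_closedSide_subDarts.2 hd⟩ h
  refine connected_iff.2 ⟨⟨G.tail (c 0), h0⟩, fun p hp0 hp u => ?_⟩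
  have hcyc : ∀ v (hv : v ∈ G.closedSideVertices c left), v ∈ G.cycleVertices c → p ⟨v, hv⟩ := by
    rintro _ hv ⟨i, rfl⟩
    refine hc.isDirCycle.induct (fun a => ∀ h : G.tail a ∈ G.closedSideVertices c left,
      p ⟨G.tail a, h⟩) ⟨c 0, ⟨0, rfl⟩, fun _ => hp0⟩ ?_ (c i) ⟨i, rfl⟩ hv
    rintro a ⟨j, rfl⟩ b - ha hba h
    have h1 : G.tail (c j) ∈ G.closedSideVertices c left :=
      mem_closedSideVertices_of_cycle left ⟨j, rfl⟩
    have h2 : G.head (c j) ∈ G.closedSideVertices c left := hba ▸ h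
    have h3 := hstep p hp (c j) (Or.inl (Or.inl ⟨j, rfl⟩)) h1 h2 (ha h1)
    simpa only [hba] using h3
  have := connected_induct hG.connected (u := G.tail (c 0))
    (p := fun v => ∀ hv : v ∈ G.closedSideVertices c left, p ⟨v, hv⟩)
    (fun _ => hp0) (fun d ih hd => ?_) u.1
  · exact this u.2
  · by_cases hoff : G.head d ∈ G.cycleVertices c
    · exact hcyc _ _ hoff
    · have h1 := (hG.mem_closedSideDarts_of_tail hc (e := G.rev d) hd hoff).2
      rw [rev_mem_closedSideDarts] at h1
      have h2 : G.tail d ∈ G.closedSideVertices c left := ⟨d, h1, rfl⟩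
      exact hstep p hp d h1 h2 hd (ih h2)

theorem mem_edgeDarts_side {left : Bool}
    {x : G.subDarts (G.closedSideVertices c left) (G.closedSideDarts c left)} :
    x ∈ (G.closedSide c left).edgeDarts {e | e.1 ∈ G.cycleDarts c} ↔ x.1 ∈ G.cycleDarts c :=
  ⟨fun h => h.elim id fun h => rev_mem_cycleDarts.1 h, Or.inl⟩

variable [Finite V]

theorem IsPlane.closedSide [NeZero n] (hG : G.IsPlane) (hc : G.IsCycle c) (left : Bool) :
    (G.closedSide c left).IsPlane :=
  hG.sub _ _ (hG.closedSide_connected hc left)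

/-- On the far side of the cycle nothing is left: the cycle bounds a face there. -/
theorem IsPlane.closedSide_rot_rev [NeZero n] (hG : G.IsPlane) (hc : G.IsCycle c) {left : Bool}
    {a b : D} (ha : a ∈ G.sideCycle c left) (hb : b ∈ G.sideCycle c left)
    (hab : G.tail b = G.head a)
    {x : G.subDarts (G.closedSideVertices c left) (G.closedSideDarts c left)}
    (hx : x.1 = G.rev a) : ((G.closedSide c left).rot x).1 = b := by
  have hA := hc.isDirCycle_sideCycle left
  have hE := edgeDarts_sideCycle (G := G) (c := c) left
  have hJ : ∀ a ∈ G.sideCycle c left,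
      G.rev a ∉ G.region (G.cycleDarts c) (G.sideCycle c left) := fun a ha => by
    rw [← hE]
    exact hG.rev_notMem_region hA ha
  -- By the Jordan curve theorem the reverse of `a` is not in the region, and turning from outside
  -- into the region is possible only across the cycle. The first dart of the cycle met is `b`, for
  -- meeting the reverse of `a` again would put `z = face a` in the region.
  have step : ∀ z, G.tail z = G.head a → (z = G.rev a ∨ z ∉ G.closedSideDarts c left) →
      G.rot z = b ∨ G.rot z ∉ G.closedSideDarts c left := by
    intro z hza hz
    have hnL : z ∉ G.region (G.cycleDarts c) (G.sideCycle c left) := by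
      rcases hz with rfl | hz
      · exact hJ a ha
      · exact fun h => hz (Or.inr h)
    by_cases hC : G.rot z ∈ G.cycleDarts c
    · left
      rw [← hE] at hC
      have h1 : G.tail (G.rot z) = G.head a := (hG.tailRot z).trans hza
      rcases hA.mem_of_tail_eq ha hC h1 with h | h
      · exact hA.tail_inj _ h _ hb (h1.trans hab.symm)
      · exfalso
        apply hnL
        have h2 : z = G.face a := by
          rw [face_apply, ← h]
          simp
        rw [h2, region_face_iff]
        exact subset_region ha
    · right
      rintro (h | h)
      · exact hC h
      · apply hnL
        rw [← region_rev_iff hC, ← region_face_iff, ← rot_inv_apply, Equiv.Perm.inv_def,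
          Equiv.symm_apply_apply] at h
        exact h
  have hend := firstReturn_induct (σ := G.rot)
    (P := G.subDarts (G.closedSideVertices c left) (G.closedSideDarts c left)) (x := x)
    (Q := fun z => G.tail z = G.head a ∧ (z = b ∨ z ∉ G.closedSideDarts c left))
    ⟨(hG.tailRot _).trans (by rw [hx, tail_rev]), step _ (by rw [hx, tail_rev]) (Or.inl hx)⟩
    (fun z hz h => ⟨(hG.tailRot z).trans h.1,
      step z h.1 (Or.inr fun h' => hz (mem_closedSide_subDarts.2 h'))⟩)
  rcases hend.2 with h | h
  · exact h
  · exact absurd (mem_closedSide_subDarts.1 ((G.closedSide c left).rot x).2) h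

/-- Contracting the cycle in a closed side yields a plane graph. -/
theorem IsPlane.contract_closedSide [NeZero n] (hG : G.IsPlane) (hc : G.IsCycle c) (left : Bool) :
    ((G.closedSide c left).contract {e | e.1 ∈ G.cycleDarts c}).IsPlane := by
  have hK := hG.closedSide hc left
  have hA := hc.isDirCycle_sideCycle left
  have hE := edgeDarts_sideCycle (G := G) (c := c) left
  set K := G.closedSide c left with hKdef
  -- A cycle is not a forest; the single cyclic order at the new vertex comes from the far side
  -- being an empty face. It is shown that a set invariant under sweeping contains all or none of
  -- the remaining darts there.
  refine hK.contract _ fun X h1 h2 d e hd he hde hXd => ?_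
  have hX : ∀ y, X (K.flip {e | e.1 ∈ G.cycleDarts c} y) ↔ X (K.rot y) := fun y => ⟨h1 y, h2 y⟩
  rw [mem_edgeDarts_side] at hd he
  have hXoff : ∀ y : G.subDarts (G.closedSideVertices c left) (G.closedSideDarts c left),
      y.1 ∉ G.cycleDarts c → (X y ↔ X (K.rot y)) := fun y hy => by
    rw [← hX, K.flip_of_notMem (fun h => hy (mem_edgeDarts_side.1 h))]
  have hmem : ∀ a ∈ G.sideCycle c left, a ∈ G.cycleDarts c := fun a ha => by
    rw [← hE]
    exact Or.inl ha
  have hmk : ∀ a ∈ G.sideCycle c left,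
      a ∈ G.subDarts (G.closedSideVertices c left) (G.closedSideDarts c left) := fun a ha =>
    mem_closedSide_subDarts.2 (Or.inl (hmem a ha))
  -- all darts at the start of `b` behave like the reverse of `b`
  have hvert : ∀ b (hb : b ∈ G.sideCycle c left)
      (y : G.subDarts (G.closedSideVertices c left) (G.closedSideDarts c left)),
      G.tail y.1 = G.tail b → y.1 ≠ b → (X y ↔ X (K.rev ⟨b, hmk b hb⟩)) := by
    intro b hb y hyb
    obtain ⟨a, ha, hab⟩ := hA.prev b hb
    refine (hK.rot_induct (d := ⟨b, hmk b hb⟩) (e := y)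
      (Q := fun y => y.1 ≠ b → (X y ↔ X (K.rev ⟨b, hmk b hb⟩)))
      (Subtype.ext hyb.symm) (fun h => absurd rfl h) fun z hz hzb => ?_)
    intro hne
    by_cases hzC : z.1 ∈ G.cycleDarts c
    · have hzt : G.tail z.1 = G.head a := (congrArg Subtype.val hzb).trans hab.symm
      rw [← hE] at hzC
      rcases hA.mem_of_tail_eq ha hzC hzt with h | h
      · have h3 : z = ⟨b, hmk b hb⟩ := Subtype.ext (hA.tail_inj _ h _ hb (hzt.trans hab))
        rw [← hX, h3, K.flip_of_mem (mem_edgeDarts_side.2 (hmem b hb))]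
      · exact absurd (hG.closedSide_rot_rev hc ha hb hab.symm h) hne
    · rw [← hXoff z hzC]
      exact hz fun h => hzC (h ▸ hmem b hb)
  obtain ⟨a₀, ha₀⟩ := hA.nonempty
  -- The reverse of `a` is one of the darts at the start of its successor `b`, which carries the
  -- value from one vertex of the cycle to the next.
  have hall : ∀ b (hb : b ∈ G.sideCycle c left),
      (X (K.rev ⟨b, hmk b hb⟩) ↔ X (K.rev ⟨a₀, hmk a₀ ha₀⟩)) := by
    intro b hb
    refine hA.induct (fun b => ∀ hb : b ∈ G.sideCycle c left,
      (X (K.rev ⟨b, hmk b hb⟩) ↔ X (K.rev ⟨a₀, hmk a₀ ha₀⟩))) ⟨a₀, ha₀, fun _ => Iff.rfl⟩ ?_ b hb hb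
    intro a ha b hb hXa hab hb'
    rw [← hXa ha]
    refine (hvert b hb (K.rev ⟨a, hmk a ha⟩) hab.symm fun h => ?_).symm
    have h' : G.rev a = b := h
    exact hA.rev_notMem a ha (h' ▸ hb)
  by_cases hdc : G.tail d.1 ∈ G.cycleVertices c
  · have hec : G.tail e.1 ∈ G.cycleVertices c := by
      refine contractVertex_lift (p := fun u => u.1 ∈ G.cycleVertices c) (fun x hx _ => ?_) hde hdc
      exact hc.tail_mem_cycleVertices (rev_mem_cycleDarts.2 (mem_edgeDarts_side.1 hx))
    obtain ⟨a, ha, hat⟩ := hc.exists_mem_sideCycle left hdc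
    obtain ⟨b, hb, hbt⟩ := hc.exists_mem_sideCycle left hec
    rw [hvert b hb e hbt.symm (fun h => he (h ▸ hmem b hb)), hall b hb, ← hall a ha,
      ← hvert a ha d hat.symm (fun h => hd (h ▸ hmem a ha))]
    exact hXd
  · have htail : K.tail e = K.tail d := by
      refine contractVertex_lift (p := fun u => u = K.tail d) (fun x hx hxd => ?_) hde rfl
      have h3 : G.tail x.1 = G.tail d.1 := congrArg Subtype.val hxd
      exact absurd (h3 ▸ hc.tail_mem_cycleVertices (mem_edgeDarts_side.1 hx)) hdc
    refine hK.rot_induct htail.symm hXd fun z hz hzd => (hXoff z fun h => hdc ?_).1 hz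
    have h3 : G.tail z.1 = G.tail d.1 := congrArg Subtype.val hzd
    exact h3 ▸ hc.tail_mem_cycleVertices h

end ClosedSide

/-! ### Contraction of the chosen blue-blue edges, and deletion of loops. -/

section EdgeCutPlane

variable {V D : Type*} {G : RotSys V D} [Finite V] [Finite D]

/-- Contracting one edge for each blue neighbour of a vertex yields a plane graph. -/
theorem IsPlane.contract_blueChoice (hG : G.IsPlane) {b : V} {T : Set D}
    (hT : IsBlueChoice G b T) : (G.contract T).IsPlane := by
  refine hG.contract_of_forest T fun f hf hsupp hsum => ?_
  have h1 : ∀ t ∈ T, f t = 0 := by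
    intro t ht
    obtain ⟨h1, h2, h3⟩ := hT.mem t ht
    have h4 := hsum (G.tail t)
    -- The chosen edges form a star whose leaves each carry one edge, so conservation at a leaf says
    -- that the flow on its edge is zero.
    rw [finsum_mem_def, finsum_eq_single _ t] at h4
    · rwa [Set.indicator_of_mem] at h4
      exact rfl
    · intro d hdt
      by_cases hd : G.tail d = G.tail t
      · rw [Set.indicator_of_mem (show d ∈ {d | G.tail d = G.tail t} from hd)]
        refine hsupp d ?_
        rintro (h | h)
        · exact hdt ((hT.existsUnique _ h1 h2 ⟨t, rfl, h3⟩).unique ⟨h, hd⟩ ⟨ht, rfl⟩)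
        · have h5 := (hT.mem _ h).2.2
          rw [head_rev, hd] at h5
          exact h2 h5
      · exact Set.indicator_of_notMem (show d ∉ {d | G.tail d = G.tail t} from hd) _
  intro d
  by_cases hd : d ∈ G.edgeDarts T
  · rcases hd with h | h
    · exact h1 d h
    · have := h1 _ h
      rw [hf] at this
      linarith
  · exact hsupp d hd

theorem IsPlane.deleteLoops (hG : G.IsPlane) : G.deleteLoops.IsPlane := by
  refine hG.sub _ _ ?_
  obtain ⟨v₀, h0⟩ := connected_iff.1 hG.connected
  refine connected_iff.2 ⟨⟨v₀, trivial⟩, fun p hp0 hp v => ?_⟩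
  refine h0 (fun v => p ⟨v, trivial⟩) hp0 (fun d hd => ?_) v.1
  by_cases hl : G.tail d = G.head d
  · simpa only [← hl] using hd
  · refine hp ⟨d, hl, ?_, trivial, trivial⟩ hd
    change G.tail (G.rev d) ≠ G.head (G.rev d)
    rw [tail_rev, head_rev]
    exact fun h => hl h.symm

end EdgeCutPlane

end RotSys

/-! ### Vertices, colours and surviving darts of an edge-cut. -/

namespace RotSys

namespace Overlay

section EdgeCut

variable {V D W E : Type*} {G : RotSys V D} [Finite E] (O : G.Overlay W E) (left : Bool)
  (T : Set (((O.H.closedSide O.curve left).edgeDarts (O.sideCurve left))ᶜ : Set _))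

/-- The darts of an edge-cut. -/
abbrev CutDart : Type _ :=
  ((O.contracted left).contract T).subDarts Set.univ
    {d | ((O.contracted left).contract T).tail d ≠ ((O.contracted left).contract T).head d}

/-- The vertex of an edge-cut that comes from a vertex of the closed side. -/
def cutVertex (u : O.H.closedSideVertices O.curve left) :
    (Set.univ : Set ((O.contracted left).ContractVertex T)) :=
  ⟨Quot.mk _ (Quot.mk _ u), trivial⟩

/-- The new blue vertex of an edge-cut. -/
def cutBase : (Set.univ : Set ((O.contracted left).ContractVertex T)) :=
  ⟨Quot.mk _ (O.newVertex left), trivial⟩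

variable {O left T}

/-- The dart of the overlay that a dart of an edge-cut comes from. -/
def CutDart.under (d : O.CutDart left T) : E := d.1.1.1.1

theorem CutDart.under_injective {d e : O.CutDart left T} (h : d.under = e.under) : d = e :=
  Subtype.ext (Subtype.ext (Subtype.ext (Subtype.ext h)))

theorem CutDart.under_rev (d : O.CutDart left T) :
    CutDart.under ((O.edgeCut left T).rev d) = O.H.rev d.under := rfl

theorem CutDart.under_mem (d : O.CutDart left T) :
    d.under ∈ O.H.closedSideDarts O.curve left := d.1.1.1.2.1

theorem CutDart.under_notMem (d : O.CutDart left T) : d.under ∉ O.H.cycleDarts O.curve :=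
  fun h => d.1.1.2 (Or.inl h)

theorem edgeCut_tail (d : O.CutDart left T) {u : O.H.closedSideVertices O.curve left}
    (hu : u.1 = O.H.tail d.under) : (O.edgeCut left T).tail d = O.cutVertex left T u := by
  obtain ⟨u, h⟩ := u
  subst hu
  rfl

theorem edgeCut_head (d : O.CutDart left T) {u : O.H.closedSideVertices O.curve left}
    (hu : u.1 = O.H.head d.under) : (O.edgeCut left T).head d = O.cutVertex left T u := by
  obtain ⟨u, h⟩ := u
  subst hu
  rfl

theorem CutDart.tail_mem (d : O.CutDart left T) :
    O.H.tail d.under ∈ O.H.closedSideVertices O.curve left := ⟨d.under, d.under_mem, rfl⟩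

theorem CutDart.head_mem (d : O.CutDart left T) :
    O.H.head d.under ∈ O.H.closedSideVertices O.curve left :=
  ⟨O.H.rev d.under, rev_mem_closedSideDarts.2 d.under_mem, rfl⟩

theorem exists_cutVertex (x : (Set.univ : Set ((O.contracted left).ContractVertex T))) :
    ∃ u, x = O.cutVertex left T u := by
  obtain ⟨x, -⟩ := x
  induction x using Quot.ind with | _ x => ?_
  induction x using Quot.ind with | _ u => ?_
  exact ⟨u, rfl⟩

/-! ### Colours -/

theorem tail_mem_of_sideCurve
    {x : O.H.subDarts (O.H.closedSideVertices O.curve left) (O.H.closedSideDarts O.curve left)}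
    (hx : x ∈ (O.H.closedSide O.curve left).edgeDarts (O.sideCurve left)) :
    ((O.H.closedSide O.curve left).tail x).1 ∈ O.H.cycleVertices O.curve :=
  O.cycle.tail_mem_cycleVertices (mem_edgeDarts_side.1 hx)

theorem contracted_mk_injective {u u' : O.H.closedSideVertices O.curve left}
    (hu : u.1 ∉ O.H.cycleVertices O.curve)
    (h : (Quot.mk _ u : (O.H.closedSide O.curve left).ContractVertex (O.sideCurve left)) =
      Quot.mk _ u') : u = u' := by
  refine (contractVertex_lift (p := fun x => x = u) (fun x hx hxu => ?_) h rfl).symm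
  exact absurd (hxu ▸ tail_mem_of_sideCurve hx) hu

theorem contracted_mk_eq_newVertex {u : O.H.closedSideVertices O.curve left}
    (hu : u.1 ∈ O.H.cycleVertices O.curve) : Quot.mk _ u = O.newVertex left := by
  obtain ⟨u, hu'⟩ := u
  obtain ⟨i, rfl⟩ := hu
  refine O.cycle.isDirCycle.induct (fun a => ∀ h : O.H.tail a ∈ O.H.closedSideVertices O.curve left,
    (Quot.mk _ ⟨O.H.tail a, h⟩ : (O.H.closedSide O.curve left).ContractVertex (O.sideCurve left)) =
      O.newVertex left) ⟨_, ⟨0, rfl⟩, fun _ => rfl⟩ ?_ _ ⟨i, rfl⟩ hu'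
  rintro a ⟨j, rfl⟩ b - ha hba h
  have h1 : O.H.tail (O.curve j) ∈ O.H.closedSideVertices O.curve left :=
    mem_closedSideVertices_of_cycle left ⟨j, rfl⟩
  rw [← ha h1]
  have hm : O.curve j ∈ O.H.cycleDarts O.curve := Or.inl ⟨j, rfl⟩
  exact (Quot.sound ⟨⟨O.curve j, mem_closedSide_subDarts.2 (Or.inl hm)⟩,
    mem_edgeDarts_side.2 hm, rfl, Subtype.ext hba.symm⟩).symm

/-- White vertices lie on the curve and are swallowed by the new blue vertex; red vertices are never
on the curve, so they keep their identity and colour. -/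
theorem mem_contracted_blue_iff {u : O.H.closedSideVertices O.curve left} :
    (Quot.mk _ u : (O.H.closedSide O.curve left).ContractVertex (O.sideCurve left)) ∈
      (O.contracted left).blue ↔ ∀ v ∈ G.red, u.1 ≠ Sum.inl v := by
  constructor
  · rintro ⟨u', hu', h⟩ v hv huv
    have hoff : u.1 ∉ O.H.cycleVertices O.curve := huv ▸ O.avoids_red v hv
    obtain rfl := contracted_mk_injective hoff hu'.symm
    rcases h with h | ⟨x, hx, rfl⟩
    · have h1 : u.1 ∈ O.H.blue := h
      rw [O.blue_eq, huv] at h1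
      obtain ⟨v', hv', h2⟩ := h1
      rw [Sum.inl_injective h2] at hv'
      exact hv hv'
    · exact hoff (tail_mem_of_sideCurve hx)
  · intro h
    refine ⟨u, rfl, ?_⟩
    rcases hu : u.1 with v | w
    · left
      change u.1 ∈ O.H.blue
      rw [O.blue_eq, hu]
      exact ⟨v, notMem_red.1 fun hv => h v hv hu, rfl⟩
    · right
      obtain ⟨i, hi⟩ := O.white_mem w
      have hm : O.curve i ∈ O.H.cycleDarts O.curve := Or.inl ⟨i, rfl⟩
      exact ⟨⟨O.curve i, mem_closedSide_subDarts.2 (Or.inl hm)⟩, mem_edgeDarts_side.2 hm,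
        Subtype.ext (hi.trans hu.symm)⟩

theorem newVertex_mem_blue : O.newVertex left ∈ (O.contracted left).blue :=
  mem_contracted_blue_iff.2 fun v hv h => O.avoids_red v hv (h ▸ ⟨0, rfl⟩)

theorem blue_of_mem_choice (hT : IsBlueChoice (O.contracted left) (O.newVertex left) T)
    {x : (((O.H.closedSide O.curve left).edgeDarts (O.sideCurve left))ᶜ : Set _)}
    (hx : x ∈ (O.contracted left).edgeDarts T) :
    (O.contracted left).tail x ∈ (O.contracted left).blue := by
  rcases hx with hx | hx
  · exact (hT.mem x hx).1
  · have := (hT.mem _ hx).2.2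
    rw [head_rev] at this
    rw [this]
    exact newVertex_mem_blue

/-- Both contractions merge only the curve and blue vertices, so a red vertex stays alone in its
class. -/
theorem cutVertex_injective (hT : IsBlueChoice (O.contracted left) (O.newVertex left) T)
    {u u' : O.H.closedSideVertices O.curve left} {v : V} (hv : v ∈ G.red) (hu : u.1 = Sum.inl v)
    (h : O.cutVertex left T u = O.cutVertex left T u') : u = u' := by
  have hb : (Quot.mk _ u : (O.H.closedSide O.curve left).ContractVertex (O.sideCurve left)) ∉
      (O.contracted left).blue := fun h => mem_contracted_blue_iff.1 h v hv hu
  refine contracted_mk_injective (hu ▸ O.avoids_red v hv) ?_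
  refine (contractVertex_lift (G := O.contracted left) (S := T) (p := fun x => x = Quot.mk _ u)
    (fun x hx hxu => ?_) (congrArg Subtype.val h) rfl).symm
  exact absurd (hxu ▸ blue_of_mem_choice hT hx) hb

theorem cutVertex_red_iff (hT : IsBlueChoice (O.contracted left) (O.newVertex left) T)
    {u : O.H.closedSideVertices O.curve left} :
    O.cutVertex left T u ∈ (O.edgeCut left T).red ↔ ∃ v ∈ G.red, u.1 = Sum.inl v := by
  constructor
  · intro h
    by_contra! hno
    exact h ⟨_, rfl, Or.inl (mem_contracted_blue_iff.2 hno)⟩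
  · rintro ⟨v, hv, hu⟩ ⟨q, hq, h⟩
    have hb : (Quot.mk _ u : (O.H.closedSide O.curve left).ContractVertex (O.sideCurve left)) ∉
        (O.contracted left).blue := fun h => mem_contracted_blue_iff.1 h v hv hu
    have hqu : q = Quot.mk _ u := by
      refine contractVertex_lift (G := O.contracted left) (S := T) (p := fun x => x = Quot.mk _ u)
        (fun x hx hxu => ?_) hq.symm rfl
      exact absurd (hxu ▸ blue_of_mem_choice hT hx) hb
    rcases h with h | ⟨x, hx, hxq⟩
    · exact hb (hqu ▸ h)
    · exact hb (hqu ▸ hxq ▸ blue_of_mem_choice hT hx)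

theorem cutVertex_eq_base_of_curve {u : O.H.closedSideVertices O.curve left}
    (hu : u.1 ∈ O.H.cycleVertices O.curve) : O.cutVertex left T u = O.cutBase left T :=
  Subtype.ext (congrArg (Quot.mk _) (contracted_mk_eq_newVertex hu))

/-- A blue vertex with an edge to the curve is merged into the new vertex. -/
theorem cutVertex_eq_base_of_adj (hT : IsBlueChoice (O.contracted left) (O.newVertex left) T)
    {u : O.H.closedSideVertices O.curve left} {β : V} (hβ : β ∈ G.blue) (hu : u.1 = Sum.inl β)
    {e : E} (he : e ∈ O.H.closedSideDarts O.curve left) (heC : e ∉ O.H.cycleDarts O.curve)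
    (het : O.H.tail e = u.1) (heh : O.H.head e ∈ O.H.cycleVertices O.curve) :
    O.cutVertex left T u = O.cutBase left T := by
  by_cases hoff : u.1 ∈ O.H.cycleVertices O.curve
  · exact cutVertex_eq_base_of_curve hoff
  let x : (((O.H.closedSide O.curve left).edgeDarts (O.sideCurve left))ᶜ : Set _) :=
    ⟨⟨e, mem_closedSide_subDarts.2 he⟩, fun h => heC (mem_edgeDarts_side.1 h)⟩
  have hxt : (O.contracted left).tail x = Quot.mk _ u := congrArg (Quot.mk _) (Subtype.ext het)
  have hxh : (O.contracted left).head x = O.newVertex left := contracted_mk_eq_newVertex heh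
  have hne : (Quot.mk _ u : (O.H.closedSide O.curve left).ContractVertex (O.sideCurve left)) ≠
      O.newVertex left := by
    intro h
    have := contracted_mk_injective hoff h
    exact hoff (this ▸ ⟨0, rfl⟩)
  obtain ⟨t, ⟨ht, htu⟩, -⟩ := hT.existsUnique (Quot.mk _ u) (mem_contracted_blue_iff.2 (by
    rintro v hv h
    rw [hu] at h
    exact hv (Sum.inl_injective h ▸ hβ))) hne ⟨x, hxt, hxh⟩
  exact Subtype.ext (Quot.sound ⟨t, Or.inl ht, htu, (hT.mem t ht).2.2⟩)

theorem edgeCut_loopFree : (O.edgeCut left T).LoopFree := fun d h =>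
  d.2.1 (congrArg Subtype.val h)

/-- An edge from the curve to a blue vertex has both ends merged into the new vertex and was deleted
as a loop. Off the curve, a blue-blue edge would be an uncrossed blue-blue edge of `G`. -/
theorem edgeCut_noBlueBlue (hT : IsBlueChoice (O.contracted left) (O.newVertex left) T)
    (hb : G.NoBlueBlue) : (O.edgeCut left T).NoBlueBlue := by
  have blue_end : ∀ d : O.CutDart left T, (O.edgeCut left T).tail d ∈ (O.edgeCut left T).blue →
      O.H.tail d.under ∉ O.H.cycleVertices O.curve →
      ∃ β ∈ G.blue, O.H.tail d.under = Sum.inl β := by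
    intro d hd hoff
    rw [edgeCut_tail d (u := ⟨_, d.tail_mem⟩) rfl, ← notMem_red, cutVertex_red_iff hT] at hd
    push Not at hd
    rcases hu : O.H.tail d.under with v | w
    · exact ⟨v, notMem_red.1 fun hv => hd v hv hu, rfl⟩
    · exact absurd (hu ▸ O.white_mem w) hoff
  have key : ∀ d : O.CutDart left T, (O.edgeCut left T).tail d ∈ (O.edgeCut left T).blue →
      O.H.head d.under ∈ O.H.cycleVertices O.curve → False := by
    intro d hd hh
    refine edgeCut_loopFree d ?_
    rw [edgeCut_head d (u := ⟨_, d.head_mem⟩) rfl, cutVertex_eq_base_of_curve hh,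
      edgeCut_tail d (u := ⟨_, d.tail_mem⟩) rfl]
    by_cases hoff : O.H.tail d.under ∈ O.H.cycleVertices O.curve
    · exact cutVertex_eq_base_of_curve hoff
    · obtain ⟨β, hβ, hu⟩ := blue_end d hd hoff
      exact cutVertex_eq_base_of_adj hT hβ hu d.under_mem d.under_notMem rfl hh
  rintro (d : O.CutDart left T) ⟨h1, h2⟩
  by_cases hh : O.H.head d.under ∈ O.H.cycleVertices O.curve
  · exact key d h1 hh
  · by_cases ht : O.H.tail d.under ∈ O.H.cycleVertices O.curve
    · refine key ((O.edgeCut left T).rev d) h2 ?_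
      rwa [CutDart.under_rev, head_rev]
    · obtain ⟨β, hβ, hu⟩ := blue_end d h1 ht
      obtain ⟨β', hβ', hu'⟩ := blue_end ((O.edgeCut left T).rev d) h2 hh
      obtain ⟨δ, rfl, hδ⟩ := O.exists_first d.under_notMem hu
      rw [CutDart.under_rev, hδ, tail_rev] at hu'
      by_cases hc : O.crossings δ = 0
      · rw [O.head_first_of_uncrossed hc] at hu'
        rw [← Sum.inl_injective hu'] at hβ'
        exact hb δ ⟨hβ, hβ'⟩
      · obtain ⟨w, hw⟩ := O.head_first_of_crossed hc
        rw [hw] at hu'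
        simp at hu'

/-! ### Corners at red vertices -/

/-- The darts at the red vertices on the given side remain. -/
theorem exists_cutDart (hT : IsBlueChoice (O.contracted left) (O.newVertex left) T)
    (hl : G.LoopFree) {e : E} (he : e ∈ O.H.closedSideDarts O.curve left) {v : V} (hv : v ∈ G.red)
    (hev : O.H.tail e = Sum.inl v) : ∃ d : O.CutDart left T, d.under = e := by
  have heC : e ∉ O.H.cycleDarts O.curve := fun h =>
    O.avoids_red v hv (hev ▸ O.cycle.tail_mem_cycleVertices h)
  let x : (((O.H.closedSide O.curve left).edgeDarts (O.sideCurve left))ᶜ : Set _) :=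
    ⟨⟨e, mem_closedSide_subDarts.2 he⟩, fun h => heC (mem_edgeDarts_side.1 h)⟩
  have hxT : x ∉ (O.contracted left).edgeDarts T := fun h =>
    mem_contracted_blue_iff.1 (blue_of_mem_choice hT h) v hv hev
  -- Since a red vertex is merged with nothing, a loop would already exist in the overlay; but a
  -- first piece ends at a white vertex or at the other end of a non-loop.
  have hloop : ((O.contracted left).contract T).tail ⟨x, hxT⟩ ≠
      ((O.contracted left).contract T).head ⟨x, hxT⟩ := by
    intro h
    have h1 := cutVertex_injective hT (u := (O.H.closedSide O.curve left).tail x.1)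
      (u' := (O.H.closedSide O.curve left).head x.1) hv hev (Subtype.ext h)
    have h2 : O.H.head e = Sum.inl v := (congrArg Subtype.val h1).symm.trans hev
    obtain ⟨δ, rfl, rfl⟩ := O.exists_first heC hev
    by_cases hc : O.crossings δ = 0
    · rw [O.head_first_of_uncrossed hc] at h2
      exact hl δ (Sum.inl_injective h2).symm
    · obtain ⟨w, hw⟩ := O.head_first_of_crossed hc
      rw [hw] at h2
      simp at h2
  exact ⟨⟨⟨x, hxT⟩, hloop, fun h => hloop (by rw [head, RotSys.rev_rev] at h; exact h.symm),
    trivial, trivial⟩, rfl⟩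

/-- When the next dart of the overlay face survives, none of the four operations has to skip
anything. -/
theorem edgeCut_face_eq {d d' : O.CutDart left T} (h : O.H.face d.under = d'.under) :
    (O.edgeCut left T).face d = d' := by
  have h1 : (O.H.closedSide O.curve left).face d.1.1.1 = d'.1.1.1 := by
    refine Subtype.ext ((sub_face_eq ?_).trans h)
    exact h ▸ d'.1.1.1.2
  have h2 : (O.contracted left).face d.1.1 = d'.1.1 := by
    refine Subtype.ext ((contract_face_eq ?_).trans h1)
    exact h1 ▸ d'.1.1.2
  have h3 : ((O.contracted left).contract T).face d.1 = d'.1 := by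
    refine Subtype.ext ((contract_face_eq ?_).trans h2)
    exact h2 ▸ d'.1.2
  refine Subtype.ext ((sub_face_eq ?_).trans h3)
  exact h3 ▸ d'.2

/-- At a red vertex the overlay has the cyclic order of `G`. -/
theorem rot_first {d : D} (hd : G.tail d ∈ G.red) : O.H.rot (O.first d) = O.first (G.rot d) := by
  have hmem : O.first d ∈ (O.H.cycleDarts O.curve)ᶜ := O.notMem_curve_of_mem (O.first_mem d)
  have h1 : (firstReturn O.H.rot (O.H.cycleDarts O.curve)ᶜ ⟨O.first d, hmem⟩).1 =
    O.first (G.rot d) := O.pieces_rot d hmem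
  rw [← h1, firstReturn_eq_of_mem]
  intro h
  have h2 := O.cycle.tail_mem_cycleVertices h
  rw [O.plane.tailRot, O.tail_first] at h2
  exact O.avoids_red _ hd h2

variable [Finite V] [Finite W]

theorem edgeCut_isPlane (hT : IsBlueChoice (O.contracted left) (O.newVertex left) T) :
    (O.edgeCut left T).IsPlane := by
  have h1 : (O.contracted left).IsPlane := O.plane.contract_closedSide O.cycle left
  exact (h1.contract_blueChoice hT).deleteLoops

end EdgeCut

end Overlay

end RotSys

/-! ### Corners of the edge-cut compared with corners of `G`. -/

namespace RotSys

namespace Overlay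

section EdgeCut

variable {V D W E : Type*} {G : RotSys V D} [Finite E] {O : G.Overlay W E} {left : Bool}
  {T : Set (((O.H.closedSide O.curve left).edgeDarts (O.sideCurve left))ᶜ : Set _)}

/-- The dart `d` of the edge-cut comes from the first piece of `δ`. -/
def CutDart.IsStart (d : O.CutDart left T) (δ : D) : Prop := d.under = O.first δ

/-- The dart `d` of the edge-cut comes from the last piece of `δ`. -/
def CutDart.IsEnd (d : O.CutDart left T) (δ : D) : Prop := d.under = O.H.rev (O.first (G.rev δ))

theorem CutDart.IsEnd.rev {d : O.CutDart left T} {δ : D} (h : d.IsEnd δ) :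
    CutDart.IsStart ((O.edgeCut left T).rev d) (G.rev δ) := by
  rw [CutDart.IsStart, CutDart.under_rev, h, O.H.rev_rev]

theorem CutDart.IsStart.isEnd {d : O.CutDart left T} {δ : D} (h : d.IsStart δ)
    (hc : O.crossings δ = 0) : d.IsEnd δ := by
  rw [CutDart.IsEnd, ← O.rev_first_of_uncrossed hc, O.H.rev_rev, h]

theorem CutDart.IsStart.head_of_crossed {d : O.CutDart left T} {δ : D} (h : d.IsStart δ)
    (hc : O.crossings δ ≠ 0) : (O.edgeCut left T).head d = O.cutBase left T := by
  obtain ⟨w, hw⟩ := O.head_first_of_crossed hc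
  rw [edgeCut_head d (u := ⟨_, d.head_mem⟩) rfl, cutVertex_eq_base_of_curve]
  change O.H.head d.under ∈ _
  rw [h, hw]
  exact O.white_mem w

theorem CutDart.IsStart.head_red_iff
    (hT : IsBlueChoice (O.contracted left) (O.newVertex left) T) {d : O.CutDart left T} {δ : D}
    (h : d.IsStart δ) : (O.edgeCut left T).head d ∈ (O.edgeCut left T).red ↔
      O.crossings δ = 0 ∧ G.head δ ∈ G.red := by
  rw [edgeCut_head d (u := ⟨_, d.head_mem⟩) rfl, cutVertex_red_iff hT]
  by_cases hc : O.crossings δ = 0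
  · have h1 := O.head_first_of_uncrossed hc
    rw [← h] at h1
    constructor
    · rintro ⟨v, hv, hdv⟩
      refine ⟨hc, ?_⟩
      rwa [Sum.inl_injective (h1.symm.trans hdv)]
    · exact fun h2 => ⟨_, h2.2, h1⟩
  · obtain ⟨w, hw⟩ := O.head_first_of_crossed hc
    rw [← h] at hw
    constructor
    · rintro ⟨v, hv, hdv⟩
      exact absurd (hw.symm.trans hdv) Sum.inr_ne_inl
    · exact fun h => absurd h.1 hc

theorem CutDart.exists_isEnd (hT : IsBlueChoice (O.contracted left) (O.newVertex left) T)
    {d : O.CutDart left T} (h : (O.edgeCut left T).head d ∈ (O.edgeCut left T).red) :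
    ∃ ε, d.IsEnd ε ∧ G.head ε ∈ G.red := by
  rw [edgeCut_head d (u := ⟨_, d.head_mem⟩) rfl, cutVertex_red_iff hT] at h
  obtain ⟨v, hv, hdv⟩ := h
  obtain ⟨δ, rfl, hδ⟩ := O.exists_first (e := O.H.rev d.under)
    (fun h => d.under_notMem (O.rev_mem_curve.1 h)) hdv
  refine ⟨G.rev δ, ?_, by rwa [head_rev]⟩
  rw [CutDart.IsEnd, G.rev_rev, ← hδ, O.H.rev_rev]

/-- The curve avoids red vertices and all darts there survive, so a red corner of the edge-cut is a
corner of `G`, up to cutting the edges further away. -/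
theorem CutDart.IsEnd.face (hG : G.IsPlane) (hl : G.LoopFree)
    (hT : IsBlueChoice (O.contracted left) (O.newVertex left) T) {d : O.CutDart left T} {ε : D}
    (h : d.IsEnd ε) (hε : G.head ε ∈ G.red) :
    CutDart.IsStart ((O.edgeCut left T).face d) (G.face ε) := by
  have ht : G.tail (G.face ε) ∈ G.red := by rwa [hG.tailRot.tail_face]
  have h1 : O.H.face d.under = O.first (G.face ε) := by
    rw [h, face_apply, O.H.rev_rev, Equiv.Perm.inv_eq_iff_eq, rot_first ht, rot_face]
  have h2 : O.H.tail (O.first (G.face ε)) = Sum.inl (G.tail (G.face ε)) := O.tail_first _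
  have h3 : O.H.tail (O.first (G.face ε)) ∈ O.H.closedSideVertices O.curve left := by
    rw [← h1, O.plane.tailRot.tail_face]
    exact d.head_mem
  obtain ⟨d', hd'⟩ := exists_cutDart hT hl
    (O.plane.mem_closedSideDarts_of_tail O.cycle h3 (h2 ▸ O.avoids_red _ ht)).2 ht h2
  rw [edgeCut_face_eq (h1.trans hd'.symm)]
  exact hd'

/-- If the blue head is off the curve but one of its edges is crossed, the first piece of that edge
joins it to the curve on the same side, and the choice of contracted edges merges it into the new
vertex. -/
theorem CutDart.IsStart.head_of_touches
    (hT : IsBlueChoice (O.contracted left) (O.newVertex left) T) {d : O.CutDart left T} {δ : D}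
    (h : d.IsStart δ) (hb : G.head δ ∈ G.blue) (ht : O.Touches (G.head δ)) :
    (O.edgeCut left T).head d = O.cutBase left T := by
  by_cases hc : O.crossings δ = 0
  · have h1 := O.head_first_of_uncrossed hc
    rw [← h] at h1
    rw [edgeCut_head d (u := ⟨_, d.head_mem⟩) rfl]
    by_cases hoff : O.H.head d.under ∈ O.H.cycleVertices O.curve
    · exact cutVertex_eq_base_of_curve hoff
    · rcases ht with ht | ⟨η, hη, hηc⟩
      · exact absurd (h1 ▸ ht) hoff
      · have h2 : O.H.tail (O.first η) = O.H.head d.under := by rw [h1, O.tail_first, hη]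
        obtain ⟨h3, h4⟩ := O.plane.mem_closedSideDarts_of_tail O.cycle (e := O.first η)
          (h2 ▸ d.head_mem) (h2 ▸ hoff)
        obtain ⟨w, hw⟩ := O.head_first_of_crossed hηc
        exact cutVertex_eq_base_of_adj hT hb h1 h4 h3 h2 (hw ▸ O.white_mem w)
  · exact h.head_of_crossed hc

/-- Darts with a common blue head stay together: touched heads go to the new vertex, while at an
untouched one no edge is crossed. -/
theorem CutDart.IsStart.head_eq
    (hT : IsBlueChoice (O.contracted left) (O.newVertex left) T) {d d' : O.CutDart left T}
    {δ δ' : D} (h : d.IsStart δ) (h' : d'.IsStart δ') (hb : G.head δ ∈ G.blue)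
    (heq : G.head δ' = G.head δ) :
    (O.edgeCut left T).head d = (O.edgeCut left T).head d' := by
  by_cases ht : O.Touches (G.head δ)
  · rw [h.head_of_touches hT hb ht, h'.head_of_touches hT (heq ▸ hb) (heq ▸ ht)]
  · have hun : ∀ ε, G.head ε = G.head δ → O.crossings ε = 0 := fun ε hε => by
      by_contra hc
      exact ht (Or.inr ⟨G.rev ε, hε, by rwa [O.crossings_rev]⟩)
    have h1 := O.head_first_of_uncrossed (hun δ rfl)
    have h2 := O.head_first_of_uncrossed (hun δ' heq)
    rw [← h] at h1
    rw [← h', heq] at h2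
    rw [edgeCut_head d (u := ⟨_, d.head_mem⟩) rfl,
      edgeCut_head d' (u := ⟨_, d.head_mem⟩) (h1.trans h2.symm)]

theorem pieces_first_injective {δ δ' : D} (h : O.first δ = O.first δ') : δ = δ' :=
  O.pieces_unique _ _ _ (O.first_mem δ) (h ▸ O.first_mem δ')

variable [Finite D] [Finite V] [Finite W] {n : ℕ} [NeZero n] {γ : Fin n → D}

/-- Each red corner comes from a corner of `G`. A blue neighbour in the cut is either a blue
neighbour in `G` or the new vertex at the end of a crossed edge; `IsPushOff.touches` and
`IsPushOff.red_face_not_isolated` ensure that the blue ends required to coincide do so at the new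
vertex. -/
theorem IsPushOff.edgeCut_locallyTriangulated (hO : O.IsPushOff γ) (hG : G.IsBRT)
    (hγ : G.IsCycle γ) (hT : IsBlueChoice (O.contracted left) (O.newVertex left) T) :
    (O.edgeCut left T).LocallyTriangulated := by
  have hP := hG.plane
  have hl : G.LoopFree := hG.no_loop
  have hL := hG.locallyTriangulated
  have ht := hP.tailRot
  -- the corner at the head of `d` comes from the corner at the head of `ε`
  have corner : ∀ d : O.CutDart left T,
      (O.edgeCut left T).head d ∈ (O.edgeCut left T).red → ∃ ε, G.head ε ∈ G.red ∧ d.IsEnd ε ∧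
        CutDart.IsStart ((O.edgeCut left T).face d) (G.face ε) := fun d hd => by
    obtain ⟨ε, h1, h2⟩ := CutDart.exists_isEnd hT hd
    exact ⟨ε, h2, h1, h1.face hP hl hT h2⟩
  have tail_red : ∀ (d : O.CutDart left T) (ε : D), d.IsEnd ε →
      ((O.edgeCut left T).tail d ∈ (O.edgeCut left T).red ↔
        O.crossings ε = 0 ∧ G.tail ε ∈ G.red) := fun d ε h => by
    have := h.rev.head_red_iff hT
    rwa [head_rev, head_rev, O.crossings_rev] at this
  refine ⟨fun x hx => ?_, fun d hd h => ?_, ?_, ?_, ?_⟩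
  · obtain ⟨u, rfl⟩ := exists_cutVertex x
    obtain ⟨v, hv, hu⟩ := (cutVertex_red_iff hT).1 hx
    obtain ⟨δ, rfl⟩ := hL.exists_dart v hv
    have h1 : O.H.tail (O.first δ) = u.1 := (O.tail_first δ).trans hu.symm
    have h2 := O.plane.mem_closedSideDarts_of_tail O.cycle (e := O.first δ) (left := left)
      (h1 ▸ u.2) (by rw [h1, hu]; exact O.avoids_red _ hv)
    obtain ⟨d, hd⟩ := exists_cutDart hT hl h2.2 hv (O.tail_first δ)
    exact ⟨d, edgeCut_tail d (by rw [hd, h1])⟩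
  · obtain ⟨ε, hε, he, hs⟩ := corner d hd
    refine hL.face_ne ε hε (pieces_first_injective (O := O) ?_)
    rw [← hs, h]
    exact he.rev
  · intro (d : O.CutDart left T) h1 h2 h3
    obtain ⟨ε, hε, he, hs⟩ := corner d h2
    rw [← notMem_red, tail_red d ε he] at h1
    rw [← notMem_red, hs.head_red_iff hT] at h3
    have htd : (O.edgeCut left T).tail d = (O.edgeCut left T).head ((O.edgeCut left T).rev d) :=
      (head_rev _ d).symm
    rw [htd]
    by_cases hu : G.tail ε ∈ G.red
    · have hc : O.crossings ε ≠ 0 := fun h => h1 ⟨h, hu⟩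
      rw [he.rev.head_of_crossed (by rwa [O.crossings_rev])]
      by_cases hw : G.head (G.face ε) ∈ G.red
      · exact hs.head_of_crossed fun h => h3 ⟨h, hw⟩
      · rw [notMem_red] at hw
        -- The triangle is read from its blue corner, one dart earlier; its red edge is crossed, so
        -- this corner merges into the new vertex as well.
        obtain ⟨y, rfl⟩ := G.face.surjective ε
        rw [ht.tail_face] at hu
        refine hs.head_of_touches hT hw ?_
        by_cases hy : G.tail y ∈ G.red
        · exfalso
          rcases hL.red_face y hy hu hε with h | h
          · rw [h] at hw
            exact hu hw
          · rw [← ht.tail_face, h] at hw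
            exact hy hw
        · rw [notMem_red] at hy
          have htri := hL.triangle y hy hu hε
          rw [htri]
          exact hO.touches hP hγ hy hu hε htri (by rw [← ht.tail_face y]; exact (hl _).symm) hc
    · rw [notMem_red] at hu
      by_cases hw : G.head (G.face ε) ∈ G.red
      · have hc : O.crossings (G.face ε) ≠ 0 := fun h => h3 ⟨h, hw⟩
        rw [hs.head_of_crossed hc]
        refine (he.rev.head_of_touches hT (by rwa [head_rev]) ?_).symm
        rw [head_rev]
        exact hO.touches hP hγ hu hε hw (hL.triangle ε hu hε hw)
          (by rw [← ht.tail_face ε]; exact (hl _).symm) hc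
      · refine (he.rev.head_eq hT hs (by rwa [head_rev]) ?_).symm
        rw [head_rev]
        exact hL.digon ε hu hε (notMem_red.1 hw)
  · intro (d : O.CutDart left T) h1 h2 h3
    obtain ⟨ε, hε, he, hs⟩ := corner d h2
    rw [← notMem_red, tail_red d ε he] at h1
    rw [hs.head_red_iff hT] at h3
    have hs2 := (hs.isEnd h3.1).face hP hl hT h3.2
    have htd : (O.edgeCut left T).tail d = (O.edgeCut left T).head ((O.edgeCut left T).rev d) :=
      (head_rev _ d).symm
    rw [htd]
    by_cases hu : G.tail ε ∈ G.red
    · have hc : O.crossings ε ≠ 0 := fun h => h1 ⟨h, hu⟩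
      rw [he.rev.head_of_crossed (by rwa [O.crossings_rev])]
      refine hs2.head_of_crossed fun hc2 => ?_
      -- In a red face whose first edge is crossed and whose second is not, the third must be
      -- crossed, so both cut edges end at the new vertex.
      refine hO.red_face_not_isolated hP hu hε h3.2 (hL.red_face ε hu hε h3.2)
        (Or.inl rfl) hc ?_
      rintro _ (rfl | rfl | rfl) h
      · rfl
      · exact absurd h3.1 h
      · exact absurd hc2 h
    · rw [notMem_red] at hu
      refine (he.rev.head_eq hT hs2 (by rwa [head_rev]) ?_).symm
      rw [head_rev]
      exact hL.triangle ε hu hε h3.2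
  · intro (d : O.CutDart left T) h1 h2 h3
    obtain ⟨ε, hε, he, hs⟩ := corner d h2
    rw [tail_red d ε he] at h1
    rw [hs.head_red_iff hT] at h3
    have hs2 := (hs.isEnd h3.1).face hP hl hT h3.2
    have hd : d.under = O.first ε := by
      rw [he, O.rev_first_of_uncrossed (by rw [O.crossings_rev, h1.1]), G.rev_rev]
    rcases hL.red_face ε h1.2 hε h3.2 with h | h
    · left
      rw [h] at hs2
      exact CutDart.under_injective (hs2.trans hd.symm)
    · right
      have hr : G.head (G.face (G.face ε)) ∈ G.red := by
        rw [← ht.tail_face, h]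
        exact h1.2
      have hc : O.crossings (G.face (G.face ε)) = 0 := by
        by_contra hc
        -- With two uncrossed edges the third is uncrossed too, so the red triangle survives intact.
        refine hO.red_face_not_isolated hP h1.2 hε h3.2 (Or.inr h) (Or.inr (Or.inr rfl)) hc ?_
        rintro _ (rfl | rfl | rfl) h'
        · exact absurd h1.1 h'
        · exact absurd h3.1 h'
        · rfl
      have hs3 := (hs2.isEnd hc).face hP hl hT hr
      rw [h] at hs3
      exact CutDart.under_injective (hs3.trans hd.symm)

/-- An edge-cut along a push-off of a cycle yields BRT-graphs. -/
theorem IsPushOff.edgeCut_isBRT (hO : O.IsPushOff γ) (hG : G.IsBRT) (hγ : G.IsCycle γ)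
    (hT : IsBlueChoice (O.contracted left) (O.newVertex left) T) : (O.edgeCut left T).IsBRT :=
  (hO.edgeCut_locallyTriangulated hG hγ hT).isBRT (edgeCut_isPlane hT) edgeCut_loopFree
    (edgeCut_noBlueBlue hT hG.no_blue_blue)

end EdgeCut

end Overlay

end RotSys

/-! ### The lemma for both kinds of cut. -/

theorem mainTheorem9 {V D : Type*} [Finite V] [Finite D] (G : RotSys V D) (hG : G.IsBRT) :
    (∀ v : V, G.IsCutVertex v → ∀ I : Set (G.Branch v), I ≠ Set.univ →
      (G.induce (G.branchSet v I)).IsBRT ∧ (G.induce (G.branchSet v Iᶜ)).IsBRT) ∧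
    (∀ (n : ℕ) [NeZero n] (γ : Fin n → D), G.IsNormalCycle γ →
      ∀ (W E : Type*) [Finite W] [Finite E] (O : G.Overlay W E), O.IsPushOff γ →
        ∀ T₁ T₂, RotSys.IsBlueChoice (O.contracted true) (O.newVertex true) T₁ →
          RotSys.IsBlueChoice (O.contracted false) (O.newVertex false) T₂ →
          (O.edgeCut true T₁).IsBRT ∧ (O.edgeCut false T₂).IsBRT) := by
  refine ⟨fun v hv I _ => ⟨hG.vertexCut hv I, hG.vertexCut hv Iᶜ⟩, ?_⟩
  intro n _ γ hγ W E _ _ O hO T₁ T₂ hT₁ hT₂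
  exact ⟨hO.edgeCut_isBRT hG hγ.cycle hT₁, hO.edgeCut_isBRT hG hγ.cycle hT₂⟩
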